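/- Let $\Omega_0=\{(\alpha,\beta)\in\mathbb{C}^2:\ \Re(\alpha+\beta)>-1,\ \Re(\alpha-\beta)>0\}$ and, for $n\in\mathbb{N}_0$, $$P_n(z;\alpha,\beta)={}_2F_1(-n,\alpha+\beta+1;2\alpha+1;1-z).$$ Powers $z^{\gamma}$ are principal (with $\arg z\in(-\pi,\pi]$), $(a)_k=a(a+1)\cdots(a+k-1)$, $B(a,b)=\Gamma(a)\Gamma(b)/\Gamma(a+b)$ and $\binom{a}{k}=\frac{\Gamma(a+1)}{\Gamma(k+1)\Gamma(a-k+1)}$. For $(\alpha,\beta)\in\Omega_0$ and $z\in\mathbb{C}\setminus\{1\}$ put $$g_{1,n}=\frac{\Gamma(2\alpha+1)}{\Gamma(\alpha+\beta+1)}\frac{\Gamma(n+1)}{\Gamma(n+\alpha-\beta+1)}z^{n+\alpha-\beta}(z-1)^{\beta-\alpha},\qquad a_{1,k}(n)=\binom{\alpha+\beta}{k}\Big(\frac{z}{1-z}\Big)^{k}\frac{\Gamma(k+\alpha-\beta)}{\Gamma(\alpha-\beta)}\frac{1}{(n+1+\alpha-\beta)_k},$$ $$g_{2,n}=\frac{\Gamma(2\alpha+1)}{\Gamma(\alpha-\beta)}\frac{\Gamma(n+1)}{\Gamma(n+\alpha+\beta+2)}(1-z)^{-\alpha-\beta-1},\qquad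 a_{2,k}(n)=\binom{\alpha-\beta-1}{k}\frac{1}{(z-1)^{k}}\frac{\Gamma(k+\alpha+\beta+1)}{\Gamma(\alpha+\beta+1)}\frac{1}{(n+2+\alpha+\beta)_k},$$ and define the remainders $$\xi_{1,n,p}(z;\alpha,\beta)=\frac{1}{B(n+1,\alpha-\beta)}\Big(\frac{z}{1-z}\Big)^{p+1}\int_0^1t^n(1-t)^{p+\alpha-\beta}\,r_p\Big(1-t;\frac{z}{1-z},\alpha+\beta\Big)dt,$$ $$\xi_{2,n,p}(z;\alpha,\beta)=\frac{1}{B(n+1,\alpha+\beta+1)}\frac{1}{(z-1)^{p+1}}\int_0^1t^n(1-t)^{p+1+\alpha+\beta}\,r_p\Big(1-t;\frac{1}{z-1},\alpha-\beta-1\Big)dt,$$ $$r_p(u;\psi,\gamma)=\frac{(1+\psi u)^{\gamma}-\sum_{k=0}^{p}\binom{\gamma}{k}(\psi u)^k}{(\psi u)^{p+1}}\quad(r_p=0\text{ if }\psi=0),$$ where in $r_p$ the power is principal, except that $\arg(1+\psi u)=-\pi$ is used when $1+\psi u<0$. Then: (i) For all $n,p_1,p_2\in\mathbb{N}_0$,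 $z\in\mathbb{C}\setminus\{1\}$ and $(\alpha,\beta)\in\Omega_0$, $$P_n(z;\alpha,\beta)=g_{1,n}\Big(\sum_{k=0}^{p_1}a_{1,k}(n)+\xi_{1,n,p_1}\Big)+g_{2,n}\Big(\sum_{k=0}^{p_2}a_{2,k}(n)+\xi_{2,n,p_2}\Big).$$ (ii) This is a compound asymptotic expansion of Poincaré type as $n\to\infty$, uniformly for $z$ in compact subsets of $\mathbb{C}\setminus\{1\}$ and $(\alpha,\beta)$ in compact subsets of $\Omega_0$: for every $p\in\mathbb{N}_0$ and $i=1,2$, $\xi_{i,n,p}=O(a_{i,p+1}(n))$ as $n\to\infty$, with an $O$-constant and a threshold for $n$ that depend only on $p$ and the two compact sets. (iii) For all $n,p\in\mathbb{N}_0$, $z\in\mathbb{C}\setminus\{1\}$ and $(\alpha,\beta)\in\Omega_0$, $$|\xi_{1,n,p}|\le\frac{1}{(n+1+\Re(\alpha-\beta))_{p+1}}\frac{\Gamma(p+1+\Re(\alpha-\beta))}{|\Gamma(\alpha-\beta)|}\Big|\frac{z}{1-z}\Big|^{p+1}c_1,\qquad |\xi_{2,n,p}|<\frac{1}{(n+2+\Re(\alpha+\beta))_{p+1}}\frac{\Gamma(p+2+\Re(\alpha+\beta))}{|\Gamma(\alpha+\beta+1)|}\frac{1}{|z-1|^{p+1}}c_2,$$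 where $$c_1=\begin{cases}m_1\big(\frac{z}{1-z};\alpha+\beta\big)+p\,e^{|\alpha+\beta|^2+\Re(\alpha+\beta)}+1,&\Re(\alpha+\beta)\ge0,\\[2pt] m_2(z;p-2\beta,\alpha+\beta)\frac{\Gamma(p+1-2\Re\beta)}{\Gamma(p+1+\Re(\alpha-\beta))}\frac{\Gamma(n+p+2+\Re(\alpha-\beta))}{\Gamma(n+p+2-2\Re\beta)}+m_3(p,\alpha+\beta),&-1<\Re(\alpha+\beta)<0,\end{cases}$$ $$c_2=\begin{cases}m_1\big(\frac{1}{z-1};\alpha-\beta-1\big)+p\,e^{|\alpha-\beta-1|^2+\Re(\alpha-\beta)-1}+1,&\Re(\alpha-\beta)\ge1,\\[2pt] m_2(z^{-1};p+2\beta+2,\alpha-\beta-1)\frac{\Gamma(p+2\Re\beta+3)}{\Gamma(p+\Re(\alpha+\beta)+2)}\frac{\Gamma(n+p+3+\Re(\alpha+\beta))}{\Gamma(n+p+2\Re\beta+4)}+m_3(p,\alpha-\beta+1),&0<\Re(\alpha-\beta)<1,\end{cases}$$ $$m_1(z;\gamma)=e^{\pi|\Im\gamma|}\max\big(2^{\Re\gamma},(1+|z|)^{\Re\gamma}\big),\qquad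 m_2(z;q,\gamma)=e^{\pi|\Im\gamma|}\frac{(|z|+1)^{1+\Re\gamma}}{|z-1|\,|z|^{\Re\gamma}}\Big(1+2\Big|\frac{q+1}{\gamma+1}\Big|\Big),$$ $$m_3(p,\gamma)=\max\Big(e^{-\pi\Im\gamma}|p-\gamma+1|+1+p\,e^{|\gamma|^2+\Re\gamma},\ 1+\Big|\frac{\sin\pi\gamma}{\pi(1+\Re\gamma)}\Big|\Big),$$ with $m_2(\infty;q,\gamma)=\lim_{z\to\infty}m_2(z;q,\gamma)$ (this is the value of $m_2(z^{-1};\cdot,\cdot)$ at $z=0$). -/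

import Mathlib

noncomputable section

namespace BiorthAsymp

/-- The parameter domain `Ω₀ = {(α, β) ∈ ℂ² : -1 < Re (α + β), 0 < Re (α - β)}`. -/
def Omega0 : Set (ℂ × ℂ) :=
  {q | -1 < (q.1 + q.2).re ∧ 0 < (q.1 - q.2).re}

/-- `P_n(z; α, β) = ₂F₁(-n, α + β + 1; 2α + 1; 1 - z)`, a polynomial in `z` (the hypergeometric
series terminates). -/
def P (n : ℕ) (z α β : ℂ) : ℂ :=
  ordinaryHypergeometric (-(n : ℂ)) (α + β + 1) (2 * α + 1) (1 - z)

/-- The generalized binomial coefficient `Γ(a+1) / (Γ(b+1) Γ(a-b+1))`. (`Complex.Gamma` is `0` at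
the poles of `Γ`, so the quotient is `0` where `1 / Γ(a-b+1)` vanishes, as it should be.) -/
def gbinom (a b : ℂ) : ℂ :=
  Complex.Gamma (a + 1) / (Complex.Gamma (b + 1) * Complex.Gamma (a - b + 1))

/-- The Beta function `B(a, b) = Γ(a) Γ(b) / Γ(a+b)`. -/
def beta (a b : ℂ) : ℂ :=
  Complex.Gamma a * Complex.Gamma b / Complex.Gamma (a + b)

/-- The Pochhammer symbol `(a)_k = a (a+1) ⋯ (a+k-1)`. -/
def poch {R : Type*} [Semiring R] (a : R) (k : ℕ) : R :=
  (ascPochhammer R k).eval a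

/-- The prefactor of the first series. -/
def g1 (n : ℕ) (z α β : ℂ) : ℂ :=
  Complex.Gamma (2 * α + 1) / Complex.Gamma (α + β + 1) *
    (Complex.Gamma (n + 1) / Complex.Gamma (n + α - β + 1)) *
    z ^ ((n : ℂ) + α - β) * (z - 1) ^ (β - α)

/-- The prefactor of the second series. -/
def g2 (n : ℕ) (z α β : ℂ) : ℂ :=
  Complex.Gamma (2 * α + 1) / Complex.Gamma (α - β) *
    (Complex.Gamma (n + 1) / Complex.Gamma (n + α + β + 2)) *
    (1 - z) ^ (-α - β - 1)

/-- The `k`-th term of the first inverse factorial series. -/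
def term1 (k n : ℕ) (z α β : ℂ) : ℂ :=
  gbinom (α + β) k * (z / (1 - z)) ^ k *
    (Complex.Gamma (k + α - β) / Complex.Gamma (α - β)) * (1 / poch (n + 1 + α - β) k)

/-- The `k`-th term of the second inverse factorial series. -/
def term2 (k n : ℕ) (z α β : ℂ) : ℂ :=
  gbinom (α - β - 1) k * (1 / (z - 1) ^ k) *
    (Complex.Gamma (k + α + β + 1) / Complex.Gamma (α + β + 1)) *
    (1 / poch (n + 2 + α + β) k)

/-- The power `w ^ γ` for the branch `-π ≤ arg w < π`: it is the principal power off the negative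
real axis, and the boundary value from below (`arg w = -π`) on it. -/
def powLower (w γ : ℂ) : ℂ := (w⁻¹) ^ (-γ)

/-- The normalized remainder of the binomial series,
`r_p(u; ψ, γ) = ((1 + ψ u)^γ - ∑_{k ≤ p} binom(γ, k) (ψ u)^k) / (ψ u)^(p+1)`;
it is `0` if `ψ = 0` or `γ = 0`. (The value at the single point `u = 0` is never used: `r` only
occurs under an integral over `u ∈ (0, 1)`.) -/
def r (p : ℕ) (u ψ γ : ℂ) : ℂ :=
  (powLower (1 + ψ * u) γ - ∑ k ∈ Finset.range (p + 1), gbinom γ k * (ψ * u) ^ k) /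
    (ψ * u) ^ (p + 1)

/-- The remainder `ξ_{1,n,p}` of the first series. -/
def xi1 (n p : ℕ) (z α β : ℂ) : ℂ :=
  1 / beta (n + 1) (α - β) * (z / (1 - z)) ^ (p + 1) *
    ∫ t in (0 : ℝ)..1, (t : ℂ) ^ n * (1 - (t : ℂ)) ^ ((p : ℂ) + α - β) *
      r p (1 - (t : ℂ)) (z / (1 - z)) (α + β)

/-- The remainder `ξ_{2,n,p}` of the second series. -/
def xi2 (n p : ℕ) (z α β : ℂ) : ℂ :=
  1 / beta (n + 1) (α + β + 1) * (1 / (z - 1) ^ (p + 1)) *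
    ∫ t in (0 : ℝ)..1, (t : ℂ) ^ n * (1 - (t : ℂ)) ^ ((p : ℂ) + 1 + α + β) *
      r p (1 - (t : ℂ)) (1 / (z - 1)) (α - β - 1)

/-- `m₁(z; γ)`. -/
def m1 (z γ : ℂ) : ℝ :=
  Real.exp (Real.pi * |γ.im|) * max ((2 : ℝ) ^ γ.re) ((1 + ‖z‖) ^ γ.re)

/-- `m₂(z; q, γ)` for `z` in the Riemann sphere; the value at `∞` is the limit as `z → ∞`, see
`tendsto_m2`. -/
def m2 (z : OnePoint ℂ) (q γ : ℂ) : ℝ :=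
  match z with
  | none => Real.exp (Real.pi * |γ.im|) * (1 + 2 * ‖(q + 1) / (γ + 1)‖)
  | some z => Real.exp (Real.pi * |γ.im|) *
      ((‖z‖ + 1) ^ (1 + γ.re) / (‖z - 1‖ * ‖z‖ ^ γ.re)) * (1 + 2 * ‖(q + 1) / (γ + 1)‖)

/-- `m₃(p, γ)`. -/
def m3 (p : ℕ) (γ : ℂ) : ℝ :=
  max (Real.exp (-Real.pi * γ.im) * ‖(p : ℂ) - γ + 1‖ + 1 + p * Real.exp (‖γ‖ ^ 2 + γ.re))
    (1 + ‖Complex.sin (Real.pi * γ) / (Real.pi * (1 + γ.re))‖)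

/-- `z⁻¹` as a point of the Riemann sphere, with `0⁻¹ = ∞`. -/
def sphereInv (z : ℂ) : OnePoint ℂ :=
  if z = 0 then OnePoint.infty else ((z⁻¹ : ℂ) : OnePoint ℂ)

/-- The last factor of the bound for `ξ_{1,n,p}`; for `(α, β) ∈ Ω₀` the second case is
`-1 < Re (α + β) < 0`. -/
def c1 (n p : ℕ) (z α β : ℂ) : ℝ :=
  if 0 ≤ (α + β).re then
    m1 (z / (1 - z)) (α + β) + p * Real.exp (‖α + β‖ ^ 2 + (α + β).re) + 1
  else
    m2 (z : OnePoint ℂ) (p - 2 * β) (α + β) *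
        (Real.Gamma (p + 1 - 2 * β.re) / Real.Gamma (p + 1 + (α - β).re)) *
        (Real.Gamma (n + p + 2 + (α - β).re) / Real.Gamma (n + p + 2 - 2 * β.re)) +
      m3 p (α + β)

/-- The last factor of the bound for `ξ_{2,n,p}`; for `(α, β) ∈ Ω₀` the second case is
`0 < Re (α - β) < 1`. -/
def c2 (n p : ℕ) (z α β : ℂ) : ℝ :=
  if 1 ≤ (α - β).re then
    m1 (1 / (z - 1)) (α - β - 1) + p * Real.exp (‖α - β - 1‖ ^ 2 + (α - β).re - 1) + 1
  else
    m2 (sphereInv z) (p + 2 * β + 2) (α - β - 1) *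
        (Real.Gamma (p + 2 * β.re + 3) / Real.Gamma (p + (α + β).re + 2)) *
        (Real.Gamma (n + p + 3 + (α + β).re) / Real.Gamma (n + p + 2 * β.re + 4)) +
      m3 p (α - β + 1)

open Filter Topology in
/-- The value of `m₂` at `∞` is its limit. -/
theorem tendsto_m2 (q γ : ℂ) :
    Tendsto (fun z : ℂ => m2 (z : OnePoint ℂ) q γ) (cocompact ℂ)
      (𝓝 (m2 OnePoint.infty q γ)) := by
  have hn : Tendsto (fun z : ℂ => ‖z‖) (cocompact ℂ) atTop := tendsto_norm_cocompact_atTop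
  have hi : Tendsto (fun z : ℂ => z⁻¹) (cocompact ℂ) (𝓝 0) := by
    rw [← Metric.cobounded_eq_cocompact]
    exact Filter.tendsto_inv₀_cobounded
  have h1 : Tendsto (fun z : ℂ => (1 + ‖z⁻¹‖) ^ (1 + γ.re) / ‖1 - z⁻¹‖) (cocompact ℂ) (𝓝 1) := by
    have e : (1 : ℝ) = (1 + ‖(0 : ℂ)‖) ^ (1 + γ.re) / ‖1 - (0 : ℂ)‖ := by simp
    have ha : Tendsto (fun z : ℂ => (1 + ‖z⁻¹‖) ^ (1 + γ.re)) (cocompact ℂ)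
        (𝓝 ((1 + ‖(0 : ℂ)‖) ^ (1 + γ.re))) :=
      (tendsto_const_nhds.add hi.norm).rpow_const (Or.inl (by simp))
    have hb : Tendsto (fun z : ℂ => ‖1 - z⁻¹‖) (cocompact ℂ) (𝓝 ‖1 - (0 : ℂ)‖) :=
      (tendsto_const_nhds.sub hi).norm
    have h := ha.div hb (by simp)
    rwa [← e] at h
  have h2 : Tendsto (fun z : ℂ => (‖z‖ + 1) ^ (1 + γ.re) / (‖z - 1‖ * ‖z‖ ^ γ.re))
      (cocompact ℂ) (𝓝 1) := by
    refine h1.congr' ?_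
    filter_upwards [hn.eventually_gt_atTop 0] with z hz
    have hz0 : z ≠ 0 := norm_pos_iff.mp hz
    have a1 : ‖z‖ + 1 = ‖z‖ * (1 + ‖z⁻¹‖) := by
      rw [norm_inv]; field_simp
    have a2 : ‖z - 1‖ = ‖z‖ * ‖1 - z⁻¹‖ := by
      rw [← norm_mul]; congr 1; field_simp
    rw [a1, a2, Real.mul_rpow hz.le (by positivity), Real.rpow_add hz, Real.rpow_one]
    have : ‖z‖ ^ γ.re ≠ 0 := (Real.rpow_pos_of_pos hz _).ne'
    by_cases h : ‖1 - z⁻¹‖ = 0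
    · simp [h]
    · field_simp
  have h3 := (h2.const_mul (Real.exp (Real.pi * |γ.im|))).mul_const
    (1 + 2 * ‖(q + 1) / (γ + 1)‖)
  rw [mul_one] at h3
  exact h3

end BiorthAsymp

end

noncomputable section

namespace BiorthAsymp

/-! Exact formula. Euler's integral expresses `B(α+β+1, α-β) P_n` as `∫₀¹ s^(α+β) (1-s)^(α-β-1)
(1-(1-z)s)^n ds`. For `z < 0` the last factor vanishes at `s₀ = 1/(1-z)` inside `(0,1)`. Cutting
there and rescaling both pieces to `[0,1]` gives two integrals of one type, `K = ∫ (1-u)^n u^(a-1)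
(1+ψu)^γ du`, with `(a, γ, ψ) = (α-β, α+β, z/(1-z))` and `(α+β+1, α-β-1, 1/(z-1))`. Both sides are
analytic off `[0,∞)`. The points of `[0,∞)` other than `0` and `1` are reached as boundary values,
because `K` is continuous up to its cut from `Im ψ ≤ 0`, the side of the branch `arg = -π`; the
point `0` is checked directly (`eulerInt_eq_branchSum`). Expanding `(1+ψu)^γ` binomially under the
integral yields Beta values, hence the inverse factorial terms, and leaves the integral `J` of the
normalized remainder (`sum_add_remainder`). Everything else is an estimate of `J`.

Order of the remainder. In the variable `ℓ = log(1+ψu)` the derivative of a binomial remainder is a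
remainder of lower order with exponent `γ-1`. Iterating gives a bound proportional to `bc γ (p+1)`,
as is necessary because the first omitted term carries this factor and may vanish
(`norm_binomRem_le`). The zero of `1+ψu` leaves an integrable singularity, uniformly in its
position, and it can only matter where `u` is bounded below, so that `(1-u)^n` is small against the
Beta integral (`exists_norm_J_le`).

Explicit bounds. If `Re γ ≥ 0`, the remainder is analytic in `x = ψu` on the unit disc; the maximum
principle there and the triangle inequality outside bound it pointwise (`norm_r_le_m1`). If `-1 < Re
γ < 0`, it may be unbounded. One more term is split off, `J_p = bc γ (p+1) B(n+1, a+p+1) + ψ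
J_(p+1)`, and `J_(p+1)` is bounded uniformly in `ψ`. In `ζ = √(1+ψ)` it becomes a bounded analytic
function on the right half-plane, so by Phragmén–Lindelöf only the lips `ψ = -T`, `T ≥ 1`, of the
cut matter (`norm_J_le_of_lip_le`). On a lip the integrand is compared with the derivative of an
explicit primitive that carries the singularity. The difference has a majorant whose integral is
again a Beta value (`norm_J_le_of_lip`). This rests on bounds for the Taylor tails of `(1-s)^(w-1)`,
`w = γ+1`, and on numerical inequalities in `Re w` and `|Im w|`. -/

open Complex in
theorem norm_Gamma_le {s : ℂ} (hs : 0 < s.re) : ‖Complex.Gamma s‖ ≤ Real.Gamma s.re := by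
  rw [Complex.Gamma_eq_integral hs, Real.Gamma_eq_integral hs, Complex.GammaIntegral]
  refine (MeasureTheory.norm_integral_le_integral_norm _).trans (le_of_eq ?_)
  refine MeasureTheory.setIntegral_congr_fun measurableSet_Ioi fun x hx => ?_
  have hx : 0 < x := hx
  simp only [norm_mul, Complex.norm_real, Real.norm_eq_abs, Real.abs_exp]
  rw [Complex.norm_cpow_eq_rpow_re_of_pos hx]
  simp

/-! ### Binomial coefficients -/

/-- The binomial coefficient `γ (γ - 1) ⋯ (γ - k + 1) / k!`. -/
def bc (γ : ℂ) (k : ℕ) : ℂ := ∏ j ∈ Finset.range k, (γ - j) / (j + 1)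

@[simp] theorem bc_zero (γ : ℂ) : bc γ 0 = 1 := by simp [bc]

theorem bc_succ (γ : ℂ) (k : ℕ) : bc γ (k + 1) = bc γ k * ((γ - k) / (k + 1)) := by
  rw [bc, bc, Finset.prod_range_succ]

@[simp] theorem bc_one (γ : ℂ) : bc γ 1 = γ := by simp [bc]

theorem succ_mul_bc_succ (γ : ℂ) (k : ℕ) : (k + 1) * bc γ (k + 1) = γ * bc (γ - 1) k := by
  induction k with
  | zero => simp
  | succ k ih =>
    have h1 : ((k : ℂ) + 1) ≠ 0 := by exact_mod_cast k.succ_ne_zero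
    have h2 : ((k : ℂ) + 1 + 1) ≠ 0 := by exact_mod_cast (k + 1).succ_ne_zero
    rw [bc_succ γ (k + 1), bc_succ (γ - 1) k]
    push_cast
    have : ((k : ℂ) + 1 + 1) * (bc γ (k + 1) * ((γ - (k + 1)) / (k + 1 + 1))) =
        ((k + 1) * bc γ (k + 1)) * ((γ - (k + 1)) / (k + 1)) := by
      field_simp
    rw [this, ih]
    ring

theorem bc_eq_choose (γ : ℂ) (k : ℕ) : bc γ k = Ring.choose γ k := by
  have h := Ring.descPochhammer_eq_factorial_smul_choose γ k
  have h2 : ∀ m : ℕ, (m.factorial : ℂ) * bc γ m = (descPochhammer ℤ m).smeval γ := by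
    intro m
    induction m with
    | zero => simp
    | succ m ih =>
      rw [descPochhammer_succ_right, Polynomial.smeval_mul, ← ih, bc_succ, Nat.factorial_succ]
      have h1 : ((m : ℂ) + 1) ≠ 0 := by exact_mod_cast m.succ_ne_zero
      simp [Polynomial.smeval_sub, Polynomial.smeval_X, Polynomial.smeval_natCast]
      field_simp
  have h3 := h2 k
  rw [h, nsmul_eq_mul] at h3
  exact mul_left_cancel₀ (by exact_mod_cast k.factorial_ne_zero) h3

theorem gbinom_eq_bc {γ : ℂ} (hγ : -1 < γ.re) (k : ℕ) : gbinom γ k = bc γ k := by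
  have hG : Complex.Gamma (γ + 1) ≠ 0 := Complex.Gamma_ne_zero_of_re_pos (by simp; linarith)
  induction k with
  | zero => simp [gbinom, hG]
  | succ k ih =>
    rw [bc_succ, ← ih, gbinom, gbinom]
    have h1 : ((k : ℂ) + 1) ≠ 0 := by exact_mod_cast k.succ_ne_zero
    have e1 : Complex.Gamma (((k + 1 : ℕ) : ℂ) + 1) = (k + 1) * Complex.Gamma (k + 1) := by
      push_cast
      exact Complex.Gamma_add_one _ h1
    have e2 : γ - ((k + 1 : ℕ) : ℂ) + 1 = γ - k := by push_cast; ring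
    rw [e1, e2]
    have hk : Complex.Gamma ((k : ℂ) + 1) ≠ 0 :=
      Complex.Gamma_ne_zero_of_re_pos (by simp; positivity)
    -- At `γ = k` the convention `Γ(0) = 0` makes the quotient vanish, in agreement with the factor
    -- `γ - k`.
    by_cases h0 : γ - k = 0
    · rw [h0]; simp [Complex.Gamma_zero]
    · rw [Complex.Gamma_add_one _ h0]
      by_cases h2 : Complex.Gamma (γ - k) = 0
      · simp [h2]
      · field_simp

/-! ### The lower power -/

theorem powLower_zero {γ : ℂ} (h : γ ≠ 0) : powLower 0 γ = 0 := by
  simp [powLower, Complex.zero_cpow (neg_ne_zero.mpr h)]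

theorem powLower_def {x : ℂ} (hx : x ≠ 0) (γ : ℂ) :
    powLower x γ = Complex.exp (-Complex.log x⁻¹ * γ) := by
  rw [powLower, Complex.cpow_def_of_ne_zero (inv_ne_zero hx)]
  congr 1; ring

theorem powLower_eq_cpow {x : ℂ} (hx : x ∈ Complex.slitPlane) (γ : ℂ) : powLower x γ = x ^ γ := by
  have h0 := Complex.slitPlane_ne_zero hx
  rw [powLower_def h0, Complex.log_inv _ (Complex.slitPlane_arg_ne_pi hx),
    Complex.cpow_def_of_ne_zero h0]
  simp

theorem powLower_one (γ : ℂ) : powLower 1 γ = 1 := by simp [powLower]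

theorem powLower_add_one {x : ℂ} (hx : x ≠ 0) (γ : ℂ) :
    powLower x (γ + 1) = x * powLower x γ := by
  rw [powLower_def hx, powLower_def hx, mul_add, Complex.exp_add, mul_one, Complex.exp_neg,
    Complex.exp_log (inv_ne_zero hx), inv_inv, mul_comm]

theorem norm_powLower_le (x γ : ℂ) :
    ‖powLower x γ‖ ≤ Real.exp (Real.pi * |γ.im|) * ‖x‖ ^ γ.re := by
  refine (Complex.norm_cpow_le _ _).trans ?_
  rw [norm_inv, Complex.neg_re, Real.rpow_neg (inv_nonneg.mpr (norm_nonneg _)),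
    ← Real.inv_rpow (inv_nonneg.mpr (norm_nonneg _)), inv_inv, div_eq_mul_inv, mul_comm,
    ← Real.exp_neg]
  refine mul_le_mul_of_nonneg_right (Real.exp_le_exp.mpr ?_) (by positivity)
  rw [Complex.neg_im, mul_neg, neg_neg]
  refine (le_abs_self _).trans ?_
  rw [abs_mul]
  exact mul_le_mul_of_nonneg_right (Complex.abs_arg_le_pi _) (abs_nonneg _)

theorem powLower_neg_ofReal {τ : ℝ} (hτ : 0 < τ) (γ : ℂ) :
    powLower (-(τ : ℂ)) γ = (τ : ℂ) ^ γ * Complex.exp (-(Real.pi * Complex.I) * γ) := by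
  have h0 : (τ : ℂ) ≠ 0 := by exact_mod_cast hτ.ne'
  rw [powLower_def (neg_ne_zero.mpr h0), Complex.cpow_def_of_ne_zero h0, ← Complex.exp_add]
  congr 1
  have : (-(τ : ℂ))⁻¹ = ((-(τ⁻¹) : ℝ) : ℂ) := by push_cast; rw [inv_neg]
  have h1 : -τ⁻¹ < 0 := by simpa using hτ
  rw [this, Complex.log, Complex.arg_ofReal_of_neg h1, ← Complex.ofReal_log hτ.le]
  simp only [Complex.norm_real, norm_neg, norm_inv, Real.norm_eq_abs, Real.log_inv, Real.log_abs]
  push_cast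
  ring

theorem powLower_conj {x : ℂ} (hx : x ∈ Complex.slitPlane) (γ : ℂ) :
    powLower (starRingEnd ℂ x) (starRingEnd ℂ γ) = starRingEnd ℂ (powLower x γ) := by
  have hx' : starRingEnd ℂ x ∈ Complex.slitPlane := by
    rw [Complex.mem_slitPlane_iff] at hx ⊢
    simpa using hx
  rw [powLower_eq_cpow hx', powLower_eq_cpow hx,
    Complex.conj_cpow _ _ (Complex.slitPlane_arg_ne_pi hx), Complex.conj_conj]

/-- The lower power is discontinuous across the cut, but `u` is real: either `1 + ψ u` is off the
cut, or `ψ` is real and the point moves along the cut. There the power is `τ^γ` times the constant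
`exp(-iπγ)`, and the usual derivative persists. -/
theorem hasDerivAt_powLower (ψ γ : ℂ) {u : ℝ} (hx : 1 + ψ * u ≠ 0) :
    HasDerivAt (fun v : ℝ => powLower (1 + ψ * v) γ)
      (γ * ψ * powLower (1 + ψ * u) (γ - 1)) u := by
  have hlin : HasDerivAt (fun v : ℂ => 1 + ψ * v) ψ u := by
    simpa using ((hasDerivAt_id (u : ℂ)).const_mul ψ).const_add 1
  have hlin' : HasDerivAt (fun v : ℝ => 1 + ψ * (v : ℂ)) ψ u := hlin.comp_ofReal
  by_cases hs : 1 + ψ * u ∈ Complex.slitPlane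
  · have h1 := (hlin.cpow_const (c := γ) hs).comp_ofReal
    rw [powLower_eq_cpow hs]
    have h2 : γ * ψ * (1 + ψ * u) ^ (γ - 1) = γ * (1 + ψ * u) ^ (γ - 1) * ψ := by ring
    rw [h2]
    refine h1.congr_of_eventuallyEq ?_
    have := hlin'.continuousAt.eventually (Complex.isOpen_slitPlane.mem_nhds hs)
    filter_upwards [this] with v hv
    exact powLower_eq_cpow hv γ
  · rw [Complex.mem_slitPlane_iff] at hs
    push Not at hs
    have hu : u ≠ 0 := by
      rintro rfl
      simp at hs
      linarith
    have him : ψ.im = 0 := by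
      have := hs.2
      simpa [hu] using this
    obtain ⟨q, rfl⟩ : ∃ q : ℝ, ψ = q := ⟨ψ.re, by apply Complex.ext <;> simp [him]⟩
    have hneg : 1 + q * u < 0 := by
      have h1 : 1 + q * u ≤ 0 := by simpa using hs.1
      refine lt_of_le_of_ne h1 fun h => hx ?_
      exact_mod_cast h
    set c := Complex.exp (-(Real.pi * Complex.I) * γ) with hc
    have e : ∀ v : ℝ, 1 + q * v < 0 → ∀ δ : ℂ, powLower (1 + (q : ℂ) * v) δ =
        ((-(1 + q * v) : ℂ)) ^ δ * Complex.exp (-(Real.pi * Complex.I) * δ) := by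
      intro v hv δ
      have := powLower_neg_ofReal (τ := -(1 + q * v)) (by linarith) δ
      push_cast at this
      rw [← this]; congr 1; ring
    have hs' : (-(1 + q * u) : ℂ) ∈ Complex.slitPlane := by
      left
      simp
      linarith
    have h1 := ((hlin.neg.cpow_const (c := γ) hs').mul_const c).comp_ofReal
    have h2 : γ * q * powLower (1 + (q : ℂ) * u) (γ - 1) =
        γ * (-(1 + q * u) : ℂ) ^ (γ - 1) * -q * c := by
      rw [e u hneg, mul_sub, Complex.exp_sub, ← hc]
      have : Complex.exp (-(Real.pi * Complex.I) * 1) = -1 := by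
        rw [mul_one, Complex.exp_neg, Complex.exp_pi_mul_I]; norm_num
      rw [this]; ring
    rw [h2]
    refine h1.congr_of_eventuallyEq ?_
    have hcont : Continuous fun v : ℝ => 1 + q * v := by fun_prop
    filter_upwards [hcont.continuousAt.eventually (gt_mem_nhds hneg)] with v hv
    exact e v hv γ

/-- Inversion maps the lower half-plane to the upper one, where the principal logarithm is
continuous up to the negative axis. At `0` the bound by a multiple of `‖x‖ ^ γ.re` takes over, which
needs `0 < γ.re`. -/
theorem continuousOn_powLower {γ : ℂ} (hγ : 0 < γ.re) :
    ContinuousOn (fun x => powLower x γ) {x | x.im ≤ 0} := by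
  intro x hx
  by_cases h0 : x = 0
  · subst h0
    have hne : γ ≠ 0 := fun h => by simp [h] at hγ
    refine ContinuousAt.continuousWithinAt ?_
    rw [ContinuousAt, powLower_zero hne]
    refine squeeze_zero_norm (fun x => norm_powLower_le x γ) ?_
    have : ContinuousAt (fun x : ℂ => Real.exp (Real.pi * |γ.im|) * ‖x‖ ^ γ.re) 0 :=
      (continuous_norm.continuousAt.rpow_const (Or.inr hγ.le)).const_mul _
    simpa [ContinuousAt, Real.zero_rpow hγ.ne'] using this
  · have hev : ∀ᶠ v in nhdsWithin x {x | x.im ≤ 0}, powLower v γ =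
        Complex.exp (-Complex.log v⁻¹ * γ) := by
      filter_upwards [nhdsWithin_le_nhds (isOpen_ne.mem_nhds h0)] with v hv
      exact powLower_def hv γ
    refine ContinuousWithinAt.congr_of_eventuallyEq ?_ hev (powLower_def h0 γ)
    refine (ContinuousWithinAt.mul ?_ continuousWithinAt_const).cexp
    refine ContinuousWithinAt.neg ?_
    have hinv : ContinuousWithinAt (fun v : ℂ => v⁻¹) {x | x.im ≤ 0} x :=
      (continuousAt_inv₀ h0).continuousWithinAt
    have hmaps : Set.MapsTo (fun v : ℂ => v⁻¹) {x | x.im ≤ 0} {x | 0 ≤ x.im} := by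
      intro v hv
      simp only [Set.mem_ofPred_eq, Complex.inv_im] at hv ⊢
      exact div_nonneg (by linarith) (Complex.normSq_nonneg _)
    by_cases hs : x⁻¹ ∈ Complex.slitPlane
    · exact (continuousAt_clog hs).comp_continuousWithinAt hinv
    · rw [Complex.mem_slitPlane_iff] at hs
      push Not at hs
      have hre : (x⁻¹).re < 0 := by
        refine lt_of_le_of_ne hs.1 fun h => inv_ne_zero h0 ?_
        exact Complex.ext h hs.2
      exact ContinuousWithinAt.comp
        (Complex.continuousWithinAt_log_of_re_neg_of_im_zero hre hs.2) hinv hmaps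

/-! ### Beta integrals -/

theorem integral_beta (n : ℕ) {a : ℂ} (ha : 0 < a.re) :
    ∫ u in (0 : ℝ)..1, (1 - (u : ℂ)) ^ n * (u : ℂ) ^ (a - 1) = beta (n + 1) a := by
  have h1 : 0 < ((n : ℂ) + 1).re := by simp; positivity
  have h := Complex.Gamma_mul_Gamma_eq_betaIntegral ha h1
  have hG : Complex.Gamma (a + (n + 1)) ≠ 0 :=
    Complex.Gamma_ne_zero_of_re_pos (by simp at h1 ⊢; linarith)
  have : Complex.betaIntegral a (n + 1) = beta (n + 1) a := by
    rw [beta, add_comm _ a, eq_div_iff hG, mul_comm (Complex.Gamma _) (Complex.Gamma a), h,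
      mul_comm]
  rw [← this, Complex.betaIntegral]
  congr 1; ext u
  rw [add_sub_cancel_right, Complex.cpow_natCast, mul_comm]

theorem intervalIntegrable_beta (n : ℕ) {a : ℂ} (ha : 0 < a.re) :
    IntervalIntegrable (fun u : ℝ => (1 - (u : ℂ)) ^ n * (u : ℂ) ^ (a - 1))
      MeasureTheory.volume 0 1 := by
  have h1 : 0 < ((n : ℂ) + 1).re := by simp; positivity
  have h := Complex.betaIntegral_convergent ha h1
  refine h.congr ?_
  intro u _
  simp only
  rw [add_sub_cancel_right, Complex.cpow_natCast, mul_comm]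

/-- The real Beta value `B(n + 1, X)`. -/
def rbeta (n : ℕ) (X : ℝ) : ℝ := ∫ u in (0 : ℝ)..1, (1 - u) ^ n * u ^ (X - 1)

theorem intervalIntegrable_rbeta (n : ℕ) {X : ℝ} (hX : 0 < X) :
    IntervalIntegrable (fun u : ℝ => (1 - u) ^ n * u ^ (X - 1)) MeasureTheory.volume 0 1 := by
  have := (intervalIntegral.intervalIntegrable_rpow' (a := 0) (b := 1) (r := X - 1) (by linarith))
  exact this.continuousOn_mul (by fun_prop)

theorem rbeta_eq (n : ℕ) {X : ℝ} (hX : 0 < X) :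
    rbeta n X = n.factorial * Real.Gamma X / Real.Gamma (n + 1 + X) := by
  have h := integral_beta n (a := (X : ℂ)) (by simpa using hX)
  have e : ∫ u in (0 : ℝ)..1, (1 - (u : ℂ)) ^ n * (u : ℂ) ^ ((X : ℂ) - 1) =
      ((rbeta n X : ℝ) : ℂ) := by
    rw [rbeta, ← intervalIntegral.integral_ofReal]
    refine intervalIntegral.integral_congr fun u hu => ?_
    rw [Set.uIcc_of_le zero_le_one] at hu
    push_cast
    rw [Complex.ofReal_cpow hu.1]
    push_cast
    rfl
  rw [e, beta, Complex.Gamma_nat_eq_factorial] at h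
  have : ((n : ℂ) + 1 + X) = ((n + 1 + X : ℝ) : ℂ) := by push_cast; rfl
  rw [this, Complex.Gamma_ofReal, Complex.Gamma_ofReal] at h
  exact_mod_cast h

theorem rbeta_pos (n : ℕ) {X : ℝ} (hX : 0 < X) : 0 < rbeta n X := by
  rw [rbeta_eq n hX]
  have := Real.Gamma_pos_of_pos hX
  have := Real.Gamma_pos_of_pos (show 0 < (n : ℝ) + 1 + X by positivity)
  positivity

end BiorthAsymp

end

/-! ### The integrals `K` and `J`: integrability, continuity up to the cut, analyticity -/

noncomputable section

namespace BiorthAsymp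

open MeasureTheory Set

/-- The integrand of `K`. -/
def kern (n : ℕ) (a γ ψ : ℂ) (u : ℝ) : ℂ :=
  (1 - (u : ℂ)) ^ n * (u : ℂ) ^ (a - 1) * powLower (1 + ψ * u) γ

/-- The integral `∫₀¹ (1 - u)ⁿ u^(a-1) (1 + ψ u)^γ du`. -/
def K (n : ℕ) (a γ ψ : ℂ) : ℂ := ∫ u in (0 : ℝ)..1, kern n a γ ψ u

/-- The integral of the normalized binomial remainder `r p` against `(1 - u)ⁿ u^(p+a)`. -/
def J (n p : ℕ) (a γ ψ : ℂ) : ℂ :=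
  ∫ u in (0 : ℝ)..1, (1 - (u : ℂ)) ^ n * (u : ℂ) ^ (p + a) * r p u ψ γ

theorem measurable_powLower (γ : ℂ) : Measurable fun x => powLower x γ := by
  unfold powLower
  fun_prop

theorem measurable_kern (n : ℕ) (a γ ψ : ℂ) : Measurable (kern n a γ ψ) := by
  have := (measurable_powLower γ).comp (f := fun u : ℝ => 1 + ψ * (u : ℂ)) (by fun_prop)
  unfold kern
  refine Measurable.mul ?_ this
  fun_prop

theorem norm_kern_le (n : ℕ) (a γ ψ : ℂ) {u : ℝ} (hu : u ∈ Ioc (0 : ℝ) 1) :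
    ‖kern n a γ ψ u‖ ≤
      Real.exp (Real.pi * |γ.im|) * (u ^ (a.re - 1) * ‖1 + ψ * u‖ ^ γ.re) := by
  rw [kern, norm_mul, norm_mul, Complex.norm_cpow_eq_rpow_re_of_pos hu.1, norm_pow]
  have h1 : ‖1 - (u : ℂ)‖ ^ n ≤ 1 := by
    refine pow_le_one₀ (norm_nonneg _) ?_
    rw [show (1 : ℂ) - u = ((1 - u : ℝ) : ℂ) by push_cast; rfl, Complex.norm_real,
      Real.norm_eq_abs, abs_le]
    constructor <;> linarith [hu.1, hu.2]
  have h2 := norm_powLower_le (1 + ψ * u) γ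
  have h3 : 0 ≤ u ^ (a - 1).re := Real.rpow_nonneg hu.1.le _
  calc _ ≤ 1 * u ^ (a - 1).re * (Real.exp (Real.pi * |γ.im|) * ‖1 + ψ * u‖ ^ γ.re) := by gcongr
    _ = _ := by rw [Complex.sub_re, Complex.one_re]; ring

theorem norm_mul_abs_sub_le {ψ : ℂ} (hψ : ψ ≠ 0) (u : ℝ) :
    ‖ψ‖ * |u - (-(1 / ψ).re)| ≤ ‖1 + ψ * u‖ := by
  have : 1 + ψ * u = ψ * (1 / ψ + u) := by field_simp
  rw [this, norm_mul]
  refine mul_le_mul_of_nonneg_left ?_ (norm_nonneg _)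
  refine le_trans (le_of_eq ?_) (Complex.abs_re_le_norm _)
  congr 1
  simp; ring

theorem intervalIntegrable_abs_sub_rpow {g : ℝ} (hg : -1 < g) (c x y : ℝ) :
    IntervalIntegrable (fun u : ℝ => |u - c| ^ g) volume x y := by
  have h := (intervalIntegral.intervalIntegrable_cpow' (a := x - c) (b := y - c) (r := (g : ℂ))
    (by simpa using hg)).norm.comp_sub_right c
  simp only [sub_add_cancel] at h
  refine h.congr_ae ?_
  have : ∀ᵐ u : ℝ ∂volume, u ≠ c := by simp [ae_iff]
  refine ae_restrict_of_ae ?_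
  filter_upwards [this] with u hu
  have h0 : ((u - c : ℝ) : ℂ) ≠ 0 := by
    rw [Complex.ofReal_ne_zero]; exact sub_ne_zero.mpr hu
  rw [Complex.norm_cpow_of_ne_zero h0]
  simp only [Complex.norm_real, Real.norm_eq_abs, Complex.ofReal_re, Complex.ofReal_im, mul_zero,
    Real.exp_zero, div_one]

/-- When `g < 0` there may be two singularities, at `u = 0` and at the zero of `1 + ψ u`. The point
`ε = 1/(2‖ψ‖)` separates them: below it `‖1 + ψ u‖ ≥ 1/2`, above it the power of `u` is bounded. -/
theorem intervalIntegrable_weight {X g : ℝ} (hX : 0 < X) (hg : -1 < g) (ψ : ℂ) :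
    IntervalIntegrable (fun u : ℝ => u ^ (X - 1) * ‖1 + ψ * u‖ ^ g) volume 0 1 := by
  have hp : IntervalIntegrable (fun u : ℝ => u ^ (X - 1)) volume 0 1 :=
    intervalIntegral.intervalIntegrable_rpow' (by linarith)
  rcases le_or_gt 0 g with h0 | h0
  · refine hp.mul_continuousOn ?_
    refine ContinuousOn.rpow_const (by fun_prop) fun _ _ => Or.inr h0
  · by_cases hψ : ψ = 0
    · subst hψ; simpa using hp
    have hn : 0 < ‖ψ‖ := norm_pos_iff.mpr hψ
    set c := -(1 / ψ).re
    set ε : ℝ := 1 / (2 * ‖ψ‖) with hε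
    have hεp : 0 < ε := by positivity
    have hmaj : IntervalIntegrable (fun u : ℝ => (1 / 2 : ℝ) ^ g * u ^ (X - 1) +
        (ε ^ (X - 1) + 1) * ‖ψ‖ ^ g * |u - c| ^ g) volume 0 1 :=
      (hp.const_mul _).add ((intervalIntegrable_abs_sub_rpow hg c 0 1).const_mul _)
    refine hmaj.mono_fun' ?_ ?_
    · exact (by fun_prop : Measurable fun u : ℝ => u ^ (X - 1) * ‖1 + ψ * u‖ ^ g).aestronglyMeasurable
    · rw [uIoc_of_le zero_le_one]
      have hne : ∀ᵐ u : ℝ ∂volume, u ≠ c := by simp [ae_iff]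
      filter_upwards [ae_restrict_mem measurableSet_Ioc, ae_restrict_of_ae hne] with u hu huc
      have hu0 : 0 < u := hu.1
      rw [Real.norm_of_nonneg (by positivity)]
      rcases le_or_gt u ε with h | h
      · have h1 : (1 / 2 : ℝ) ≤ ‖1 + ψ * u‖ := by
          have e1 : ‖ψ * u‖ ≤ 1 / 2 := by
            rw [norm_mul, Complex.norm_real, Real.norm_of_nonneg hu0.le]
            calc ‖ψ‖ * u ≤ ‖ψ‖ * ε := by gcongr
              _ = 1 / 2 := by rw [hε]; field_simp
          have e2 := norm_sub_norm_le (1 : ℂ) (-(ψ * u))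
          rw [sub_neg_eq_add, norm_neg, norm_one] at e2
          linarith
        have h2 : ‖1 + ψ * u‖ ^ g ≤ (1 / 2 : ℝ) ^ g :=
          Real.rpow_le_rpow_of_nonpos (by norm_num) h1 h0.le
        have h3 : 0 ≤ (ε ^ (X - 1) + 1) * ‖ψ‖ ^ g * |u - c| ^ g := by positivity
        calc _ ≤ u ^ (X - 1) * (1 / 2 : ℝ) ^ g := by gcongr
          _ ≤ _ := by linarith
      · have h1 : u ^ (X - 1) ≤ ε ^ (X - 1) + 1 := by
          rcases le_or_gt 0 (X - 1) with h5 | h5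
          · have := Real.rpow_le_one hu0.le hu.2 h5
            have := Real.rpow_nonneg hεp.le (X - 1)
            linarith
          · have := Real.rpow_le_rpow_of_nonpos hεp h.le h5.le
            linarith
        have h2 : ‖1 + ψ * u‖ ^ g ≤ ‖ψ‖ ^ g * |u - c| ^ g := by
          rw [← Real.mul_rpow hn.le (abs_nonneg _)]
          refine Real.rpow_le_rpow_of_nonpos ?_ (norm_mul_abs_sub_le hψ u) h0.le
          exact mul_pos hn (abs_pos.mpr (sub_ne_zero.mpr huc))
        have h3 : 0 ≤ (1 / 2 : ℝ) ^ g * u ^ (X - 1) := by positivity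
        calc _ ≤ (ε ^ (X - 1) + 1) * (‖ψ‖ ^ g * |u - c| ^ g) := by gcongr
          _ ≤ _ := by linarith

theorem intervalIntegrable_kern (n : ℕ) {a γ : ℂ} (ha : 0 < a.re) (hγ : -1 < γ.re) (ψ : ℂ) :
    IntervalIntegrable (kern n a γ ψ) volume 0 1 := by
  refine ((intervalIntegrable_weight ha hγ ψ).const_mul (Real.exp (Real.pi * |γ.im|))).mono_fun'
    (measurable_kern n a γ ψ).aestronglyMeasurable ?_
  rw [uIoc_of_le zero_le_one]
  filter_upwards [ae_restrict_mem measurableSet_Ioc] with u hu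
  exact norm_kern_le n a γ ψ hu

theorem cpow_kern_shift {u : ℝ} (hu : 0 < u) (a : ℂ) (k : ℕ) :
    (u : ℂ) ^ (a + k - 1) = (u : ℂ) ^ (a - 1) * (u : ℂ) ^ k := by
  rw [← Complex.cpow_natCast, ← Complex.cpow_add _ _ (by exact_mod_cast hu.ne')]
  congr 1; ring

theorem remainder_integrand_eq (n p : ℕ) (a γ : ℂ) (hγ : -1 < γ.re) {ψ : ℂ} (hψ : ψ ≠ 0) {u : ℝ}
    (hu : 0 < u) :
    ψ ^ (p + 1) * ((1 - (u : ℂ)) ^ n * (u : ℂ) ^ (p + a) * r p u ψ γ) =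
      kern n a γ ψ u - ∑ k ∈ Finset.range (p + 1), bc γ k * ψ ^ k *
        ((1 - (u : ℂ)) ^ n * (u : ℂ) ^ (a + k - 1)) := by
  have hu' : (u : ℂ) ≠ 0 := by exact_mod_cast hu.ne'
  have e1 : (u : ℂ) ^ (p + a) = (u : ℂ) ^ (a - 1) * (u : ℂ) ^ (p + 1) := by
    rw [← cpow_kern_shift hu]; congr 1; push_cast; ring
  have e2 : ψ ^ (p + 1) * (u : ℂ) ^ (p + 1) * r p u ψ γ =
      powLower (1 + ψ * u) γ - ∑ k ∈ Finset.range (p + 1), bc γ k * (ψ * u) ^ k := by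
    rw [r, ← mul_pow, mul_div_cancel₀ _ (pow_ne_zero _ (mul_ne_zero hψ hu'))]
    simp only [gbinom_eq_bc hγ]
  calc _ = (1 - (u : ℂ)) ^ n * (u : ℂ) ^ (a - 1) *
        (ψ ^ (p + 1) * (u : ℂ) ^ (p + 1) * r p u ψ γ) := by rw [e1]; ring
    _ = _ := by
      rw [e2, mul_sub, kern, Finset.mul_sum]
      congr 1
      refine Finset.sum_congr rfl fun k _ => ?_
      rw [cpow_kern_shift hu, mul_pow]; ring

theorem intervalIntegrable_beta_shift (n k : ℕ) {a : ℂ} (ha : 0 < a.re) (c : ℂ) :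
    IntervalIntegrable (fun u : ℝ => c * ((1 - (u : ℂ)) ^ n * (u : ℂ) ^ (a + k - 1))) volume 0 1 :=
  (intervalIntegrable_beta n (a := a + k) (by simp; positivity)).const_mul _

theorem intervalIntegrable_remainder (n p : ℕ) {a γ : ℂ} (ha : 0 < a.re) (hγ : -1 < γ.re) (ψ : ℂ) :
    IntervalIntegrable (fun u : ℝ => (1 - (u : ℂ)) ^ n * (u : ℂ) ^ (p + a) * r p u ψ γ)
      volume 0 1 := by
  by_cases hψ : ψ = 0
  · subst hψ
    simp [r]
  have h := ((intervalIntegrable_kern n ha hγ ψ).sub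
    (IntervalIntegrable.sum (Finset.range (p + 1)) fun k _ =>
      intervalIntegrable_beta_shift n k ha (bc γ k * ψ ^ k))).const_mul ((ψ ^ (p + 1))⁻¹)
  refine h.congr ?_
  intro u hu
  rw [uIoc_of_le zero_le_one] at hu
  have := remainder_integrand_eq n p a γ hγ hψ hu.1
  simp only [Finset.sum_apply]
  rw [← this, inv_mul_cancel_left₀ (pow_ne_zero _ hψ)]

theorem pow_mul_J (n p : ℕ) {a γ : ℂ} (ha : 0 < a.re) (hγ : -1 < γ.re) {ψ : ℂ} (hψ : ψ ≠ 0) :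
    ψ ^ (p + 1) * J n p a γ ψ = K n a γ ψ -
      ∑ k ∈ Finset.range (p + 1), bc γ k * ψ ^ k * beta (n + 1) (a + k) := by
  rw [J, K, ← intervalIntegral.integral_const_mul]
  have e : ∀ k ∈ Finset.range (p + 1), bc γ k * ψ ^ k * beta (n + 1) (a + k) =
      ∫ u in (0 : ℝ)..1, bc γ k * ψ ^ k * ((1 - (u : ℂ)) ^ n * (u : ℂ) ^ (a + k - 1)) := by
    intro k _
    rw [intervalIntegral.integral_const_mul, integral_beta n (by simp; positivity)]
  have hsum : IntervalIntegrable (fun u : ℝ => ∑ k ∈ Finset.range (p + 1), bc γ k * ψ ^ k *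
      ((1 - (u : ℂ)) ^ n * (u : ℂ) ^ (a + k - 1))) volume 0 1 := by
    have := IntervalIntegrable.sum (Finset.range (p + 1)) fun k _ =>
      intervalIntegrable_beta_shift n k ha (bc γ k * ψ ^ k)
    refine this.congr fun u _ => ?_
    simp only [Finset.sum_apply]
  rw [Finset.sum_congr rfl e, ← intervalIntegral.integral_finsetSum
    fun k _ => intervalIntegrable_beta_shift n k ha _, ← intervalIntegral.integral_sub
    (intervalIntegrable_kern n ha hγ ψ) hsum]
  refine intervalIntegral.integral_congr_uIoo fun u hu => ?_
  rw [uIoo_of_le zero_le_one] at hu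
  simpa using remainder_integrand_eq n p a γ hγ hψ hu.1

theorem one_add_mul_im_nonpos {ψ : ℂ} (hψ : ψ.im ≤ 0) {u : ℝ} (hu : 0 ≤ u) :
    (1 + ψ * u).im ≤ 0 := by
  simp only [Complex.add_im, Complex.one_im, Complex.mul_im, Complex.ofReal_re, Complex.ofReal_im]
  nlinarith

/-- Integration by parts, raising the exponent of `1 + ψ u`. -/
theorem mul_K_sub_one (n : ℕ) {a w : ℂ} (ha : 0 < a.re) (hw : 0 < w.re) {ψ : ℂ} (hψ : ψ.im ≤ 0) :
    w * K n a (w - 1) ψ = (w + a) * K n a w ψ - n * K (n - 1) (a + 1) w ψ -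
      (if n = 0 then powLower (1 + ψ) w else 0) := by
  have ha0 : a ≠ 0 := fun h => by simp [h] at ha
  have ha1 : 0 < (a + 1).re := by simp; linarith
  have hw0 : w ≠ 0 := fun h => by simp [h] at hw
  have hw1 : -1 < (w - 1).re := by simpa using hw
  set G : ℝ → ℂ := fun u => (1 - (u : ℂ)) ^ n * (u : ℂ) ^ a * powLower (1 + ψ * u) w with hG
  set G' : ℝ → ℂ := fun u => (w + a) * kern n a w ψ u - n * kern (n - 1) (a + 1) w ψ u -
    w * kern n a (w - 1) ψ u with hG'
  have hi1 := (intervalIntegrable_kern n ha (by linarith : -1 < w.re) ψ).const_mul (w + a)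
  have hi2 := (intervalIntegrable_kern (n - 1) ha1 (by linarith : -1 < w.re) ψ).const_mul (n : ℂ)
  have hi3 := (intervalIntegrable_kern n ha hw1 ψ).const_mul w
  have hcont : ContinuousOn G (Icc 0 1) := by
    refine ContinuousOn.mul (ContinuousOn.mul (by fun_prop) ?_) ?_
    · refine Continuous.continuousOn ?_
      refine continuous_iff_continuousAt.mpr fun u => ?_
      exact Complex.continuousAt_ofReal_cpow_const u a (Or.inl ha)
    · refine (continuousOn_powLower hw).comp (by fun_prop) fun u hu => ?_
      exact one_add_mul_im_nonpos hψ hu.1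
  -- The primitive is continuous on `[0,1]`, but its derivative may fail to exist at the zero of `1
  -- + ψ u`; there is at most one such point.
  have hcount : ({u : ℝ | 1 + ψ * u = 0}).Countable := by
    refine Set.Subsingleton.countable ?_
    intro u hu v hv
    have hu : 1 + ψ * u = 0 := hu
    have hv : 1 + ψ * v = 0 := hv
    have h0 : ψ ≠ 0 := by rintro rfl; simp at hu
    have : ψ * u = ψ * v := by linear_combination hu - hv
    exact_mod_cast mul_left_cancel₀ h0 this
  have hder : ∀ u ∈ Ioo (0 : ℝ) 1 \ {u : ℝ | 1 + ψ * u = 0}, HasDerivAt G (G' u) u := by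
    rintro u ⟨hu, hne⟩
    have hne : 1 + ψ * u ≠ 0 := hne
    have hu0 : (u : ℂ) ≠ 0 := by exact_mod_cast hu.1.ne'
    have d1 : HasDerivAt (fun v : ℝ => (1 - (v : ℂ)) ^ n)
        (-(n * (1 - (u : ℂ)) ^ (n - 1))) u := by
      have := (((hasDerivAt_id (u : ℂ)).const_sub 1).pow n).comp_ofReal
      refine this.congr_deriv ?_
      simp
    have d2 : HasDerivAt (fun v : ℝ => (v : ℂ) ^ a) (a * (u : ℂ) ^ (a - 1)) u := by
      have := ((hasDerivAt_id (u : ℂ)).cpow_const (c := a) (by left; simpa using hu.1)).comp_ofReal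
      simpa using this
    have d3 := hasDerivAt_powLower ψ w hne
    refine ((d1.mul d2).mul d3).congr_deriv ?_
    have e1 : (u : ℂ) ^ a = (u : ℂ) ^ (a - 1) * u := by
      simpa using Complex.cpow_add (a - 1) 1 hu0
    have e2 : powLower (1 + ψ * u) w = (1 + ψ * u) * powLower (1 + ψ * u) (w - 1) := by
      rw [← powLower_add_one hne, sub_add_cancel]
    simp only [hG', kern, add_sub_cancel_right, Pi.mul_apply]
    rw [e1, e2]
    ring
  have hint : IntervalIntegrable G' volume 0 1 := (hi1.sub hi2).sub hi3
  have h := integral_eq_of_hasDerivAt_off_countable_of_le G G' zero_le_one hcount hcont hder hint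
  have h2 : ∫ u in (0 : ℝ)..1, G' u = (w + a) * K n a w ψ - n * K (n - 1) (a + 1) w ψ -
      w * K n a (w - 1) ψ := by
    simp only [hG']
    rw [intervalIntegral.integral_sub (hi1.sub hi2) hi3, intervalIntegral.integral_sub hi1 hi2,
      intervalIntegral.integral_const_mul, intervalIntegral.integral_const_mul,
      intervalIntegral.integral_const_mul]
    rfl
  -- At `u = 1` the factor `(1-u)^n` survives only for `n = 0`, where `0^0 = 1`.
  have h3 : G 1 - G 0 = if n = 0 then powLower (1 + ψ) w else 0 := by
    simp only [hG]
    rcases Nat.eq_zero_or_pos n with rfl | hn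
    · simp [Complex.zero_cpow ha0]
    · simp [Complex.zero_cpow ha0, hn.ne']
  rw [h2, h3] at h
  linear_combination -h

theorem continuousOn_K_of_pos (n : ℕ) {a γ : ℂ} (ha : 0 < a.re) (hγ : 0 < γ.re) :
    ContinuousOn (K n a γ) {ψ | ψ.im ≤ 0} := by
  intro ψ hψ
  refine intervalIntegral.continuousWithinAt_of_dominated_interval
    (bound := fun u => Real.exp (Real.pi * |γ.im|) * (u ^ (a.re - 1) * (2 + ‖ψ‖) ^ γ.re)) ?_ ?_ ?_ ?_
  · exact Filter.Eventually.of_forall fun φ => (measurable_kern n a γ φ).aestronglyMeasurable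
  · have : ∀ᶠ φ in nhdsWithin ψ {ψ | ψ.im ≤ 0}, ‖φ‖ < 1 + ‖ψ‖ :=
      nhdsWithin_le_nhds (continuous_norm.continuousAt.eventually (gt_mem_nhds (by simp)))
    filter_upwards [this] with φ hφ
    refine Filter.Eventually.of_forall fun u hu => ?_
    rw [uIoc_of_le zero_le_one] at hu
    refine (norm_kern_le n a γ φ hu).trans ?_
    have h1 : ‖1 + φ * u‖ ≤ 2 + ‖ψ‖ := by
      refine (norm_add_le _ _).trans ?_
      rw [norm_one, norm_mul, Complex.norm_real, Real.norm_of_nonneg hu.1.le]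
      nlinarith [norm_nonneg φ, hu.2]
    have h2 : 0 ≤ u ^ (a.re - 1) := Real.rpow_nonneg hu.1.le _
    gcongr
  · refine (IntervalIntegrable.mul_const ?_ _).const_mul _
    exact intervalIntegral.intervalIntegrable_rpow' (by linarith)
  · refine Filter.Eventually.of_forall fun u hu => ?_
    rw [uIoc_of_le zero_le_one] at hu
    refine ContinuousWithinAt.mul continuousWithinAt_const ?_
    refine ContinuousWithinAt.comp (t := {x | x.im ≤ 0}) (g := fun x => powLower x γ)
      (f := fun ψ : ℂ => 1 + ψ * u)
      (continuousOn_powLower hγ _ (one_add_mul_im_nonpos hψ hu.1.le))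
      (by fun_prop) fun φ hφ => one_add_mul_im_nonpos hφ hu.1.le

/-- For `Re γ ≤ 0` the singularity of the integrand moves with `ψ`, which obstructs direct
domination. Integration by parts expresses `K` through integrals with exponent `γ + 1`, of positive
real part, for which dominated convergence works. -/
theorem continuousOn_K (n : ℕ) {a γ : ℂ} (ha : 0 < a.re) (hγ : -1 < γ.re) :
    ContinuousOn (K n a γ) {ψ | ψ.im ≤ 0} := by
  have hw : 0 < (γ + 1).re := by simp; linarith
  have hw0 : γ + 1 ≠ 0 := fun h => by simp [h] at hw
  have h1 := (((continuousOn_K_of_pos n ha hw).const_smul (γ + 1 + a)).sub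
    ((continuousOn_K_of_pos (n - 1) (a := a + 1) (by simp; linarith) hw).const_smul (n : ℂ))).sub
    (g := fun ψ => if n = 0 then powLower (1 + ψ) (γ + 1) else 0) (by
      split_ifs
      · refine (continuousOn_powLower hw).comp (by fun_prop) fun ψ hψ => ?_
        simpa using hψ
      · exact continuousOn_const)
  refine (h1.const_smul (γ + 1)⁻¹).congr fun ψ hψ => ?_
  have := mul_K_sub_one n ha hw hψ
  rw [add_sub_cancel_right] at this
  simp only [smul_eq_mul, Pi.smul_apply, Pi.sub_apply]
  rw [← this, inv_mul_cancel_left₀ hw0]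

theorem one_add_mul_mem_slitPlane {ψ : ℂ} (hψ : 1 + ψ ∈ Complex.slitPlane) {u : ℝ}
    (hu : u ∈ Icc (0 : ℝ) 1) : 1 + ψ * u ∈ Complex.slitPlane := by
  have := Complex.starConvex_one_slitPlane hψ (sub_nonneg.mpr hu.2) hu.1 (by ring)
  convert this using 1
  simp only [Complex.real_smul, Complex.ofReal_sub, Complex.ofReal_one]
  ring

theorem differentiableAt_K (n : ℕ) {a γ : ℂ} (ha : 0 < a.re) (hγ : -1 < γ.re) {ψ : ℂ}
    (hψ : 1 + ψ ∈ Complex.slitPlane) : DifferentiableAt ℂ (K n a γ) ψ := by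
  have hopen : IsOpen {φ : ℂ | 1 + φ ∈ Complex.slitPlane} :=
    Complex.isOpen_slitPlane.preimage (by fun_prop)
  obtain ⟨ε, hε, hsub⟩ := Metric.nhds_basis_closedBall.mem_iff.mp (hopen.mem_nhds hψ)
  have hc : ContinuousOn (fun q : ℂ × ℝ => (1 + q.1 * q.2) ^ (γ - 1))
      (Metric.closedBall ψ ε ×ˢ Icc (0 : ℝ) 1) := by
    intro q hq
    refine ContinuousAt.continuousWithinAt ?_
    refine ContinuousAt.cpow (by fun_prop) continuousAt_const ?_
    exact one_add_mul_mem_slitPlane (hsub hq.1) hq.2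
  obtain ⟨C, hC⟩ := ((isCompact_closedBall ψ ε).prod isCompact_Icc).exists_bound_of_continuousOn hc
  refine (intervalIntegral.hasDerivAt_integral_of_dominated_loc_of_deriv_le
    (F := fun ψ u => kern n a γ ψ u)
    (F' := fun ψ u => (1 - (u : ℂ)) ^ n * (u : ℂ) ^ (a - 1) *
      (γ * u * (1 + ψ * u) ^ (γ - 1)))
    (bound := fun u => ‖(1 - (u : ℂ)) ^ n * (u : ℂ) ^ (a - 1)‖ * (‖γ‖ * C))
    (Metric.closedBall_mem_nhds ψ hε) ?_ ?_ ?_ ?_ ?_ ?_).2.differentiableAt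
  · exact Filter.Eventually.of_forall fun φ => (measurable_kern n a γ φ).aestronglyMeasurable
  · exact intervalIntegrable_kern n ha hγ ψ
  · exact (by fun_prop : Measurable _).aestronglyMeasurable
  · refine Filter.Eventually.of_forall fun u hu φ hφ => ?_
    rw [uIoc_of_le zero_le_one] at hu
    rw [norm_mul]
    refine mul_le_mul_of_nonneg_left ?_ (norm_nonneg _)
    have h1 := hC (φ, u) ⟨hφ, hu.1.le, hu.2⟩
    rw [norm_mul, norm_mul, Complex.norm_real, Real.norm_of_nonneg hu.1.le]
    calc ‖γ‖ * u * _ ≤ ‖γ‖ * 1 * C := by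
          gcongr
          exact hu.2
      _ = _ := by ring
  · exact (intervalIntegrable_beta n ha).norm.mul_const _
  · refine Filter.Eventually.of_forall fun u hu φ hφ => ?_
    rw [uIoc_of_le zero_le_one] at hu
    have hs : ∀ χ ∈ Metric.closedBall ψ ε, 1 + χ * u ∈ Complex.slitPlane := fun χ hχ =>
      one_add_mul_mem_slitPlane (hsub hχ) ⟨hu.1.le, hu.2⟩
    refine HasDerivAt.const_mul _ ?_
    have hlin : HasDerivAt (fun χ : ℂ => 1 + χ * u) u φ := by
      simpa using ((hasDerivAt_id φ).mul_const (u : ℂ)).const_add 1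
    have hs' := hs φ hφ
    refine ((hlin.cpow_const (c := γ) hs').congr_of_eventuallyEq ?_).congr_deriv (by ring)
    have := hlin.continuousAt.eventually (Complex.isOpen_slitPlane.mem_nhds hs')
    filter_upwards [this] with χ hχ
    exact powLower_eq_cpow hχ γ

/-- This fails on the cut, since conjugation exchanges its two sides. It is what later gives access
to the upper side. -/
theorem K_conj (n : ℕ) (a γ : ℂ) {ψ : ℂ} (hψ : 1 + ψ ∈ Complex.slitPlane) :
    K n (starRingEnd ℂ a) (starRingEnd ℂ γ) (starRingEnd ℂ ψ) = starRingEnd ℂ (K n a γ ψ) := by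
  have hc : ∀ f : ℝ → ℂ, starRingEnd ℂ (∫ u in (0 : ℝ)..1, f u) =
      ∫ u in (0 : ℝ)..1, starRingEnd ℂ (f u) := fun f => by
    rw [intervalIntegral.integral_of_le zero_le_one, intervalIntegral.integral_of_le zero_le_one,
      integral_conj]
  rw [K, K, hc]
  refine intervalIntegral.integral_congr_uIoo fun u hu => ?_
  rw [uIoo_of_le zero_le_one] at hu
  simp only [kern, map_mul, map_pow, map_sub, map_one, Complex.conj_ofReal]
  rw [← powLower_conj (one_add_mul_mem_slitPlane hψ ⟨hu.1.le, hu.2.le⟩)]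
  congr 2
  · have := Complex.conj_cpow (u : ℂ) (starRingEnd ℂ (a - 1))
      (by rw [Complex.arg_ofReal_of_nonneg hu.1.le]; exact Real.pi_ne_zero.symm)
    simpa using this
  · simp

end BiorthAsymp

end

/-! ### Euler's integral, its two branches, and the exact decomposition -/

noncomputable section

namespace BiorthAsymp

open MeasureTheory Set Filter Topology

/-- Euler's integral for the terminating hypergeometric series. -/
def eulerInt (n : ℕ) (b d z : ℂ) : ℂ :=
  ∫ s in (0 : ℝ)..1, (s : ℂ) ^ (b - 1) * (1 - (s : ℂ)) ^ (d - 1) * (1 - (1 - z) * s) ^ n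

theorem eulerInt_eq_sum (n : ℕ) {b d : ℂ} (hb : 0 < b.re) (hd : 0 < d.re) (z : ℂ) :
    eulerInt n b d z = ∑ k ∈ Finset.range (n + 1), n.choose k * (-(1 - z)) ^ k *
      Complex.betaIntegral (b + k) d := by
  have hk : ∀ k : ℕ, 0 < (b + k).re := fun k => by simp; positivity
  have e : ∀ k ∈ Finset.range (n + 1), n.choose k * (-(1 - z)) ^ k *
      Complex.betaIntegral (b + k) d = ∫ s in (0 : ℝ)..1, n.choose k * (-(1 - z)) ^ k *
        ((s : ℂ) ^ (b + k - 1) * (1 - (s : ℂ)) ^ (d - 1)) := by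
    intro k _
    rw [Complex.betaIntegral, intervalIntegral.integral_const_mul]
  rw [Finset.sum_congr rfl e, ← intervalIntegral.integral_finsetSum
    fun k _ => (Complex.betaIntegral_convergent (hk k) hd).const_mul _, eulerInt]
  refine intervalIntegral.integral_congr_uIoo fun s hs => ?_
  rw [uIoo_of_le zero_le_one] at hs
  rw [show 1 - (1 - z) * (s : ℂ) = -(1 - z) * s + 1 by ring, add_pow, Finset.mul_sum]
  refine Finset.sum_congr rfl fun k _ => ?_
  rw [cpow_kern_shift hs.1, one_pow, mul_pow]
  ring

theorem ne_neg_natCast_of_re_pos {z : ℂ} (hz : 0 < z.re) (k : ℕ) : z ≠ -k := by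
  intro h
  rw [h] at hz
  simp at hz
  have : (0 : ℝ) ≤ k := k.cast_nonneg
  linarith

/-- Since the series terminates, the binomial theorem turns Euler's integral into a finite sum of
Beta values, and no restriction on `z` arises. -/
theorem beta_mul_hypergeometric (n : ℕ) {b d : ℂ} (hb : 0 < b.re) (hd : 0 < d.re) (z : ℂ) :
    beta b d * ordinaryHypergeometric (-(n : ℂ)) b (b + d) (1 - z) = eulerInt n b d z := by
  have hbd : 0 < (b + d).re := by simp; linarith
  rw [eulerInt_eq_sum n hb hd, ordinaryHypergeometric_eq_tsum]
  simp only
  rw [tsum_eq_sum (s := Finset.range (n + 1)), Finset.mul_sum]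
  · refine Finset.sum_congr rfl fun k hk => ?_
    have hkn : k ≤ n := by simpa [Nat.lt_succ_iff] using hk
    have hG1 := Complex.Gamma_ne_zero_of_re_pos hb
    have hG2 := Complex.Gamma_ne_zero_of_re_pos hbd
    have hG3 : Complex.Gamma (b + d + k) ≠ 0 :=
      Complex.Gamma_ne_zero_of_re_pos (by
        rw [Complex.add_re, Complex.natCast_re]; positivity)
    have hbk : 0 < (b + k).re := by simp; positivity
    have hB := Complex.Gamma_mul_Gamma_eq_betaIntegral hbk hd
    have e1 : Complex.betaIntegral (b + k) d =
        Complex.Gamma (b + k) * Complex.Gamma d / Complex.Gamma (b + d + k) := by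
      rw [hB, show b + k + d = b + d + k by ring]
      field_simp
    rw [e1, ← Complex.Gamma_add_nat_div_Gamma_eq b (ne_neg_natCast_of_re_pos hb),
      ← Complex.Gamma_add_nat_div_Gamma_eq (b + d) (ne_neg_natCast_of_re_pos hbd),
      ascPochhammer_eval_neg_eq_descPochhammer, descPochhammer_eval_eq_descFactorial, beta,
      smul_eq_mul, Nat.descFactorial_eq_factorial_mul_choose, neg_pow (1 - z)]
    have hf : (k.factorial : ℂ) ≠ 0 := by exact_mod_cast k.factorial_ne_zero
    push_cast
    field_simp
  · intro k hk
    have hkn : n < k := by simpa [Nat.lt_succ_iff] using hk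
    rw [ascPochhammer_eval_neg_coe_nat_of_lt hkn]
    simp

theorem continuous_eulerInt (n : ℕ) {b d : ℂ} (hb : 0 < b.re) (hd : 0 < d.re) :
    Continuous (eulerInt n b d) := by
  rw [show eulerInt n b d = _ from funext (eulerInt_eq_sum n hb hd)]
  fun_prop

/-- The sum of the two branches of Euler's integral, split at the zero of `1 - (1 - z) s`. -/
def branchSum (n : ℕ) (b d z : ℂ) : ℂ :=
  z ^ n * powLower (1 + 1 / (z - 1)) d * K n d (b - 1) (z / (1 - z)) +
    powLower (1 + z / (1 - z)) b * K n b (d - 1) (1 / (z - 1))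

theorem eulerInt_zero (n : ℕ) {b d : ℂ} (hd : 0 < d.re) :
    eulerInt n b d 0 = branchSum n b d 0 := by
  have hd0 : d ≠ 0 := fun h => by simp [h] at hd
  have h1 : (1 : ℂ) + 1 / (0 - 1) = 0 := by norm_num
  have h2 : (1 : ℂ) / (0 - 1) = -1 := by norm_num
  rw [branchSum, h1, powLower_zero hd0, h2]
  simp only [zero_div, add_zero, powLower_one, mul_zero, zero_mul, zero_add, one_mul]
  rw [K, eulerInt]
  refine intervalIntegral.integral_congr_uIoo fun s hs => ?_
  rw [uIoo_of_le zero_le_one] at hs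
  have : (1 + -1 * (s : ℂ)) ∈ Complex.slitPlane := by
    left; simp; exact hs.2
  simp only [kern]
  rw [powLower_eq_cpow this]
  rw [show (1 : ℂ) - (1 - 0) * s = 1 - s by ring, show (1 : ℂ) + -1 * s = 1 - s by ring]
  ring

/-- For `z = -τ` the polynomial factor vanishes at `s₀ = 1/(1+τ)`. The substitutions `s = s₀ u` on
the left piece and `s = 1 - σ u` on the right piece turn it into `(1-u)^n` and `(-τ)^n (1-u)^n`. -/
theorem eulerInt_neg_ofReal (n : ℕ) {b d : ℂ} (hb : 0 < b.re) (hd : 0 < d.re) {τ : ℝ}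
    (hτ : 0 < τ) : eulerInt n b d (-(τ : ℂ)) = branchSum n b d (-(τ : ℂ)) := by
  have h1τ : 0 < 1 + τ := by linarith
  set s₀ : ℝ := 1 / (1 + τ) with hs₀
  set σ : ℝ := τ / (1 + τ) with hσ
  have hs₀p : 0 < s₀ := by positivity
  have hσp : 0 < σ := by positivity
  have hsum : s₀ + σ = 1 := by rw [hs₀, hσ]; field_simp
  have hτC : (1 + τ : ℂ) ≠ 0 := by exact_mod_cast h1τ.ne'
  have hσC : (σ : ℂ) ≠ 0 := by exact_mod_cast hσp.ne'
  have hsC : (s₀ : ℂ) ≠ 0 := by exact_mod_cast hs₀p.ne'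
  have hψ2 : (1 : ℂ) / (-(τ : ℂ) - 1) = -(s₀ : ℂ) := by
    have : -(τ : ℂ) - 1 ≠ 0 := by
      rw [show -(τ : ℂ) - 1 = -(1 + τ) by ring]; exact neg_ne_zero.mpr hτC
    rw [hs₀, div_eq_iff this]; push_cast; field_simp; ring
  have hψ1 : -(τ : ℂ) / (1 - -(τ : ℂ)) = -(σ : ℂ) := by
    rw [hσ, sub_neg_eq_add]; push_cast; ring
  have hsumC : (s₀ : ℂ) + σ = 1 := by exact_mod_cast hsum
  have hst : (1 + τ : ℂ) * s₀ = 1 := by rw [hs₀]; push_cast; field_simp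
  have hσt : (1 + τ : ℂ) * σ = τ := by rw [hσ]; push_cast; field_simp
  set f : ℝ → ℂ := fun s =>
    (s : ℂ) ^ (b - 1) * (1 - (s : ℂ)) ^ (d - 1) * (1 - (1 - -(τ : ℂ)) * s) ^ n with hf
  have hfi : IntervalIntegrable f volume 0 1 :=
    (Complex.betaIntegral_convergent hb hd).mul_continuousOn (by fun_prop)
  have hmem : s₀ ∈ uIcc (0 : ℝ) 1 := by
    rw [uIcc_of_le zero_le_one]; exact ⟨hs₀p.le, by linarith⟩
  have hfi1 : IntervalIntegrable f volume 0 s₀ :=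
    hfi.mono_set (uIcc_subset_uIcc left_mem_uIcc hmem)
  have hfi2 : IntervalIntegrable f volume s₀ 1 :=
    hfi.mono_set (uIcc_subset_uIcc hmem right_mem_uIcc)
  have hsplit : eulerInt n b d (-(τ : ℂ)) = (∫ s in (0 : ℝ)..s₀, f s) + ∫ s in s₀..1, f s :=
    (intervalIntegral.integral_add_adjacent_intervals hfi1 hfi2).symm
  have hA : ∫ s in (0 : ℝ)..s₀, f s = (s₀ : ℂ) ^ b * K n b (d - 1) (-(s₀ : ℂ)) := by
    have := intervalIntegral.smul_integral_comp_mul_left f s₀ (a := 0) (b := 1)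
    rw [mul_zero, mul_one] at this
    rw [← this, K, ← intervalIntegral.integral_const_mul, ← intervalIntegral.integral_smul]
    refine intervalIntegral.integral_congr_uIoo fun u hu => ?_
    rw [uIoo_of_le zero_le_one] at hu
    have hsl : 1 + -(s₀ : ℂ) * u ∈ Complex.slitPlane := by
      left; simp; nlinarith [hu.1, hu.2]
    simp only [hf, kern, Complex.real_smul]
    rw [powLower_eq_cpow hsl]
    push_cast
    have e1 : ((s₀ : ℂ) * u) ^ (b - 1) = (s₀ : ℂ) ^ (b - 1) * (u : ℂ) ^ (b - 1) := by
      exact Complex.mul_cpow_ofReal_nonneg hs₀p.le hu.1.le _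
    have e2 : (s₀ : ℂ) ^ b = (s₀ : ℂ) ^ (b - 1) * s₀ := by
      simpa using Complex.cpow_add (b - 1) 1 hsC
    have e3 : 1 - (1 - -(τ : ℂ)) * (s₀ * u) = 1 - u := by
      linear_combination -(u : ℂ) * hst
    rw [e1, e2, e3]
    ring_nf
  have hB : ∫ s in s₀..1, f s =
      (-(τ : ℂ)) ^ n * (σ : ℂ) ^ d * K n d (b - 1) (-(σ : ℂ)) := by
    have := intervalIntegral.smul_integral_comp_sub_mul f σ 1 (a := 0) (b := 1)
    rw [mul_zero, mul_one, sub_zero, show 1 - σ = s₀ by linarith] at this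
    rw [← this, K, ← intervalIntegral.integral_const_mul, ← intervalIntegral.integral_smul]
    refine intervalIntegral.integral_congr_uIoo fun u hu => ?_
    rw [uIoo_of_le zero_le_one] at hu
    have hsl : 1 + -(σ : ℂ) * u ∈ Complex.slitPlane := by
      left; simp; nlinarith [hu.1, hu.2]
    simp only [hf, kern, Complex.real_smul]
    rw [powLower_eq_cpow hsl]
    push_cast
    have e1 : (1 - (1 - (σ : ℂ) * u)) ^ (d - 1) = (σ : ℂ) ^ (d - 1) * (u : ℂ) ^ (d - 1) := by
      rw [sub_sub_cancel]
      exact Complex.mul_cpow_ofReal_nonneg hσp.le hu.1.le _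
    have e2 : (σ : ℂ) ^ d = (σ : ℂ) ^ (d - 1) * σ := by
      simpa using Complex.cpow_add (d - 1) 1 hσC
    have e3 : 1 - (1 - -(τ : ℂ)) * (1 - σ * u) = -τ * (1 - u) := by
      linear_combination (u : ℂ) * hσt
    rw [e1, e2, e3, mul_pow]
    ring_nf
  rw [hsplit, hA, hB, branchSum, hψ1, hψ2]
  have e1 : (1 : ℂ) + -(s₀ : ℂ) = σ := by linear_combination -hsumC
  have e2 : (1 : ℂ) + -(σ : ℂ) = s₀ := by linear_combination -hsumC
  rw [e1, e2, powLower_eq_cpow (by left; simpa using hσp),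
    powLower_eq_cpow (by left; simpa using hs₀p)]
  ring

theorem one_add_mem_slitPlane {v : ℂ} (hv : v ∈ Complex.slitPlane) :
    1 + v ∈ Complex.slitPlane := by
  rw [Complex.mem_slitPlane_iff] at hv ⊢
  rcases hv with h | h
  · left; simp; linarith
  · right; simpa using h

theorem inv_mem_slitPlane {v : ℂ} (hv : v ∈ Complex.slitPlane) : v⁻¹ ∈ Complex.slitPlane := by
  have h0 : 0 < Complex.normSq v := Complex.normSq_pos.mpr (Complex.slitPlane_ne_zero hv)
  rw [Complex.mem_slitPlane_iff] at hv ⊢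
  rcases hv with h | h
  · left; rw [Complex.inv_re]; positivity
  · right; rw [Complex.inv_im]; exact div_ne_zero (neg_ne_zero.mpr h) h0.ne'

theorem one_add_branch_one {z : ℂ} (hz : z ≠ 1) : 1 + z / (1 - z) = (1 - z)⁻¹ := by
  have : 1 - z ≠ 0 := sub_ne_zero.mpr hz.symm
  field_simp; ring

theorem one_add_branch_two {z : ℂ} (hz : z ≠ 1) (h0 : z ≠ 0) :
    1 + 1 / (z - 1) = (1 + (-z)⁻¹)⁻¹ := by
  have h1 : z - 1 ≠ 0 := sub_ne_zero.mpr hz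
  have h2 : 1 + (-z)⁻¹ = (z - 1) / z := by field_simp; ring
  rw [h2]
  field_simp; ring

theorem branch_mem_slitPlane {z : ℂ} (hz : -z ∈ Complex.slitPlane) :
    z ≠ 1 ∧ z ≠ 0 ∧ 1 + z / (1 - z) ∈ Complex.slitPlane ∧
      1 + 1 / (z - 1) ∈ Complex.slitPlane := by
  have h1 : z ≠ 1 := by
    rintro rfl
    rw [Complex.mem_slitPlane_iff] at hz
    simp at hz
    linarith
  have h0 : z ≠ 0 := by
    rintro rfl
    simp [Complex.mem_slitPlane_iff] at hz
  refine ⟨h1, h0, ?_, ?_⟩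
  · rw [one_add_branch_one h1]
    exact inv_mem_slitPlane (by simpa [sub_eq_add_neg] using one_add_mem_slitPlane hz)
  · rw [one_add_branch_two h1 h0]
    exact inv_mem_slitPlane (one_add_mem_slitPlane (inv_mem_slitPlane hz))

theorem differentiableAt_powLower {x : ℂ} (hx : x ∈ Complex.slitPlane) (γ : ℂ) :
    DifferentiableAt ℂ (fun x => powLower x γ) x := by
  have : DifferentiableAt ℂ (fun x => x ^ γ) x := differentiableAt_id.cpow_const hx
  refine this.congr_of_eventuallyEq ?_
  filter_upwards [Complex.isOpen_slitPlane.mem_nhds hx] with y hy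
  exact powLower_eq_cpow hy γ

theorem differentiableAt_branchSum (n : ℕ) {b d : ℂ} (hb : 0 < b.re) (hd : 0 < d.re) {z : ℂ}
    (hz : -z ∈ Complex.slitPlane) : DifferentiableAt ℂ (branchSum n b d) z := by
  obtain ⟨h1, h0, hs1, hs2⟩ := branch_mem_slitPlane hz
  have hm1 : z - 1 ≠ 0 := sub_ne_zero.mpr h1
  have hm2 : 1 - z ≠ 0 := sub_ne_zero.mpr h1.symm
  have d1 : DifferentiableAt ℂ (fun z : ℂ => z / (1 - z)) z := by fun_prop (disch := assumption)
  have d2 : DifferentiableAt ℂ (fun z : ℂ => 1 / (z - 1)) z := by fun_prop (disch := assumption)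
  have hb' : -1 < (b - 1).re := by simpa using hb
  have hd' : -1 < (d - 1).re := by simpa using hd
  refine DifferentiableAt.add (DifferentiableAt.mul (DifferentiableAt.mul (by fun_prop) ?_) ?_)
    (DifferentiableAt.mul ?_ ?_)
  · exact (differentiableAt_powLower hs2 d).comp z (f := fun z => 1 + 1 / (z - 1)) (d2.const_add 1)
  · exact (differentiableAt_K n hd hb' hs1).comp z d1
  · exact (differentiableAt_powLower hs1 b).comp z (f := fun z => 1 + z / (1 - z)) (d1.const_add 1)
  · exact (differentiableAt_K n hb hd' hs2).comp z d2

/-- Identity theorem on the complement of `[0,∞)`: the two sides agree at the points `-(1 +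
1/(m+1))`, which accumulate at `-1`. -/
theorem eulerInt_eq_branchSum_of_neg_mem (n : ℕ) {b d : ℂ} (hb : 0 < b.re) (hd : 0 < d.re) {z : ℂ}
    (hz : -z ∈ Complex.slitPlane) : eulerInt n b d z = branchSum n b d z := by
  have hf : AnalyticOnNhd ℂ (fun v => eulerInt n b d (-v)) Complex.slitPlane := by
    refine DifferentiableOn.analyticOnNhd ?_ Complex.isOpen_slitPlane
    rw [show eulerInt n b d = _ from funext (eulerInt_eq_sum n hb hd)]
    fun_prop
  have hg : AnalyticOnNhd ℂ (fun v => branchSum n b d (-v)) Complex.slitPlane := by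
    refine DifferentiableOn.analyticOnNhd (fun v hv => ?_) Complex.isOpen_slitPlane
    exact ((differentiableAt_branchSum n hb hd (by simpa using hv)).comp v
      differentiableAt_id.neg).differentiableWithinAt
  have hpc : IsPreconnected Complex.slitPlane :=
    (Complex.starConvex_one_slitPlane.isPathConnected
      Complex.one_mem_slitPlane).isConnected.isPreconnected
  have hfreq : ∃ᶠ v in 𝓝[≠] (1 : ℂ), eulerInt n b d (-v) = branchSum n b d (-v) := by
    have ht : Tendsto (fun m : ℕ => ((1 + 1 / ((m : ℝ) + 1) : ℝ) : ℂ)) atTop (𝓝[≠] 1) := by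
      refine tendsto_nhdsWithin_iff.mpr ⟨?_, Eventually.of_forall fun m => ?_⟩
      · have := (tendsto_one_div_add_atTop_nhds_zero_nat (𝕜 := ℝ)).const_add 1
        have h2 := (Complex.continuous_ofReal.tendsto _).comp this
        simpa [Function.comp_def] using h2
      · simp only [mem_compl_iff, mem_singleton_iff]
        intro h
        have h' : (1 + 1 / ((m : ℝ) + 1) : ℝ) = 1 := by exact_mod_cast h
        have : 0 < 1 / ((m : ℝ) + 1) := by positivity
        linarith
    refine ht.frequently (Eventually.of_forall fun m => ?_).frequently
    exact eulerInt_neg_ofReal n hb hd (by positivity)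
  have := hf.eqOn_of_preconnected_of_frequently_eq hg hpc Complex.one_mem_slitPlane hfreq hz
  simpa using this

theorem continuousWithinAt_K_comp (n : ℕ) {a γ : ℂ} (ha : 0 < a.re) (hγ : -1 < γ.re) {ψ : ℂ → ℂ}
    {S : Set ℂ} {z : ℂ} (hc : ContinuousAt ψ z) (hz : z ∈ S)
    (h : 1 + ψ z ∈ Complex.slitPlane ∨ MapsTo ψ S {φ | φ.im ≤ 0}) :
    ContinuousWithinAt (fun v => K n a γ (ψ v)) S z := by
  rcases h with h | h
  · exact (differentiableAt_K n ha hγ h).continuousAt.comp_continuousWithinAt hc.continuousWithinAt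
  · exact (continuousOn_K n ha hγ _ (h hz)).comp hc.continuousWithinAt h

theorem continuousWithinAt_powLower_comp {γ : ℂ} (hγ : 0 < γ.re) {ψ : ℂ → ℂ}
    {S : Set ℂ} {z : ℂ} (hc : ContinuousAt ψ z) (hz : z ∈ S)
    (h : 1 + ψ z ∈ Complex.slitPlane ∨ MapsTo ψ S {φ | φ.im ≤ 0}) :
    ContinuousWithinAt (fun v => powLower (1 + ψ v) γ) S z := by
  have hc' : ContinuousAt (fun v => 1 + ψ v) z := continuousAt_const.add hc
  rcases h with h | h
  · exact (differentiableAt_powLower h γ).continuousAt.comp_continuousWithinAt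
      (f := fun v => 1 + ψ v) hc'.continuousWithinAt
  · have h' : MapsTo (fun v => 1 + ψ v) S {φ | φ.im ≤ 0} := fun v hv => by
      simpa using h hv
    exact ContinuousWithinAt.comp (f := fun v => 1 + ψ v) (g := fun x => powLower x γ)
      (continuousOn_powLower hγ _ (h' hz)) hc'.continuousWithinAt h'

theorem continuousWithinAt_branchSum (n : ℕ) {b d : ℂ} (hb : 0 < b.re) (hd : 0 < d.re) {S : Set ℂ}
    {z : ℂ} (hz : z ∈ S) (hz1 : z ≠ 1)
    (h1 : 1 + z / (1 - z) ∈ Complex.slitPlane ∨ MapsTo (fun z => z / (1 - z)) S {φ | φ.im ≤ 0})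
    (h2 : 1 + 1 / (z - 1) ∈ Complex.slitPlane ∨ MapsTo (fun z => 1 / (z - 1)) S {φ | φ.im ≤ 0}) :
    ContinuousWithinAt (branchSum n b d) S z := by
  have hm1 : z - 1 ≠ 0 := sub_ne_zero.mpr hz1
  have hm2 : 1 - z ≠ 0 := sub_ne_zero.mpr hz1.symm
  have d1 : ContinuousAt (fun z : ℂ => z / (1 - z)) z := by fun_prop (disch := assumption)
  have d2 : ContinuousAt (fun z : ℂ => 1 / (z - 1)) z := by fun_prop (disch := assumption)
  have hb' : -1 < (b - 1).re := by simpa using hb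
  have hd' : -1 < (d - 1).re := by simpa using hd
  exact ((ContinuousWithinAt.mul (by fun_prop)
      (continuousWithinAt_powLower_comp hd d2 hz h2)).mul
      (continuousWithinAt_K_comp n hd hb' d1 hz h1)).add
    ((continuousWithinAt_powLower_comp hb d1 hz h1).mul
      (continuousWithinAt_K_comp n hb hd' d2 hz h2))

theorem branch_two_im (z : ℂ) : (1 / (z - 1)).im = -z.im / Complex.normSq (z - 1) := by
  simp [Complex.inv_im]

theorem branch_one_im {z : ℂ} (hz : z ≠ 1) :
    (z / (1 - z)).im = z.im / Complex.normSq (1 - z) := by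
  have h := congrArg Complex.im (one_add_branch_one hz)
  simpa [Complex.inv_im] using h

/-- Passage to the boundary `c ε`, `ε → 0`, from the open half plane `c ε > 0`. -/
theorem eulerInt_eq_branchSum_of_continuousWithinAt (n : ℕ) {b d : ℂ} (hb : 0 < b.re)
    (hd : 0 < d.re) {x c : ℝ} (hc : c ≠ 0)
    (h : ContinuousWithinAt (branchSum n b d) {z | z ≠ 1 ∧ 0 ≤ c * z.im} (x : ℂ)) :
    eulerInt n b d x = branchSum n b d x := by
  have hpath : Continuous fun ε : ℝ => (x : ℂ) + (c * ε : ℝ) * Complex.I := by fun_prop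
  have hp0 : (x : ℂ) + (c * (0 : ℝ) : ℝ) * Complex.I = x := by simp
  have him : ∀ ε : ℝ, ((x : ℂ) + (c * ε : ℝ) * Complex.I).im = c * ε := fun ε => by simp
  have ht : Tendsto (fun ε : ℝ => (x : ℂ) + (c * ε : ℝ) * Complex.I) (𝓝[>] 0) (𝓝 (x : ℂ)) := by
    have := hpath.tendsto 0
    rw [hp0] at this
    exact this.mono_left nhdsWithin_le_nhds
  have hmem : ∀ᶠ ε : ℝ in 𝓝[>] 0, (x : ℂ) + (c * ε : ℝ) * Complex.I ∈
      {z : ℂ | z ≠ 1 ∧ 0 ≤ c * z.im} := by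
    filter_upwards [self_mem_nhdsWithin] with ε hε
    have hε : 0 < ε := hε
    refine ⟨fun h => ?_, ?_⟩
    · have := congrArg Complex.im h
      rw [him] at this
      simp [hc, hε.ne'] at this
    · rw [him, ← mul_assoc]; exact mul_nonneg (mul_self_nonneg c) hε.le
  have l1 := ((continuous_eulerInt n hb hd).tendsto (x : ℂ)).comp ht
  have l2 := h.tendsto.comp (tendsto_nhdsWithin_iff.mpr ⟨ht, hmem⟩)
  refine tendsto_nhds_unique l1 (l2.congr' ?_)
  filter_upwards [self_mem_nhdsWithin] with ε hε
  have hε : 0 < ε := hε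
  refine (eulerInt_eq_branchSum_of_neg_mem n hb hd ?_).symm
  right
  rw [Complex.neg_im, him]
  exact neg_ne_zero.mpr (mul_ne_zero hc hε.ne')

/-- On `(0,1)` only `1/(z-1)` lies on the cut of `K`, on `(1,∞)` only `z/(1-z)`. The side of
approach is chosen so that this parameter keeps a nonpositive imaginary part: from above in the
first case, from below in the second. -/
theorem eulerInt_eq_branchSum (n : ℕ) {b d : ℂ} (hb : 0 < b.re) (hd : 0 < d.re) {z : ℂ}
    (hz : z ≠ 1) : eulerInt n b d z = branchSum n b d z := by
  by_cases hs : -z ∈ Complex.slitPlane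
  · exact eulerInt_eq_branchSum_of_neg_mem n hb hd hs
  rw [Complex.mem_slitPlane_iff] at hs
  push Not at hs
  obtain ⟨x, rfl⟩ : ∃ x : ℝ, z = x := ⟨z.re, by
    apply Complex.ext <;> simp at hs ⊢
    exact hs.2⟩
  have hx0 : 0 ≤ x := by simpa using hs.1
  have hx1 : x ≠ 1 := fun h => hz (by exact_mod_cast h)
  rcases hx0.eq_or_lt with rfl | hx0
  · simpa using eulerInt_zero n (b := b) hd
  rcases lt_or_gt_of_ne hx1 with hx | hx
  · refine eulerInt_eq_branchSum_of_continuousWithinAt n hb hd one_ne_zero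
      (continuousWithinAt_branchSum n hb hd ⟨hz, by simp⟩ hz (Or.inl ?_) (Or.inr ?_))
    · rw [one_add_branch_one hz]
      refine inv_mem_slitPlane (Or.inl ?_)
      simpa using hx
    · intro v hv
      have h1 : 0 ≤ v.im := by simpa using hv.2
      change (1 / (v - 1)).im ≤ 0
      rw [branch_two_im]
      exact div_nonpos_of_nonpos_of_nonneg (by linarith) (Complex.normSq_nonneg _)
  · refine eulerInt_eq_branchSum_of_continuousWithinAt n hb hd (neg_ne_zero.mpr one_ne_zero)
      (continuousWithinAt_branchSum n hb hd ⟨hz, by simp⟩ hz (Or.inr ?_) (Or.inl ?_))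
    · intro v hv
      have h1 : v.im ≤ 0 := by simpa using hv.2
      change (v / (1 - v)).im ≤ 0
      rw [branch_one_im hv.1]
      exact div_nonpos_of_nonpos_of_nonneg h1 (Complex.normSq_nonneg _)
    · have : (1 : ℂ) / (x - 1) = ((1 / (x - 1) : ℝ) : ℂ) := by push_cast; rfl
      rw [this]
      left
      have h1 : 0 < 1 / (x - 1) := by
        have : 0 < x - 1 := by linarith
        positivity
      simp only [Complex.add_re, Complex.one_re, Complex.ofReal_re]
      linarith

/-- For all `z ≠ 0, 1` the difference `arg(z-1) - arg z` lies in `(-π, π]`, so the logarithms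
subtract without correction. The value `π` occurs for `0 < z < 1`; after inversion this is the
branch `arg = -π` of `z/(z-1)`. -/
theorem cpow_mul_cpow_sub_one {z : ℂ} (h0 : z ≠ 0) (h1 : z ≠ 1) (d : ℂ) :
    z ^ d * (z - 1) ^ (-d) = powLower (1 + 1 / (z - 1)) d := by
  have hm : z - 1 ≠ 0 := sub_ne_zero.mpr h1
  have hinv : (1 + 1 / (z - 1))⁻¹ = (z - 1) / z := by
    have : 1 + 1 / (z - 1) = z / (z - 1) := by field_simp; ring
    rw [this, inv_div]
  have hlog : Complex.log ((z - 1) / z) = Complex.log (z - 1) - Complex.log z := by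
    have hexp : Complex.exp (Complex.log (z - 1) - Complex.log z) = (z - 1) / z := by
      rw [Complex.exp_sub, Complex.exp_log hm, Complex.exp_log h0]
    have key : -Real.pi < (z - 1).arg - z.arg ∧ (z - 1).arg - z.arg ≤ Real.pi := by
      have hpi := Real.pi_pos
      rcases lt_trichotomy z.im 0 with h | h | h
      · have a1 : (z - 1).arg < 0 := Complex.arg_neg_iff.mpr (by simpa using h)
        have a2 : z.arg < 0 := Complex.arg_neg_iff.mpr h
        have := Complex.neg_pi_lt_arg (z - 1)
        have := Complex.neg_pi_lt_arg z
        constructor <;> linarith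
      · obtain ⟨x, rfl⟩ : ∃ x : ℝ, z = x := ⟨z.re, by
          apply Complex.ext <;> simp [h]⟩
        have e : (x : ℂ) - 1 = ((x - 1 : ℝ) : ℂ) := by push_cast; rfl
        rw [e]
        rcases lt_or_ge x 0 with hx | hx
        · rw [Complex.arg_ofReal_of_neg hx, Complex.arg_ofReal_of_neg (by linarith)]
          constructor <;> linarith
        · rw [Complex.arg_ofReal_of_nonneg hx]
          have := Complex.neg_pi_lt_arg ((x - 1 : ℝ) : ℂ)
          have := Complex.arg_le_pi ((x - 1 : ℝ) : ℂ)
          constructor <;> linarith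
      · have a1 : 0 ≤ (z - 1).arg := Complex.arg_nonneg_iff.mpr (by simpa using h.le)
        have a2 : 0 ≤ z.arg := Complex.arg_nonneg_iff.mpr h.le
        have a3 : z.arg < Real.pi := lt_of_le_of_ne (Complex.arg_le_pi z) fun h' => by
          rw [Complex.arg_eq_pi_iff] at h'
          linarith [h'.2]
        have := Complex.arg_le_pi (z - 1)
        constructor <;> linarith
    rw [← hexp]
    refine Complex.log_exp ?_ ?_ <;> simp only [Complex.sub_im, Complex.log_im]
    · exact key.1
    · exact key.2
  have hne : 1 + 1 / (z - 1) ≠ 0 := fun h => by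
    rw [h, inv_zero] at hinv
    exact div_ne_zero hm h0 hinv.symm
  rw [powLower_def hne, hinv, hlog, Complex.cpow_def_of_ne_zero h0, Complex.cpow_def_of_ne_zero hm,
    ← Complex.exp_add]
  congr 1; ring

/-- The expansion of `K` in normalized form. -/
theorem sum_add_remainder (n p : ℕ) {a γ : ℂ} (ha : 0 < a.re) (hγ : -1 < γ.re) {ψ : ℂ}
    (hψ : ψ ≠ 0) :
    ∑ k ∈ Finset.range (p + 1), gbinom γ k * ψ ^ k * (Complex.Gamma (a + k) / Complex.Gamma a) *
        (1 / poch ((n : ℂ) + 1 + a) k) +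
      1 / beta (n + 1) a * ψ ^ (p + 1) * J n p a γ ψ = K n a γ ψ / beta (n + 1) a := by
  have hn : 0 < ((n : ℂ) + 1).re := by simp; positivity
  have hna : 0 < ((n : ℂ) + 1 + a).re := by rw [Complex.add_re]; linarith
  have hG1 := Complex.Gamma_ne_zero_of_re_pos ha
  have hG2 := Complex.Gamma_ne_zero_of_re_pos hn
  have hG3 := Complex.Gamma_ne_zero_of_re_pos hna
  rw [mul_assoc (1 / beta _ _), pow_mul_J n p ha hγ hψ, mul_sub, Finset.mul_sum, one_div_mul_eq_div,
    ← add_sub_assoc, add_sub_right_comm, ← Finset.sum_sub_distrib, Finset.sum_eq_zero, zero_add]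
  intro k _
  have hG4 : Complex.Gamma ((n : ℂ) + 1 + a + k) ≠ 0 :=
    Complex.Gamma_ne_zero_of_re_pos (by rw [Complex.add_re, Complex.natCast_re]; positivity)
  rw [gbinom_eq_bc hγ, poch, ← Complex.Gamma_add_nat_div_Gamma_eq _ (ne_neg_natCast_of_re_pos hna),
    beta, beta, show (n : ℂ) + 1 + (a + k) = n + 1 + a + k by ring]
  field_simp
  ring

theorem J_eq_integral_sub (n p : ℕ) (a γ ψ : ℂ) :
    ∫ t in (0 : ℝ)..1, (t : ℂ) ^ n * (1 - (t : ℂ)) ^ ((p : ℂ) + a) * r p (1 - (t : ℂ)) ψ γ =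
      J n p a γ ψ := by
  have := intervalIntegral.integral_comp_sub_left (a := 0) (b := 1)
    (fun u : ℝ => (1 - (u : ℂ)) ^ n * (u : ℂ) ^ ((p : ℂ) + a) * r p u ψ γ) 1
  rw [sub_self, sub_zero] at this
  rw [J, ← this]
  refine intervalIntegral.integral_congr fun t _ => ?_
  push_cast
  rw [sub_sub_cancel]

theorem xi1_eq (n p : ℕ) (z α β : ℂ) :
    xi1 n p z α β = 1 / beta (n + 1) (α - β) * (z / (1 - z)) ^ (p + 1) *
      J n p (α - β) (α + β) (z / (1 - z)) := by
  rw [xi1, ← J_eq_integral_sub]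
  simp only [add_sub_assoc]

theorem xi2_eq (n p : ℕ) (z α β : ℂ) :
    xi2 n p z α β = 1 / beta (n + 1) (α + β + 1) * (1 / (z - 1)) ^ (p + 1) *
      J n p (α + β + 1) (α - β - 1) (1 / (z - 1)) := by
  rw [xi2, ← J_eq_integral_sub, one_div_pow]
  simp only [show (p : ℂ) + 1 + α + β = p + (α + β + 1) by ring]

theorem decomposition (n p₁ p₂ : ℕ) {z α β : ℂ} (hz : z ≠ 1) (h : (α, β) ∈ Omega0) :
    P n z α β =
      g1 n z α β * (∑ k ∈ Finset.range (p₁ + 1), term1 k n z α β + xi1 n p₁ z α β) +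
      g2 n z α β * (∑ k ∈ Finset.range (p₂ + 1), term2 k n z α β + xi2 n p₂ z α β) := by
  have hb : 0 < (α + β + 1).re := by
    have := h.1
    simp at this ⊢; linarith
  have hd : 0 < (α - β).re := h.2
  have hb' : -1 < (α + β).re := h.1
  have hd' : -1 < (α - β - 1).re := by simp at hd ⊢; linarith
  have hc : 0 < (2 * α + 1).re := by simp at hb hd ⊢; linarith
  have hGb := Complex.Gamma_ne_zero_of_re_pos hb
  have hGd := Complex.Gamma_ne_zero_of_re_pos hd
  have hGc := Complex.Gamma_ne_zero_of_re_pos hc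
  have hn : 0 < ((n : ℂ) + 1).re := by simp; positivity
  have hGn := Complex.Gamma_ne_zero_of_re_pos hn
  have hGn1 : Complex.Gamma ((n : ℂ) + 1 + (α - β)) ≠ 0 :=
    Complex.Gamma_ne_zero_of_re_pos (by rw [Complex.add_re]; linarith)
  have hGn2 : Complex.Gamma ((n : ℂ) + 1 + (α + β + 1)) ≠ 0 :=
    Complex.Gamma_ne_zero_of_re_pos (by rw [Complex.add_re]; linarith)
  have hm : z - 1 ≠ 0 := sub_ne_zero.mpr hz
  have hE := beta_mul_hypergeometric n hb hd z
  rw [show α + β + 1 + (α - β) = 2 * α + 1 by ring, eulerInt_eq_branchSum n hb hd hz, branchSum,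
    show α + β + 1 - 1 = α + β by ring, beta,
    show α + β + 1 + (α - β) = 2 * α + 1 by ring] at hE
  have hP : P n z α β = Complex.Gamma (2 * α + 1) /
      (Complex.Gamma (α + β + 1) * Complex.Gamma (α - β)) *
      (z ^ n * powLower (1 + 1 / (z - 1)) (α - β) * K n (α - β) (α + β) (z / (1 - z)) +
        powLower (1 + z / (1 - z)) (α + β + 1) *
          K n (α + β + 1) (α - β - 1) (1 / (z - 1))) := by
    rw [← hE, P]
    generalize 2 * α + 1 = c at hGc ⊢
    field_simp
  have h2 : g2 n z α β *
      (∑ k ∈ Finset.range (p₂ + 1), term2 k n z α β + xi2 n p₂ z α β) =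
      Complex.Gamma (2 * α + 1) / (Complex.Gamma (α + β + 1) * Complex.Gamma (α - β)) *
        (powLower (1 + z / (1 - z)) (α + β + 1) *
          K n (α + β + 1) (α - β - 1) (1 / (z - 1))) := by
    have e := sum_add_remainder n p₂ hb hd' (one_div_ne_zero hm)
    have e' : ∑ k ∈ Finset.range (p₂ + 1), term2 k n z α β + xi2 n p₂ z α β =
        K n (α + β + 1) (α - β - 1) (1 / (z - 1)) / beta (n + 1) (α + β + 1) := by
      rw [← e, xi2_eq]
      congr 1
      refine Finset.sum_congr rfl fun k _ => ?_
      rw [term2, one_div_pow, show (k : ℂ) + α + β + 1 = α + β + 1 + k by ring,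
        show (n : ℂ) + 2 + α + β = n + 1 + (α + β + 1) by ring]
    rw [e', g2, beta, one_add_branch_one hz, powLower, inv_inv,
      show (n : ℂ) + α + β + 2 = n + 1 + (α + β + 1) by ring,
      show -(α + β + 1) = -α - β - 1 by ring]
    field_simp
  have h1 : g1 n z α β *
      (∑ k ∈ Finset.range (p₁ + 1), term1 k n z α β + xi1 n p₁ z α β) =
      Complex.Gamma (2 * α + 1) / (Complex.Gamma (α + β + 1) * Complex.Gamma (α - β)) *
        (z ^ n * powLower (1 + 1 / (z - 1)) (α - β) * K n (α - β) (α + β) (z / (1 - z))) := by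
    -- Here `ψ = 0` and the normalized expansion of `K` is not available, but both sides vanish: the
    -- left through `0 ^ (n + α - β)`, the right through `powLower 0`.
    by_cases h0 : z = 0
    · subst h0
      have hd0 : α - β ≠ 0 := fun h => by simp [h] at hd
      have hnd : (n : ℂ) + α - β ≠ 0 := fun h => by
        have := congrArg Complex.re h
        simp at this hd
        have : (0 : ℝ) ≤ n := n.cast_nonneg
        linarith
      rw [g1, Complex.zero_cpow hnd, show (1 : ℂ) + 1 / (0 - 1) = 0 by norm_num, powLower_zero hd0]
      ring
    have e := sum_add_remainder n p₁ hd hb' (div_ne_zero h0 (sub_ne_zero.mpr hz.symm))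
    have e' : ∑ k ∈ Finset.range (p₁ + 1), term1 k n z α β + xi1 n p₁ z α β =
        K n (α - β) (α + β) (z / (1 - z)) / beta (n + 1) (α - β) := by
      rw [← e, xi1_eq]
      congr 1
      refine Finset.sum_congr rfl fun k _ => ?_
      rw [term1, show (k : ℂ) + α - β = α - β + k by ring,
        show (n : ℂ) + 1 + α - β = n + 1 + (α - β) by ring]
    have e2 : z ^ ((n : ℂ) + α - β) = z ^ n * z ^ (α - β) := by
      rw [add_sub_assoc, Complex.cpow_add _ _ h0, Complex.cpow_natCast]
    rw [e', g1, beta, ← cpow_mul_cpow_sub_one h0 hz, e2, neg_sub,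
      show (n : ℂ) + α - β + 1 = n + 1 + (α - β) by ring]
    field_simp
  rw [hP, h1, h2]
  ring

end BiorthAsymp

end

noncomputable section

namespace BiorthAsymp

open MeasureTheory Set Filter Topology

/-! ### A bound for the remainder of the binomial series -/

/-- The remainder of the binomial expansion of `(e^ℓ)^γ` in powers of `e^ℓ - 1`. -/
def binomRem (q : ℕ) (γ ℓ : ℂ) : ℂ :=
  Complex.exp (γ * ℓ) - ∑ k ∈ Finset.range q, bc γ k * (Complex.exp ℓ - 1) ^ k

/-- Differentiation in the logarithmic variable removes one subtracted term and lowers the exponent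
by one, by `(k+1) bc γ (k+1) = γ bc (γ-1) k`. -/
theorem hasDerivAt_binomRem (q : ℕ) (γ ℓ : ℂ) (s : ℝ) :
    HasDerivAt (fun s : ℝ => binomRem (q + 1) γ (s * ℓ))
      (ℓ * γ * Complex.exp (s * ℓ) * binomRem q (γ - 1) (s * ℓ)) s := by
  have hl : HasDerivAt (fun s : ℂ => s * ℓ) ℓ s := by
    simpa using (hasDerivAt_id (s : ℂ)).mul_const ℓ
  have h1 : HasDerivAt (fun s : ℂ => Complex.exp (γ * (s * ℓ)))
      (Complex.exp (γ * (s * ℓ)) * (γ * ℓ)) s := (hl.const_mul γ).cexp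
  have h2 : HasDerivAt (fun s : ℂ => Complex.exp (s * ℓ) - 1) (Complex.exp (s * ℓ) * ℓ) s :=
    hl.cexp.sub_const 1
  have h3 : HasDerivAt (fun s : ℂ => ∑ k ∈ Finset.range (q + 1),
      bc γ k * (Complex.exp (s * ℓ) - 1) ^ k)
      (∑ k ∈ Finset.range (q + 1), bc γ k * (k * (Complex.exp (s * ℓ) - 1) ^ (k - 1) *
        (Complex.exp (s * ℓ) * ℓ))) s :=
    HasDerivAt.fun_sum fun k _ => (h2.pow k).const_mul _
  refine ((h1.sub h3).comp_ofReal).congr_deriv ?_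
  rw [Finset.sum_range_succ', binomRem, mul_sub, Finset.mul_sum]
  simp only [Nat.cast_zero, zero_mul, mul_zero, add_zero, Nat.add_sub_cancel]
  congr 1
  · rw [sub_mul, one_mul, Complex.exp_sub]
    have := Complex.exp_ne_zero (s * ℓ)
    field_simp
  · refine Finset.sum_congr rfl fun k _ => ?_
    have := succ_mul_bc_succ γ k
    push_cast
    linear_combination (Complex.exp (s * ℓ) - 1) ^ k * (Complex.exp (s * ℓ) * ℓ) * this

/-- Induction on `q`, integrating the derivative along the segment from `0` to `ℓ`. The factors `γ,
γ-1, …` met on the way multiply to `q! bc γ q`, so the bound vanishes together with the first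
omitted coefficient. -/
theorem norm_binomRem_le (q : ℕ) (γ ℓ : ℂ) :
    ‖binomRem q γ ℓ‖ ≤ (q.factorial * ‖bc γ q‖) * ‖ℓ‖ ^ q * Real.exp (max 0 ℓ.re) ^ q *
      max 1 ‖Complex.exp (γ * ℓ)‖ := by
  induction q generalizing γ ℓ with
  | zero => simp [binomRem]
  | succ q ih =>
    set m := Real.exp (max 0 ℓ.re) with hm
    have hm1 : 1 ≤ m := Real.one_le_exp (le_max_left _ _)
    set E := max 1 ‖Complex.exp (γ * ℓ)‖ with hE
    have hE1 : 1 ≤ E := le_max_left _ _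
    have hbc : ‖γ‖ * (q.factorial * ‖bc (γ - 1) q‖) =
        (q + 1).factorial * ‖bc γ (q + 1)‖ := by
      have := congrArg norm (succ_mul_bc_succ γ q)
      rw [norm_mul, norm_mul] at this
      have h2 : ‖(q : ℂ) + 1‖ = q + 1 := by
        rw [show (q : ℂ) + 1 = ((q + 1 : ℕ) : ℂ) by push_cast; rfl, Complex.norm_natCast]
        push_cast; rfl
      rw [h2] at this
      rw [Nat.factorial_succ]
      push_cast
      linear_combination -(q.factorial : ℝ) * this
    have hbound : ∀ s ∈ Ico (0 : ℝ) 1,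
        ‖ℓ * γ * Complex.exp (s * ℓ) * binomRem q (γ - 1) (s * ℓ)‖ ≤
        ((q + 1).factorial * ‖bc γ (q + 1)‖) * ‖ℓ‖ ^ (q + 1) * m ^ (q + 1) * E := by
      intro s hs
      have hsl : ‖(s : ℂ) * ℓ‖ ≤ ‖ℓ‖ := by
        rw [norm_mul, Complex.norm_real, Real.norm_of_nonneg hs.1]
        exact mul_le_of_le_one_left (norm_nonneg _) hs.2.le
      have hre : ((s : ℂ) * ℓ).re = s * ℓ.re := by simp
      have h1 : Real.exp (max 0 ((s : ℂ) * ℓ).re) ≤ m := by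
        refine Real.exp_le_exp.mpr (max_le (le_max_left _ _) ?_)
        rw [hre]
        rcases le_total 0 ℓ.re with h | h
        · exact (mul_le_of_le_one_left h hs.2.le).trans (le_max_right _ _)
        · exact (mul_nonpos_of_nonneg_of_nonpos hs.1 h).trans (le_max_left _ _)
      have h2 : ‖Complex.exp (s * ℓ)‖ * max 1 ‖Complex.exp ((γ - 1) * (s * ℓ))‖ ≤ m * E := by
        rw [mul_max_of_nonneg _ _ (norm_nonneg _), mul_one]
        refine max_le ?_ ?_
        · rw [Complex.norm_exp]
          calc Real.exp ((s : ℂ) * ℓ).re ≤ Real.exp (max 0 ((s : ℂ) * ℓ).re) :=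
                Real.exp_le_exp.mpr (le_max_right _ _)
            _ ≤ m * 1 := by rw [mul_one]; exact h1
            _ ≤ m * E := by gcongr
        · rw [← norm_mul, ← Complex.exp_add, show s * ℓ + (γ - 1) * (s * ℓ) = s * (γ * ℓ) by ring]
          refine le_trans ?_ (le_mul_of_one_le_left (by linarith) hm1)
          rw [hE, Complex.norm_exp, Complex.norm_exp, ← Real.exp_zero, ← Real.exp_monotone.map_max]
          refine Real.exp_le_exp.mpr ?_
          rw [Complex.re_ofReal_mul]
          rcases le_total 0 (γ * ℓ).re with h | h
          · exact (mul_le_of_le_one_left h hs.2.le).trans (le_max_right _ _)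
          · exact (mul_nonpos_of_nonneg_of_nonpos hs.1 h).trans (le_max_left _ _)
      have h3 := ih (γ - 1) (s * ℓ)
      calc _ = ‖ℓ‖ * ‖γ‖ * ‖Complex.exp (s * ℓ)‖ * ‖binomRem q (γ - 1) (s * ℓ)‖ := by
            rw [norm_mul, norm_mul, norm_mul]
        _ ≤ ‖ℓ‖ * ‖γ‖ * ‖Complex.exp (s * ℓ)‖ * ((q.factorial * ‖bc (γ - 1) q‖) * ‖ℓ‖ ^ q * m ^ q *
            max 1 ‖Complex.exp ((γ - 1) * (s * ℓ))‖) := by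
            refine mul_le_mul_of_nonneg_left (h3.trans ?_) (by positivity)
            gcongr
        _ = ‖γ‖ * (q.factorial * ‖bc (γ - 1) q‖) * ‖ℓ‖ ^ (q + 1) * m ^ q *
            (‖Complex.exp (s * ℓ)‖ * max 1 ‖Complex.exp ((γ - 1) * (s * ℓ))‖) := by ring
        _ ≤ ‖γ‖ * (q.factorial * ‖bc (γ - 1) q‖) * ‖ℓ‖ ^ (q + 1) * m ^ q * (m * E) := by
            gcongr
        _ = _ := by rw [hbc]; ring
    have h := norm_image_sub_le_of_norm_deriv_le_segment_01'
      (fun s _ => (hasDerivAt_binomRem q γ ℓ s).hasDerivWithinAt) hbound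
    have h0 : binomRem (q + 1) γ ((0 : ℝ) * ℓ) = 0 := by
      simp [binomRem, Finset.sum_range_succ']
    rw [h0] at h
    simpa using h

theorem r_eq_binomRem (p : ℕ) {γ : ℂ} (hγ : -1 < γ.re) {ψ u : ℂ} (h : 1 + ψ * u ≠ 0) :
    r p u ψ γ = binomRem (p + 1) γ (-Complex.log (1 + ψ * u)⁻¹) / (ψ * u) ^ (p + 1) := by
  rw [r, binomRem, powLower_def h, mul_comm γ, Complex.exp_neg (Complex.log _),
    Complex.exp_log (inv_ne_zero h), inv_inv, add_sub_cancel_left]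
  simp only [gbinom_eq_bc hγ]

theorem norm_r_le (p : ℕ) {γ : ℂ} (hγ : -1 < γ.re) {ψ u : ℂ} (h : 1 + ψ * u ≠ 0) :
    ‖r p u ψ γ‖ ≤ ((p + 1).factorial * ‖bc γ (p + 1)‖) *
      (‖Complex.log (1 + ψ * u)⁻¹‖ / ‖ψ * u‖) ^ (p + 1) * max 1 ‖1 + ψ * u‖ ^ (p + 1) *
      max 1 ‖powLower (1 + ψ * u) γ‖ := by
  rw [r_eq_binomRem p hγ h, norm_div, norm_pow, powLower_def h, div_pow]
  have h1 := norm_binomRem_le (p + 1) γ (-Complex.log (1 + ψ * u)⁻¹)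
  have h2 : Real.exp (max 0 (-Complex.log (1 + ψ * u)⁻¹).re) = max 1 ‖1 + ψ * u‖ := by
    rw [Real.exp_monotone.map_max, Real.exp_zero, Complex.neg_re, Complex.log_re, norm_inv,
      Real.log_inv, neg_neg, Real.exp_log (norm_pos_iff.mpr h)]
  rw [h2, norm_neg, mul_comm γ] at h1
  calc _ ≤ _ := div_le_div_of_nonneg_right h1 (by positivity)
    _ = _ := by ring

theorem norm_r_le_of_norm_le_half (p : ℕ) {γ : ℂ} (hγ : -1 < γ.re) {G : ℝ} (hG : ‖γ‖ ≤ G)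
    {ψ u : ℂ} (h : ‖ψ * u‖ ≤ 1 / 2) :
    ‖r p u ψ γ‖ ≤ (p + 1).factorial * 4 ^ (p + 1) * (Real.exp (Real.pi * G) * 2 ^ G) *
      ‖bc γ (p + 1)‖ := by
  have hG0 : 0 ≤ G := (norm_nonneg _).trans hG
  have hy1 : 1 / 2 ≤ ‖1 + ψ * u‖ := by
    have e2 := norm_sub_norm_le (1 : ℂ) (-(ψ * u))
    rw [sub_neg_eq_add, norm_neg, norm_one] at e2
    linarith
  have hy2 : ‖1 + ψ * u‖ ≤ 2 := (norm_add_le _ _).trans (by rw [norm_one]; linarith)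
  have h0 : 1 + ψ * u ≠ 0 := norm_pos_iff.mp (by linarith)
  by_cases hx : ψ * u = 0
  · rw [r, hx]
    simp only [ne_eq, Nat.add_eq_zero_iff, one_ne_zero, and_false, not_false_eq_true, zero_pow,
      div_zero, norm_zero]
    positivity
  refine (norm_r_le p hγ h0).trans ?_
  have hsl : 1 + ψ * u ∈ Complex.slitPlane := by
    left
    have := (abs_le.mp ((Complex.abs_re_le_norm (ψ * u)).trans h)).1
    rw [Complex.add_re, Complex.one_re]; linarith
  have hl : ‖Complex.log (1 + ψ * u)⁻¹‖ / ‖ψ * u‖ ≤ 2 := by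
    rw [Complex.log_inv _ (Complex.slitPlane_arg_ne_pi hsl), norm_neg,
      div_le_iff₀ (norm_pos_iff.mpr hx)]
    have := Complex.norm_log_one_add_half_le_self h
    linarith [norm_nonneg (ψ * u)]
  have hp : max 1 ‖powLower (1 + ψ * u) γ‖ ≤ Real.exp (Real.pi * G) * 2 ^ G := by
    have hA : 1 ≤ Real.exp (Real.pi * G) := Real.one_le_exp (by positivity)
    have hB : (1 : ℝ) ≤ 2 ^ G := Real.one_le_rpow (by norm_num) hG0
    refine max_le (by nlinarith) ((norm_powLower_le _ _).trans ?_)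
    have hi : |γ.im| ≤ G := (Complex.abs_im_le_norm γ).trans hG
    have hr : |γ.re| ≤ G := (Complex.abs_re_le_norm γ).trans hG
    refine mul_le_mul (Real.exp_le_exp.mpr (by gcongr)) ?_ (by positivity) (by positivity)
    rcases le_total 0 γ.re with hg | hg
    · calc ‖1 + ψ * u‖ ^ γ.re ≤ 2 ^ γ.re := by gcongr
        _ ≤ 2 ^ G := Real.rpow_le_rpow_of_exponent_le (by norm_num) ((le_abs_self _).trans hr)
    · calc ‖1 + ψ * u‖ ^ γ.re ≤ (1 / 2 : ℝ) ^ γ.re :=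
            Real.rpow_le_rpow_of_nonpos (by norm_num) hy1 hg
        _ = 2 ^ (-γ.re) := by
            rw [one_div, Real.inv_rpow (by norm_num), Real.rpow_neg (by norm_num)]
        _ ≤ 2 ^ G := Real.rpow_le_rpow_of_exponent_le (by norm_num) ((neg_le_abs _).trans hr)
  have hm : max 1 ‖1 + ψ * u‖ ≤ 2 := max_le (by norm_num) hy2
  calc _ ≤ ((p + 1).factorial * ‖bc γ (p + 1)‖) * 2 ^ (p + 1) * 2 ^ (p + 1) *
        (Real.exp (Real.pi * G) * 2 ^ G) := by gcongr
    _ = (p + 1).factorial * (2 * 2 : ℝ) ^ (p + 1) * (Real.exp (Real.pi * G) * 2 ^ G) *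
      ‖bc γ (p + 1)‖ := by rw [mul_pow]; ring
    _ = _ := by norm_num

theorem abs_log_mul_rpow_le {κ R y : ℝ} (hκ : 0 < κ) (hκ1 : κ ≤ 1) (hR : 1 ≤ R) (hy : 0 < y)
    (hyR : y ≤ R) : (|Real.log y| + Real.pi) * y ^ κ ≤ 1 / κ + R * R + 4 * R := by
  have hyk : y ^ κ ≤ R := by
    calc y ^ κ ≤ R ^ κ := by gcongr
      _ ≤ R ^ (1 : ℝ) := Real.rpow_le_rpow_of_exponent_le hR hκ1
      _ = R := Real.rpow_one R
  have hyk0 : 0 ≤ y ^ κ := by positivity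
  have hpi : Real.pi * y ^ κ ≤ 4 * R := mul_le_mul Real.pi_le_four hyk hyk0 (by norm_num)
  have hl : |Real.log y| * y ^ κ ≤ 1 / κ + R * R := by
    rcases le_total y 1 with h | h
    · have := (Real.abs_log_mul_self_rpow_lt y κ hy h hκ).le
      rw [abs_mul, abs_of_nonneg hyk0] at this
      nlinarith
    · have h1 : |Real.log y| ≤ R := by
        rw [abs_of_nonneg (Real.log_nonneg h)]
        linarith [Real.log_le_sub_one_of_pos hy]
      have h2 : |Real.log y| * y ^ κ ≤ R * R := mul_le_mul h1 hyk hyk0 (by linarith)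
      have : 0 < 1 / κ := by positivity
      linarith
  linarith

/-- With `y = ‖1 + ψ u‖`, each of the `p+1` logarithms costs at most a multiple of `y^(-κ)`, `κ =
δ/(p+1)`, together `y^(-δ)`. The power `γ` costs `y^(-(1-2δ))`. The total exponent `-1 + δ` is still
integrable. -/
theorem exists_norm_r_le_of_half_le (p : ℕ) {δ M G : ℝ} (hδ : 0 < δ) (hδ1 : δ < 1 / 2)
    (hM : 0 ≤ M) :
    ∃ C : ℝ, 0 ≤ C ∧ ∀ γ ψ u : ℂ, -1 + 2 * δ ≤ γ.re → ‖γ‖ ≤ G → 1 / 2 ≤ ‖ψ * u‖ → ‖ψ * u‖ ≤ M →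
      1 + ψ * u ≠ 0 → ‖r p u ψ γ‖ ≤ C * ‖bc γ (p + 1)‖ * ‖1 + ψ * u‖ ^ (-1 + δ) := by
  set R := 1 + M with hR
  have hR1 : 1 ≤ R := by linarith
  set κ := δ / (p + 1) with hκ
  have hp1 : (0 : ℝ) < p + 1 := by positivity
  have hκ0 : 0 < κ := by positivity
  have hκ1 : κ ≤ 1 := by
    rw [hκ, div_le_one hp1]
    have : (0 : ℝ) ≤ p := p.cast_nonneg
    linarith
  set A := 1 / κ + R * R + 4 * R with hA
  have hA0 : 0 ≤ A := by positivity
  refine ⟨(p + 1).factorial * (2 * A) ^ (p + 1) * R ^ (p + 1) *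
    (R + Real.exp (Real.pi * G) * R ^ (G + 1)), by positivity, ?_⟩
  intro γ ψ u hγ hγG h1 h2 h0
  set y := ‖1 + ψ * u‖ with hy
  have hy0 : 0 < y := norm_pos_iff.mpr h0
  have hyR : y ≤ R := (norm_add_le _ _).trans (by rw [norm_one]; linarith)
  refine (norm_r_le p (by linarith) h0).trans ?_
  have hlog : ‖Complex.log (1 + ψ * u)⁻¹‖ ≤ |Real.log y| + Real.pi := by
    refine (Complex.norm_le_abs_re_add_abs_im _).trans ?_
    rw [Complex.log_re, Complex.log_im, norm_inv, Real.log_inv, abs_neg]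
    linarith [Complex.abs_arg_le_pi (1 + ψ * u)⁻¹]
  have hl : (‖Complex.log (1 + ψ * u)⁻¹‖ / ‖ψ * u‖) ^ (p + 1) ≤ (2 * A) ^ (p + 1) * y ^ (-δ) := by
    have e1 : ‖Complex.log (1 + ψ * u)⁻¹‖ / ‖ψ * u‖ ≤ 2 * A * y ^ (-κ) := by
      rw [div_le_iff₀ (by linarith)]
      have := abs_log_mul_rpow_le hκ0 hκ1 hR1 hy0 hyR
      have hA2 : |Real.log y| + Real.pi ≤ A * y ^ (-κ) := by
        rw [Real.rpow_neg hy0.le, ← div_eq_mul_inv, le_div_iff₀ (by positivity)]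
        exact this
      have h3 : 0 ≤ A * y ^ (-κ) := by positivity
      nlinarith
    calc _ ≤ (2 * A * y ^ (-κ)) ^ (p + 1) := by gcongr
      _ = _ := by
        rw [mul_pow, ← Real.rpow_natCast (y ^ (-κ)), ← Real.rpow_mul hy0.le, hκ]
        congr 2
        push_cast; field_simp
  have hm : max 1 y ≤ R := max_le hR1 hyR
  have hp : max 1 ‖powLower (1 + ψ * u) γ‖ ≤
      (R + Real.exp (Real.pi * G) * R ^ (G + 1)) * y ^ (-(1 - 2 * δ)) := by
    have hi : |γ.im| ≤ G := (Complex.abs_im_le_norm γ).trans hγG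
    have hr : γ.re ≤ G := (le_abs_self _).trans ((Complex.abs_re_le_norm γ).trans hγG)
    have hb1 : 1 ≤ R * y ^ (-(1 - 2 * δ)) := by
      rw [Real.rpow_neg hy0.le, ← div_eq_mul_inv, le_div_iff₀ (by positivity), one_mul]
      calc y ^ (1 - 2 * δ) ≤ R ^ (1 - 2 * δ) :=
            Real.rpow_le_rpow hy0.le hyR (by linarith)
        _ ≤ R ^ (1 : ℝ) := Real.rpow_le_rpow_of_exponent_le hR1 (by linarith)
        _ = R := Real.rpow_one R
    have hb2 : y ^ γ.re ≤ R ^ (G + 1) * y ^ (-(1 - 2 * δ)) := by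
      have : y ^ γ.re = y ^ (γ.re + (1 - 2 * δ)) * y ^ (-(1 - 2 * δ)) := by
        rw [← Real.rpow_add hy0]; congr 1; ring
      rw [this]
      refine mul_le_mul_of_nonneg_right ?_ (by positivity)
      calc y ^ (γ.re + (1 - 2 * δ)) ≤ R ^ (γ.re + (1 - 2 * δ)) :=
            Real.rpow_le_rpow hy0.le hyR (by linarith)
        _ ≤ R ^ (G + 1) := Real.rpow_le_rpow_of_exponent_le hR1 (by linarith)
    have hE : Real.exp (Real.pi * |γ.im|) ≤ Real.exp (Real.pi * G) :=
      Real.exp_le_exp.mpr (by gcongr)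
    have h5 : ‖powLower (1 + ψ * u) γ‖ ≤
        Real.exp (Real.pi * G) * (R ^ (G + 1) * y ^ (-(1 - 2 * δ))) :=
      (norm_powLower_le _ _).trans (by gcongr)
    have h6 : 0 ≤ Real.exp (Real.pi * G) * (R ^ (G + 1) * y ^ (-(1 - 2 * δ))) := by positivity
    rw [add_mul]
    refine max_le ?_ ?_ <;> nlinarith
  calc _ ≤ ((p + 1).factorial * ‖bc γ (p + 1)‖) * ((2 * A) ^ (p + 1) * y ^ (-δ)) * R ^ (p + 1) *
        ((R + Real.exp (Real.pi * G) * R ^ (G + 1)) * y ^ (-(1 - 2 * δ))) := by gcongr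
    _ = (p + 1).factorial * (2 * A) ^ (p + 1) * R ^ (p + 1) *
        (R + Real.exp (Real.pi * G) * R ^ (G + 1)) * ‖bc γ (p + 1)‖ *
        (y ^ (-δ) * y ^ (-(1 - 2 * δ))) := by ring
    _ = _ := by
      rw [← Real.rpow_add hy0]
      congr 2; ring

end BiorthAsymp

end

/-! ### Uniform comparison of the remainders with the first omitted terms -/

noncomputable section

namespace BiorthAsymp

open MeasureTheory Set Filter Topology

/-- Where `|u - c| > 1` the integrand is at most `1`; elsewhere it is a translate of `|v|^g` on
`[-1,1]`. Neither contribution depends on `c`. -/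
theorem exists_integral_abs_sub_rpow_le {g : ℝ} (hg : -1 < g) (hg0 : g ≤ 0) :
    ∃ H : ℝ, 0 ≤ H ∧ ∀ c : ℝ, ∫ u in (0 : ℝ)..1, |u - c| ^ g ≤ H := by
  set φ : ℝ → ℝ := (Icc (-1 : ℝ) 1).indicator fun v => |v| ^ g with hφ
  have hφ0 : ∀ v, 0 ≤ φ v := fun v => indicator_nonneg (fun _ _ => by positivity) v
  have hφi : Integrable φ := by
    rw [hφ, integrable_indicator_iff measurableSet_Icc]
    have := intervalIntegrable_abs_sub_rpow hg 0 (-1) 1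
    rw [intervalIntegrable_iff_integrableOn_Icc_of_le (by norm_num)] at this
    simpa using this
  refine ⟨1 + ∫ v, φ v, by
    have : 0 ≤ ∫ v, φ v := integral_nonneg fun v => hφ0 v
    linarith, fun c => ?_⟩
  have hφc : Integrable fun u => φ (u - c) := hφi.comp_sub_right c
  calc ∫ u in (0 : ℝ)..1, |u - c| ^ g ≤ ∫ u in (0 : ℝ)..1, (1 + φ (u - c)) := by
        refine intervalIntegral.integral_mono_on zero_le_one
          (intervalIntegrable_abs_sub_rpow hg c 0 1)
          (intervalIntegrable_const.add hφc.intervalIntegrable) fun u _ => ?_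
        by_cases h : u - c ∈ Icc (-1 : ℝ) 1
        · rw [hφ, indicator_of_mem h]; linarith
        · rw [hφ, indicator_of_notMem h, add_zero]
          refine Real.rpow_le_one_of_one_le_of_nonpos ?_ hg0
          by_contra h'
          exact h (abs_le.mp (not_le.mp h').le)
    _ = 1 + ∫ u in (0 : ℝ)..1, φ (u - c) := by
        rw [intervalIntegral.integral_add intervalIntegrable_const hφc.intervalIntegrable]
        simp
    _ ≤ 1 + ∫ u, φ (u - c) := by
        rw [intervalIntegral.integral_of_le zero_le_one]
        gcongr
        · exact Eventually.of_forall fun u => hφ0 _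
        · exact Measure.restrict_le_self
    _ = 1 + ∫ v, φ v := by rw [integral_sub_right_eq_self]

/-- On `[0, u₁]` the factor `(1-u)^n` is at least `(1-u₁)^n`. Hence whatever is `O((1-u₁)^n)` is
dominated by the Beta integral, uniformly in `n`. -/
theorem le_rbeta (n : ℕ) {X u₁ : ℝ} (hX : 0 < X) (h0 : 0 < u₁) (h1 : u₁ ≤ 1) :
    (1 - u₁) ^ n * (u₁ ^ X / X) ≤ rbeta n X := by
  have hi := intervalIntegrable_rbeta n hX
  have hnn : ∀ u ∈ Ioc (0 : ℝ) 1, 0 ≤ (1 - u) ^ n * u ^ (X - 1) := fun u hu => by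
    have : 0 ≤ 1 - u := by linarith [hu.2]
    have := Real.rpow_nonneg hu.1.le (X - 1)
    positivity
  have hmem : u₁ ∈ uIcc (0 : ℝ) 1 := by
    rw [uIcc_of_le zero_le_one]; exact ⟨h0.le, h1⟩
  have e : u₁ ^ X / X = ∫ u in (0 : ℝ)..u₁, u ^ (X - 1) := by
    rw [integral_rpow (Or.inl (by linarith)), sub_add_cancel, Real.zero_rpow hX.ne', sub_zero]
  calc (1 - u₁) ^ n * (u₁ ^ X / X) = ∫ u in (0 : ℝ)..u₁, (1 - u₁) ^ n * u ^ (X - 1) := by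
        rw [intervalIntegral.integral_const_mul, e]
    _ ≤ ∫ u in (0 : ℝ)..u₁, (1 - u) ^ n * u ^ (X - 1) := by
        refine intervalIntegral.integral_mono_on h0.le
          ((intervalIntegral.intervalIntegrable_rpow' (by linarith)).const_mul _)
          (hi.mono_set (uIcc_subset_uIcc left_mem_uIcc hmem)) fun u hu => ?_
        have := Real.rpow_nonneg hu.1 (X - 1)
        have : 0 ≤ 1 - u₁ := by linarith
        gcongr
        exact hu.2
    _ ≤ rbeta n X := by
        refine intervalIntegral.integral_mono_interval le_rfl h0.le h1 ?_ hi
        filter_upwards [ae_restrict_mem measurableSet_Ioc] with u hu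
        exact hnn u hu

theorem norm_remainder_weight (n p : ℕ) (a : ℂ) {u : ℝ} (hu : u ∈ Ioc (0 : ℝ) 1) :
    ‖(1 - (u : ℂ)) ^ n * (u : ℂ) ^ (p + a)‖ = (1 - u) ^ n * u ^ (p + a.re) := by
  rw [norm_mul, norm_pow, Complex.norm_cpow_eq_rpow_re_of_pos hu.1,
    show (1 : ℂ) - u = ((1 - u : ℝ) : ℂ) by push_cast; rfl, Complex.norm_real,
    Real.norm_of_nonneg (by linarith [hu.2])]
  simp

/-- Where `‖ψ u‖ ≤ 1/2` the remainder is bounded, which gives the Beta integral. Elsewhere `u ≥ u₁ =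
1/(2M)`, so `(1-u)^n ≤ (1-u₁)^n`, which `le_rbeta` absorbs, and the singularity at the zero of `1 +
ψ u` integrates to at most a fixed constant. -/
theorem exists_norm_J_le (p : ℕ) {δ M G A : ℝ} (hδ : 0 < δ) (hδ1 : δ < 1 / 2) (hM : 1 ≤ M) :
    ∃ C : ℝ, 0 ≤ C ∧ ∀ (n : ℕ) (a γ ψ : ℂ), 0 < a.re → a.re ≤ A → -1 + 2 * δ ≤ γ.re → ‖γ‖ ≤ G →
      ‖ψ‖ ≤ M → ‖J n p a γ ψ‖ ≤ C * ‖bc γ (p + 1)‖ * rbeta n (p + 1 + a.re) := by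
  obtain ⟨C₂, hC₂, hr₂⟩ := exists_norm_r_le_of_half_le p (δ := δ) (M := M) (G := G) hδ hδ1
    (by linarith)
  obtain ⟨H, hH, hHc⟩ := exists_integral_abs_sub_rpow_le (g := -1 + δ) (by linarith) (by linarith)
  set C₁ : ℝ := (p + 1).factorial * 4 ^ (p + 1) * (Real.exp (Real.pi * G) * 2 ^ G) with hC₁
  have hC₁0 : 0 ≤ C₁ := by positivity
  set u₁ : ℝ := 1 / (2 * M) with hu₁
  have hu₁0 : 0 < u₁ := by positivity
  have hu₁1 : u₁ ≤ 1 / 2 := by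
    rw [hu₁, div_le_div_iff₀ (by positivity) (by norm_num)]; linarith
  set B : ℝ := (1 / 2 : ℝ) ^ (-1 + δ) with hB
  have hB0 : 0 ≤ B := by positivity
  -- An upper bound for `X / u₁ ^ X` over all admissible `X = p + 1 + Re a`.
  set D : ℝ := (p + 1 + |A|) / u₁ ^ (p + 1 + |A|) with hD
  have hD0 : 0 ≤ D := by positivity
  refine ⟨C₁ + C₂ * B * H * D, by positivity, ?_⟩
  intro n a γ ψ ha haA hγ hγG hψM
  have hb0 : 0 ≤ ‖bc γ (p + 1)‖ := norm_nonneg _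
  have hX : 0 < (p : ℝ) + 1 + a.re := by positivity
  by_cases hψ : ψ = 0
  · subst hψ
    have : J n p a γ 0 = 0 := by simp [J, r]
    rw [this, norm_zero]
    have := (rbeta_pos n hX).le
    positivity
  set c := -(1 / ψ).re with hc
  set q : ℝ := (1 - u₁) ^ n with hq
  have hq0 : 0 ≤ q := pow_nonneg (by linarith) n
  have hne : ∀ᵐ u : ℝ ∂volume, u ≠ c := by simp [ae_iff]
  have hi1 : IntervalIntegrable (fun u : ℝ => C₁ * ‖bc γ (p + 1)‖ *
      ((1 - u) ^ n * u ^ ((p : ℝ) + 1 + a.re - 1))) volume 0 1 :=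
    (intervalIntegrable_rbeta n hX).const_mul _
  have hi2 : IntervalIntegrable (fun u : ℝ => C₂ * ‖bc γ (p + 1)‖ * q * B *
      |u - c| ^ (-1 + δ)) volume 0 1 :=
    (intervalIntegrable_abs_sub_rpow (by linarith) c 0 1).const_mul _
  have hle : ‖J n p a γ ψ‖ ≤ ∫ u in (0 : ℝ)..1, (C₁ * ‖bc γ (p + 1)‖ *
      ((1 - u) ^ n * u ^ ((p : ℝ) + 1 + a.re - 1)) +
      C₂ * ‖bc γ (p + 1)‖ * q * B * |u - c| ^ (-1 + δ)) := by
    refine intervalIntegral.norm_integral_le_of_norm_le zero_le_one ?_ (hi1.add hi2)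
    filter_upwards [hne] with u huc hu
    have hu0 := hu.1
    rw [norm_mul, norm_remainder_weight n p a hu]
    have e0 : u ^ ((p : ℝ) + a.re) = u ^ ((p : ℝ) + 1 + a.re - 1) := by congr 1; ring
    have hw0 : 0 ≤ (1 - u) ^ n := pow_nonneg (by linarith [hu.2]) n
    have hx : ‖ψ * (u : ℂ)‖ = ‖ψ‖ * u := by
      rw [norm_mul, Complex.norm_real, Real.norm_of_nonneg hu0.le]
    rcases le_or_gt ‖ψ * (u : ℂ)‖ (1 / 2) with h | h
    · have h1 := norm_r_le_of_norm_le_half p (by linarith) hγG h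
      have h2 : 0 ≤ C₂ * ‖bc γ (p + 1)‖ * q * B * |u - c| ^ (-1 + δ) := by positivity
      have h3 : 0 ≤ u ^ ((p : ℝ) + a.re) := by positivity
      calc _ ≤ (1 - u) ^ n * u ^ ((p : ℝ) + a.re) * (C₁ * ‖bc γ (p + 1)‖) := by gcongr
        _ = C₁ * ‖bc γ (p + 1)‖ * ((1 - u) ^ n * u ^ ((p : ℝ) + 1 + a.re - 1)) := by
          rw [e0]; ring
        _ ≤ _ := by linarith
    · have hψn : 1 / 2 ≤ ‖ψ‖ := by
        rw [hx] at h
        nlinarith [norm_nonneg ψ, hu.2]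
      have huu : u₁ ≤ u := by
        rw [hu₁, div_le_iff₀ (by positivity)]
        rw [hx] at h
        nlinarith
      have hxM : ‖ψ * (u : ℂ)‖ ≤ M := by
        rw [hx]; nlinarith [norm_nonneg ψ, hu.2]
      have hlow := norm_mul_abs_sub_le hψ u
      rw [← hc] at hlow
      have hpos : 0 < |u - c| := abs_pos.mpr (sub_ne_zero.mpr huc)
      have hlow' : 1 / 2 * |u - c| ≤ ‖1 + ψ * (u : ℂ)‖ := le_trans (by gcongr) hlow
      have hne0 : 1 + ψ * (u : ℂ) ≠ 0 := norm_pos_iff.mp (lt_of_lt_of_le (by positivity) hlow')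
      have h1 := hr₂ γ ψ u hγ hγG h.le hxM hne0
      have h2 : ‖1 + ψ * (u : ℂ)‖ ^ (-1 + δ) ≤ B * |u - c| ^ (-1 + δ) := by
        rw [hB, ← Real.mul_rpow (by norm_num) hpos.le]
        exact Real.rpow_le_rpow_of_nonpos (by positivity) hlow' (by linarith)
      have h3 : (1 - u) ^ n * u ^ ((p : ℝ) + a.re) ≤ q := by
        have e1 : (1 - u) ^ n ≤ q := by
          have : 0 ≤ 1 - u := by linarith [hu.2]
          rw [hq]; gcongr
        have e2 : u ^ ((p : ℝ) + a.re) ≤ 1 := Real.rpow_le_one hu0.le hu.2 (by positivity)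
        calc _ ≤ q * 1 := by gcongr
          _ = q := mul_one q
      have h4 : 0 ≤ C₁ * ‖bc γ (p + 1)‖ * ((1 - u) ^ n * u ^ ((p : ℝ) + 1 + a.re - 1)) := by
        positivity
      calc _ ≤ q * (C₂ * ‖bc γ (p + 1)‖ * (B * |u - c| ^ (-1 + δ))) := by
            refine mul_le_mul h3 (h1.trans ?_) (norm_nonneg _) hq0
            gcongr
        _ = C₂ * ‖bc γ (p + 1)‖ * q * B * |u - c| ^ (-1 + δ) := by ring
        _ ≤ _ := by linarith
  refine hle.trans ?_
  rw [intervalIntegral.integral_add hi1 hi2, intervalIntegral.integral_const_mul,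
    intervalIntegral.integral_const_mul]
  have hqle : q ≤ D * rbeta n (p + 1 + a.re) := by
    have h1 := le_rbeta n hX hu₁0 (by linarith)
    have hXA : (p : ℝ) + 1 + a.re ≤ p + 1 + |A| := by linarith [le_abs_self A]
    have h2 : D⁻¹ ≤ u₁ ^ ((p : ℝ) + 1 + a.re) / (p + 1 + a.re) := by
      rw [hD, inv_div]
      have : u₁ ^ ((p : ℝ) + 1 + |A|) ≤ u₁ ^ ((p : ℝ) + 1 + a.re) :=
        Real.rpow_le_rpow_of_exponent_ge hu₁0 (by linarith) hXA
      gcongr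
    have hDp : 0 < D := by positivity
    have h3 : q * D⁻¹ ≤ rbeta n (p + 1 + a.re) := le_trans (by gcongr) h1
    calc q = D * (q * D⁻¹) := by field_simp
      _ ≤ _ := by gcongr
  have hHc' := hHc c
  calc _ ≤ C₁ * ‖bc γ (p + 1)‖ * rbeta n (p + 1 + a.re) +
        C₂ * ‖bc γ (p + 1)‖ * (D * rbeta n (p + 1 + a.re)) * B * H := by
        have hI0 : 0 ≤ ∫ u in (0 : ℝ)..1, |u - c| ^ (-1 + δ) :=
          intervalIntegral.integral_nonneg zero_le_one fun u _ => by positivity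
        refine add_le_add le_rfl ?_
        have : 0 ≤ D * rbeta n (p + 1 + a.re) := hq0.trans hqle
        gcongr
    _ = _ := by ring

/-- Comparison of the normalized remainder with the first omitted term. -/
theorem norm_xi_le_of_norm_J_le (n p : ℕ) {a γ ψ : ℂ} {C C' : ℝ} (ha : 0 < a.re) (hγ : -1 < γ.re)
    (hC : 0 ≤ C) (hJ : ‖J n p a γ ψ‖ ≤ C * ‖bc γ (p + 1)‖ * rbeta n (p + 1 + a.re))
    (hC' : Real.Gamma (p + 1 + a.re) ≤ C' * ‖Complex.Gamma (p + 1 + a)‖) :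
    ‖1 / beta (n + 1) a * ψ ^ (p + 1) * J n p a γ ψ‖ ≤ C * C' *
      ‖gbinom γ (p + 1 : ℕ) * ψ ^ (p + 1) * (Complex.Gamma (a + (p + 1 : ℕ)) / Complex.Gamma a) *
        (1 / poch ((n : ℂ) + 1 + a) (p + 1))‖ := by
  have hna : 0 < ((n : ℂ) + 1 + a).re := by simp; positivity
  have hG1 := norm_pos_iff.mpr (Complex.Gamma_ne_zero_of_re_pos ha)
  have hG3 := norm_pos_iff.mpr (Complex.Gamma_ne_zero_of_re_pos hna)
  have hX : 0 < (p : ℝ) + 1 + a.re := by positivity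
  have hnp : 0 < ((n : ℂ) + 1 + a + (p + 1 : ℕ)).re := by simp; positivity
  have hG4 := norm_pos_iff.mpr (Complex.Gamma_ne_zero_of_re_pos hnp)
  have hG5 := norm_Gamma_le hnp
  have hG6 := Real.Gamma_pos_of_pos hnp
  have hf : (0 : ℝ) < n.factorial := by positivity
  have hre : ((n : ℂ) + 1 + a + (p + 1 : ℕ)).re = n + 1 + (p + 1 + a.re) := by simp; ring
  rw [rbeta_eq n hX, ← hre] at hJ
  rw [gbinom_eq_bc hγ, poch, ← Complex.Gamma_add_nat_div_Gamma_eq _ (ne_neg_natCast_of_re_pos hna),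
    beta, Complex.Gamma_nat_eq_factorial, show a + ((p + 1 : ℕ) : ℂ) = p + 1 + a by push_cast; ring]
  simp only [norm_mul, norm_div, norm_one, norm_pow, Complex.norm_natCast]
  set g1 := ‖Complex.Gamma a‖
  set g2 := ‖Complex.Gamma (n + 1 + a)‖
  set g3 := ‖Complex.Gamma (n + 1 + a + (p + 1 : ℕ))‖
  set g4 := Real.Gamma ((n : ℂ) + 1 + a + (p + 1 : ℕ)).re
  set g5 := ‖Complex.Gamma (p + 1 + a)‖
  set g6 := Real.Gamma (p + 1 + a.re)
  have hg6 : 0 < g6 := Real.Gamma_pos_of_pos hX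
  have hC'g : 0 ≤ C' * g5 := hg6.le.trans hC'
  -- The Gamma value that still depends on `n` is compared through `|Γ(x)| ≤ Γ(Re x)`, in the
  -- favourable direction. Only `Γ(p+1+Re a) / |Γ(p+1+a)|`, free of `n`, costs a constant.
  calc 1 / (n.factorial * g1 / g2) * ‖ψ‖ ^ (p + 1) * ‖J n p a γ ψ‖
      ≤ 1 / (n.factorial * g1 / g2) * ‖ψ‖ ^ (p + 1) *
        (C * ‖bc γ (p + 1)‖ * (n.factorial * g6 / g4)) := by gcongr
    _ = C * ‖bc γ (p + 1)‖ * ‖ψ‖ ^ (p + 1) * (g2 / g1) * (g6 / g4) := by field_simp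
    _ ≤ C * ‖bc γ (p + 1)‖ * ‖ψ‖ ^ (p + 1) * (g2 / g1) * (C' * g5 / g3) := by gcongr
    _ = _ := by field_simp

/-- The uniform bound of the remainder by the first omitted term, in terms of compact sets of
parameters. -/
theorem exists_norm_xi_le (p : ℕ) {Ka Kγ Kψ : Set ℂ} (hKa : IsCompact Ka) (hKγ : IsCompact Kγ)
    (hKψ : IsCompact Kψ) (ha : ∀ a ∈ Ka, 0 < a.re) (hγ : ∀ γ ∈ Kγ, -1 < γ.re) :
    ∃ C : ℝ, ∀ (n : ℕ), ∀ a ∈ Ka, ∀ γ ∈ Kγ, ∀ ψ ∈ Kψ,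
      ‖1 / beta (n + 1) a * ψ ^ (p + 1) * J n p a γ ψ‖ ≤ C *
      ‖gbinom γ (p + 1 : ℕ) * ψ ^ (p + 1) * (Complex.Gamma (a + (p + 1 : ℕ)) / Complex.Gamma a) *
        (1 / poch ((n : ℂ) + 1 + a) (p + 1))‖ := by
  rcases Kγ.eq_empty_or_nonempty with rfl | hne
  · exact ⟨0, by simp⟩
  obtain ⟨A, hA⟩ := hKa.exists_bound_of_continuousOn (f := id) continuousOn_id
  obtain ⟨G, hG⟩ := hKγ.exists_bound_of_continuousOn (f := id) continuousOn_id
  obtain ⟨M, hM⟩ := hKψ.exists_bound_of_continuousOn (f := id) continuousOn_id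
  obtain ⟨γ₀, hγ₀, hmin⟩ := hKγ.exists_isMinOn hne Complex.continuous_re.continuousOn
  have h0 := hγ γ₀ hγ₀
  have hpos : ∀ a ∈ Ka, 0 < ((p : ℂ) + 1 + a).re := fun a h => by
    have := ha a h
    simp; positivity
  have hcont : ContinuousOn (fun a : ℂ => Real.Gamma (p + 1 + a.re) *
      (‖Complex.Gamma (p + 1 + a)‖)⁻¹) Ka := by
    refine ContinuousOn.mul (fun a h => ?_) (fun a h => ?_)
    · have hp := hpos a h
      have h1 : ContinuousAt Real.Gamma (p + 1 + a.re) :=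
        (Real.differentiableAt_Gamma fun m => by
          have : (0 : ℝ) ≤ m := m.cast_nonneg
          simp at hp
          linarith).continuousAt
      exact (ContinuousAt.comp (f := fun a : ℂ => (p : ℝ) + 1 + a.re) h1
        (by fun_prop)).continuousWithinAt
    · have hp := hpos a h
      have h1 : ContinuousAt Complex.Gamma (p + 1 + a) :=
        (Complex.differentiableAt_Gamma _ (ne_neg_natCast_of_re_pos hp)).continuousAt
      have h2 : ContinuousAt (fun a : ℂ => Complex.Gamma (p + 1 + a)) a :=
        ContinuousAt.comp (f := fun a : ℂ => (p : ℂ) + 1 + a) h1 (by fun_prop)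
      exact (h2.norm.inv₀ (norm_ne_zero_iff.mpr
        (Complex.Gamma_ne_zero_of_re_pos hp))).continuousWithinAt
  obtain ⟨C', hC'⟩ := hKa.exists_bound_of_continuousOn hcont
  -- This makes `-1 + 2δ ≤ Re γ₀`, the minimum of `Re γ` on the compact set, while `δ < 1/2`.
  set δ := min (1 / 4) ((γ₀.re + 1) / 2) with hδ
  have hδ0 : 0 < δ := lt_min (by norm_num) (by linarith)
  have hδ1 : δ < 1 / 2 := lt_of_le_of_lt (min_le_left _ _) (by norm_num)
  obtain ⟨C, hC, hJ⟩ := exists_norm_J_le p (G := G) (A := A) hδ0 hδ1 (le_max_left 1 M)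
  refine ⟨C * C', fun n a haK γ hγK ψ hψK => ?_⟩
  refine norm_xi_le_of_norm_J_le n p (ha a haK) (hγ γ hγK) hC (hJ n a γ ψ (ha a haK) ?_ ?_
    (hG γ hγK) ((hM ψ hψK).trans (le_max_right _ _))) ?_
  · exact (le_abs_self _).trans ((Complex.abs_re_le_norm a).trans (hA a haK))
  · have h1 : γ₀.re ≤ γ.re := hmin hγK
    have h2 : δ ≤ (γ₀.re + 1) / 2 := min_le_right _ _
    linarith
  · have h1 := (le_abs_self _).trans (hC' a haK)
    have h2 := norm_pos_iff.mpr (Complex.Gamma_ne_zero_of_re_pos (hpos a haK))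
    rwa [← div_eq_mul_inv, div_le_iff₀ h2] at h1

theorem exists_norm_xi1_le {S : Set ℂ} {L : Set (ℂ × ℂ)} (hS : IsCompact S) (hS1 : S ⊆ {1}ᶜ)
    (hL : IsCompact L) (hLΩ : L ⊆ Omega0) (p : ℕ) :
    ∃ C : ℝ, ∀ n : ℕ, ∀ z ∈ S, ∀ α β : ℂ, (α, β) ∈ L →
      ‖xi1 n p z α β‖ ≤ C * ‖term1 (p + 1) n z α β‖ := by
  have hψ : ContinuousOn (fun z : ℂ => z / (1 - z)) S := fun z hz => by
    have : 1 - z ≠ 0 := sub_ne_zero.mpr fun h => hS1 hz h.symm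
    exact ContinuousAt.continuousWithinAt (by fun_prop (disch := assumption))
  obtain ⟨C, hC⟩ := exists_norm_xi_le p (hL.image (f := fun q => q.1 - q.2) (by fun_prop))
    (hL.image (f := fun q => q.1 + q.2) (by fun_prop)) (hS.image_of_continuousOn hψ)
    (by rintro _ ⟨q, hq, rfl⟩; exact (hLΩ hq).2) (by rintro _ ⟨q, hq, rfl⟩; exact (hLΩ hq).1)
  refine ⟨C, fun n z hz α β hq => ?_⟩
  have := hC n (α - β) ⟨_, hq, rfl⟩ (α + β) ⟨_, hq, rfl⟩ (z / (1 - z)) ⟨z, hz, rfl⟩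
  rwa [← xi1_eq, show α - β + ((p + 1 : ℕ) : ℂ) = ((p + 1 : ℕ) : ℂ) + α - β by ring,
    ← add_sub_assoc] at this

theorem exists_norm_xi2_le {S : Set ℂ} {L : Set (ℂ × ℂ)} (hS : IsCompact S) (hS1 : S ⊆ {1}ᶜ)
    (hL : IsCompact L) (hLΩ : L ⊆ Omega0) (p : ℕ) :
    ∃ C : ℝ, ∀ n : ℕ, ∀ z ∈ S, ∀ α β : ℂ, (α, β) ∈ L →
      ‖xi2 n p z α β‖ ≤ C * ‖term2 (p + 1) n z α β‖ := by
  have hψ : ContinuousOn (fun z : ℂ => 1 / (z - 1)) S := fun z hz => by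
    have : z - 1 ≠ 0 := sub_ne_zero.mpr fun h => hS1 hz h
    exact ContinuousAt.continuousWithinAt (by fun_prop (disch := assumption))
  obtain ⟨C, hC⟩ := exists_norm_xi_le p (hL.image (f := fun q => q.1 + q.2 + 1) (by fun_prop))
    (hL.image (f := fun q => q.1 - q.2 - 1) (by fun_prop)) (hS.image_of_continuousOn hψ)
    (by
      rintro _ ⟨q, hq, rfl⟩
      have := (hLΩ hq).1
      rw [Complex.add_re _ 1, Complex.one_re]; linarith)
    (by
      rintro _ ⟨q, hq, rfl⟩
      have := (hLΩ hq).2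
      rw [Complex.sub_re _ 1, Complex.one_re]; linarith)
  refine ⟨C, fun n z hz α β hq => ?_⟩
  have := hC n (α + β + 1) ⟨_, hq, rfl⟩ (α - β - 1) ⟨_, hq, rfl⟩ (1 / (z - 1)) ⟨z, hz, rfl⟩
  rwa [← xi2_eq, show α + β + 1 + ((p + 1 : ℕ) : ℂ) = ((p + 1 : ℕ) : ℂ) + α + β + 1 by ring,
    show (n : ℂ) + 1 + (α + β + 1) = n + 2 + α + β by ring, one_div_pow] at this

end BiorthAsymp

end

/-! ### Explicit bounds: reduction to `J`, and exponents with nonnegative real part -/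

noncomputable section

namespace BiorthAsymp

open MeasureTheory Set Filter Topology

theorem poch_eq_Gamma_div {x : ℝ} (hx : 0 < x) (k : ℕ) :
    poch x k = Real.Gamma (x + k) / Real.Gamma x := by
  have hG := (Real.Gamma_pos_of_pos hx).ne'
  rw [eq_div_iff hG, poch]
  induction k with
  | zero => simp
  | succ k ih =>
    have hxk : x + k ≠ 0 := by positivity
    rw [ascPochhammer_succ_eval, mul_right_comm, ih]
    push_cast
    rw [← add_assoc, Real.Gamma_add_one hxk, mul_comm]

/-- The explicit bound for the normalized remainder, as the product of the norm of a prefactor and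
a bound for `J`. -/
theorem explicit_bound_eq (n p : ℕ) {a : ℂ} (ψ : ℂ) (ha : 0 < a.re) (c : ℝ) :
    1 / poch ((n : ℝ) + 1 + a.re) (p + 1) * (Real.Gamma (p + 1 + a.re) / ‖Complex.Gamma a‖) *
      ‖ψ‖ ^ (p + 1) * c = Real.Gamma (n + 1 + a.re) / (n.factorial * ‖Complex.Gamma a‖) *
      ‖ψ‖ ^ (p + 1) * (c * rbeta n (p + 1 + a.re)) := by
  have h1 : 0 < (n : ℝ) + 1 + a.re := by positivity
  have h2 : 0 < (p : ℝ) + 1 + a.re := by positivity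
  have hG1 := norm_pos_iff.mpr (Complex.Gamma_ne_zero_of_re_pos ha)
  have hG2 := Real.Gamma_pos_of_pos h1
  have hG3 := Real.Gamma_pos_of_pos h2
  have hG4 := Real.Gamma_pos_of_pos (show 0 < (n : ℝ) + 1 + (p + 1 + a.re) by positivity)
  have hf : (0 : ℝ) < n.factorial := by positivity
  rw [poch_eq_Gamma_div h1, rbeta_eq n h2,
    show (n : ℝ) + 1 + a.re + ((p + 1 : ℕ) : ℝ) = n + 1 + (p + 1 + a.re) by push_cast; ring]
  field_simp

theorem norm_inv_beta_le (n : ℕ) {a : ℂ} (ha : 0 < a.re) :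
    ‖1 / beta (n + 1) a‖ ≤ Real.Gamma (n + 1 + a.re) / (n.factorial * ‖Complex.Gamma a‖) := by
  have hna : 0 < ((n : ℂ) + 1 + a).re := by simp; positivity
  have hG := norm_Gamma_le hna
  rw [beta, Complex.Gamma_nat_eq_factorial, one_div_div, norm_div, norm_mul, Complex.norm_natCast]
  have e : ((n : ℂ) + 1 + a).re = n + 1 + a.re := by simp
  rw [e] at hG
  gcongr

theorem explicit_bound (n p : ℕ) {a γ ψ : ℂ} (ha : 0 < a.re) {c : ℝ}
    (hJ : ‖J n p a γ ψ‖ ≤ c * rbeta n (p + 1 + a.re)) :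
    ‖1 / beta (n + 1) a * ψ ^ (p + 1) * J n p a γ ψ‖ ≤
      1 / poch ((n : ℝ) + 1 + a.re) (p + 1) * (Real.Gamma (p + 1 + a.re) / ‖Complex.Gamma a‖) *
      ‖ψ‖ ^ (p + 1) * c := by
  rw [explicit_bound_eq n p ψ ha, norm_mul, norm_mul, norm_pow]
  have := norm_inv_beta_le n ha
  gcongr

theorem explicit_bound_lt (n p : ℕ) {a γ ψ : ℂ} (ha : 0 < a.re) (hψ : ψ ≠ 0) {c : ℝ}
    (hJ : ‖J n p a γ ψ‖ < c * rbeta n (p + 1 + a.re)) :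
    ‖1 / beta (n + 1) a * ψ ^ (p + 1) * J n p a γ ψ‖ <
      1 / poch ((n : ℝ) + 1 + a.re) (p + 1) * (Real.Gamma (p + 1 + a.re) / ‖Complex.Gamma a‖) *
      ‖ψ‖ ^ (p + 1) * c := by
  rw [explicit_bound_eq n p ψ ha, norm_mul, norm_mul, norm_pow]
  have h1 := norm_inv_beta_le n ha
  have h2 := norm_pos_iff.mpr hψ
  have h3 : 0 < Real.Gamma (n + 1 + a.re) / (n.factorial * ‖Complex.Gamma a‖) := by
    have := Real.Gamma_pos_of_pos (show 0 < (n : ℝ) + 1 + a.re by positivity)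
    have := norm_pos_iff.mpr (Complex.Gamma_ne_zero_of_re_pos ha)
    positivity
  calc _ ≤ Real.Gamma (n + 1 + a.re) / (n.factorial * ‖Complex.Gamma a‖) * ‖ψ‖ ^ (p + 1) *
        ‖J n p a γ ψ‖ := by gcongr
    _ < _ := by gcongr

/-! ### Bounds for the binomial coefficients -/

theorem bc_factor (γ : ℂ) (j : ℕ) : (γ - j) / (j + 1) = -(1 - (γ + 1) / (j + 1)) := by
  have h1 : ((j : ℂ) + 1) ≠ 0 := by exact_mod_cast j.succ_ne_zero
  field_simp; ring

theorem normSq_one_sub_div (w : ℂ) (j : ℕ) :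
    ‖1 - w / (j + 1)‖ ^ 2 = 1 - 2 * w.re * (1 / (j + 1)) + ‖w‖ ^ 2 * (1 / (j + 1) ^ 2) := by
  have h1 : ((j : ℝ) + 1) ≠ 0 := by positivity
  have e : w / ((j : ℂ) + 1) = ((1 / (j + 1) : ℝ) : ℂ) * w := by push_cast; ring
  rw [← Complex.normSq_eq_norm_sq, ← Complex.normSq_eq_norm_sq, e, Complex.normSq_apply,
    Complex.normSq_apply]
  simp only [Complex.sub_re, Complex.one_re, Complex.sub_im, Complex.one_im, Complex.re_ofReal_mul,
    Complex.im_ofReal_mul]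
  field_simp; ring

theorem sum_inv_sq_le (k : ℕ) : ∑ j ∈ Finset.range k, 1 / ((j : ℝ) + 1) ^ 2 ≤ 2 := by
  have h : ∀ m : ℕ, ∑ j ∈ Finset.range (m + 1), 1 / ((j : ℝ) + 1) ^ 2 ≤
      2 - 1 / ((m : ℝ) + 1) := by
    intro m
    induction m with
    | zero => norm_num
    | succ m ih =>
      rw [Finset.sum_range_succ]
      have : 1 / (((m + 1 : ℕ) : ℝ) + 1) ^ 2 ≤ 1 / ((m : ℝ) + 1) - 1 / (((m + 1 : ℕ) : ℝ) + 1) := by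
        push_cast
        rw [div_sub_div _ _ (by positivity) (by positivity),
          div_le_div_iff₀ (by positivity) (by positivity)]
        nlinarith [(m.cast_nonneg : (0 : ℝ) ≤ m)]
      push_cast at this ⊢
      linarith
  cases k with
  | zero => simp
  | succ m =>
    have := h m
    have : 0 < 1 / ((m : ℝ) + 1) := by positivity
    linarith

/-- With `w = γ + 1` the factors are `-(1 - w/(j+1))`, and `1 + t ≤ e^t` bounds the squared product
by `exp(-2 Re w ∑ 1/(j+1) + ‖w‖² ∑ 1/(j+1)²)`. The first sum is at least `1`, the second at most
`2`, and `‖w‖² - Re w = ‖γ‖² + Re γ`. -/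
theorem norm_bc_succ_le {γ : ℂ} (hγ : -1 ≤ γ.re) (k : ℕ) :
    ‖bc γ (k + 1)‖ ≤ Real.exp (‖γ‖ ^ 2 + γ.re) := by
  set w := γ + 1 with hw
  have hwr : w.re = γ.re + 1 := by simp [hw]
  have hwn : ‖w‖ ^ 2 = ‖γ‖ ^ 2 + 2 * γ.re + 1 := by
    rw [← Complex.normSq_eq_norm_sq, ← Complex.normSq_eq_norm_sq, Complex.normSq_apply,
      Complex.normSq_apply]
    simp [hw]; ring
  have h1 : ‖bc γ (k + 1)‖ ^ 2 ≤ Real.exp (∑ j ∈ Finset.range (k + 1),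
      (-(2 * w.re) * (1 / ((j : ℝ) + 1)) + ‖w‖ ^ 2 * (1 / ((j : ℝ) + 1) ^ 2))) := by
    rw [bc, norm_prod, ← Finset.prod_pow, Real.exp_sum]
    refine Finset.prod_le_prod (fun _ _ => by positivity) fun j _ => ?_
    rw [bc_factor, norm_neg, normSq_one_sub_div]
    refine le_trans (le_of_eq ?_) (Real.add_one_le_exp _)
    ring
  rw [Finset.sum_add_distrib, ← Finset.mul_sum, ← Finset.mul_sum] at h1
  have h2 : 1 ≤ ∑ j ∈ Finset.range (k + 1), 1 / ((j : ℝ) + 1) := by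
    rw [Finset.sum_range_succ']
    have : 0 ≤ ∑ j ∈ Finset.range k, 1 / (((j + 1 : ℕ) : ℝ) + 1) :=
      Finset.sum_nonneg fun _ _ => by positivity
    simp only [Nat.cast_zero, zero_add, div_one]
    linarith
  have h3 := sum_inv_sq_le (k + 1)
  have h4 : ‖bc γ (k + 1)‖ ^ 2 ≤ Real.exp (‖γ‖ ^ 2 + γ.re) ^ 2 := by
    refine h1.trans ?_
    rw [← Real.exp_nat_mul]
    refine Real.exp_le_exp.mpr ?_
    have h5 : 0 ≤ w.re := by linarith
    have h6 : 0 ≤ ‖w‖ ^ 2 := by positivity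
    push_cast
    nlinarith
  exact le_of_sq_le_sq h4 (by positivity)

/-! ### The normalized remainder as a function of `x = ψ u` -/

/-- The normalized remainder `r`, as a function of `x = ψ u`. -/
def rr (p : ℕ) (γ x : ℂ) : ℂ :=
  (powLower (1 + x) γ - ∑ k ∈ Finset.range (p + 1), bc γ k * x ^ k) / x ^ (p + 1)

theorem r_eq_rr (p : ℕ) {γ : ℂ} (hγ : -1 < γ.re) (u ψ : ℂ) : r p u ψ γ = rr p γ (ψ * u) := by
  rw [r, rr]
  simp only [gbinom_eq_bc hγ]

theorem rr_eq_add (p : ℕ) (γ : ℂ) {x : ℂ} (hx : x ≠ 0) :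
    rr p γ x = bc γ (p + 1) + x * rr (p + 1) γ x := by
  rw [rr, rr, Finset.sum_range_succ _ (p + 1)]
  field_simp
  ring

/-- The triangle inequality. A radius `ρ ≤ 1` is allowed so that the bound can also be used on
circles inside the unit disc. -/
theorem norm_rr_le_of_one_le (p : ℕ) {γ : ℂ} (hγ : -1 ≤ γ.re) {x : ℂ} {ρ : ℝ} (hρ : 0 < ρ)
    (hρ1 : ρ ≤ 1) (hx : ρ ≤ ‖x‖) {m : ℝ} (hm : ‖powLower (1 + x) γ‖ ≤ m) :
    ‖rr p γ x‖ ≤ (m + p * Real.exp (‖γ‖ ^ 2 + γ.re) + 1) / ρ ^ (p + 1) := by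
  have hx0 : 0 < ‖x‖ := hρ.trans_le hx
  set E := Real.exp (‖γ‖ ^ 2 + γ.re)
  rw [rr, norm_div, norm_pow, sub_eq_add_neg]
  have hsum : ‖∑ k ∈ Finset.range (p + 1), bc γ k * x ^ k‖ / ‖x‖ ^ (p + 1) ≤
      (p * E + 1) / ρ ^ (p + 1) := by
    have hone : ∀ k ∈ Finset.range (p + 1), ‖x‖ ^ k / ‖x‖ ^ (p + 1) ≤ 1 / ρ ^ (p + 1) := by
      intro k hk
      have hk : k < p + 1 := Finset.mem_range.mp hk
      rw [div_le_div_iff₀ (by positivity) (by positivity), one_mul]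
      have : ‖x‖ ^ (p + 1) = ‖x‖ ^ k * ‖x‖ ^ (p + 1 - k) := by
        rw [← pow_add]; congr 1; omega
      rw [this]
      refine mul_le_mul_of_nonneg_left ?_ (by positivity)
      calc ρ ^ (p + 1) ≤ ρ ^ (p + 1 - k) := pow_le_pow_of_le_one hρ.le hρ1 (by omega)
        _ ≤ _ := by gcongr
    calc _ ≤ (∑ k ∈ Finset.range (p + 1), ‖bc γ k‖ * ‖x‖ ^ k) / ‖x‖ ^ (p + 1) := by
          gcongr
          refine (norm_sum_le _ _).trans (le_of_eq ?_)
          exact Finset.sum_congr rfl fun k _ => by rw [norm_mul, norm_pow]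
      _ = ∑ k ∈ Finset.range (p + 1), ‖bc γ k‖ * (‖x‖ ^ k / ‖x‖ ^ (p + 1)) := by
          rw [Finset.sum_div]
          exact Finset.sum_congr rfl fun k _ => by ring
      _ ≤ ∑ k ∈ Finset.range (p + 1), ‖bc γ k‖ * (1 / ρ ^ (p + 1)) := by
          refine Finset.sum_le_sum fun k hk => ?_
          have := hone k hk
          gcongr
      _ = (∑ k ∈ Finset.range (p + 1), ‖bc γ k‖) * (1 / ρ ^ (p + 1)) := by rw [Finset.sum_mul]
      _ ≤ (p * E + 1) * (1 / ρ ^ (p + 1)) := by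
          refine mul_le_mul_of_nonneg_right ?_ (by positivity)
          rw [Finset.sum_range_succ', bc_zero, norm_one]
          refine add_le_add ?_ le_rfl
          calc _ ≤ ∑ k ∈ Finset.range p, E := Finset.sum_le_sum fun k _ => norm_bc_succ_le hγ k
            _ = p * E := by simp
      _ = _ := by ring
  have hm0 : 0 ≤ m := (norm_nonneg _).trans hm
  calc _ ≤ (‖powLower (1 + x) γ‖ + ‖∑ k ∈ Finset.range (p + 1), bc γ k * x ^ k‖) /
        ‖x‖ ^ (p + 1) := by
        gcongr
        exact (norm_add_le _ _).trans (by rw [norm_neg])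
    _ = ‖powLower (1 + x) γ‖ / ‖x‖ ^ (p + 1) +
        ‖∑ k ∈ Finset.range (p + 1), bc γ k * x ^ k‖ / ‖x‖ ^ (p + 1) := by rw [add_div]
    _ ≤ m / ρ ^ (p + 1) + (p * E + 1) / ρ ^ (p + 1) := by gcongr
    _ = _ := by ring

theorem one_add_mem_slitPlane_of_norm_lt {x : ℂ} (hx : ‖x‖ < 1) : 1 + x ∈ Complex.slitPlane := by
  left
  have := (abs_le.mp (Complex.abs_re_le_norm x)).1
  rw [Complex.add_re, Complex.one_re]; linarith

theorem norm_rr_le_of_norm_le_half (p : ℕ) {γ : ℂ} (hγ : -1 < γ.re) :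
    ∃ C : ℝ, ∀ x : ℂ, ‖x‖ ≤ 1 / 2 → ‖rr p γ x‖ ≤ C := by
  refine ⟨(p + 1).factorial * 4 ^ (p + 1) * (Real.exp (Real.pi * ‖γ‖) * 2 ^ ‖γ‖) *
      ‖bc γ (p + 1)‖, fun x hx => ?_⟩
  have := norm_r_le_of_norm_le_half p hγ le_rfl (ψ := x) (u := 1) (by simpa using hx)
  rw [r_eq_rr p hγ, mul_one] at this
  exact this

/-- Maximum principle: after removal of the singularity at `0` the remainder is analytic in the unit
disc, and on `‖x‖ = ρ` the triangle inequality gives `c / ρ^(p+1)`. Then `ρ → 1`. -/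
theorem norm_rr_le_of_norm_lt_one (p : ℕ) {γ : ℂ} (hγ : -1 < γ.re) {m : ℝ}
    (hm : ∀ x : ℂ, ‖x‖ < 1 → ‖powLower (1 + x) γ‖ ≤ m) {x : ℂ} (hx0 : x ≠ 0) (hx : ‖x‖ < 1) :
    ‖rr p γ x‖ ≤ m + p * Real.exp (‖γ‖ ^ 2 + γ.re) + 1 := by
  set c := m + p * Real.exp (‖γ‖ ^ 2 + γ.re) + 1
  obtain ⟨C, hC⟩ := norm_rr_le_of_norm_le_half p hγ
  set F := Function.update (rr p γ) 0 (limUnder (𝓝[≠] 0) (rr p γ)) with hF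
  have hF' : ∀ y : ℂ, y ≠ 0 → F y = rr p γ y := fun y hy => Function.update_of_ne hy _ _
  have hdiff : DifferentiableOn ℂ F (Metric.ball 0 1) := by
    have hd : DifferentiableOn ℂ (rr p γ) (Metric.ball 0 1 \ {0}) := by
      intro y hy
      have hy1 : ‖y‖ < 1 := by simpa using hy.1
      have hy0 : y ≠ 0 := hy.2
      refine DifferentiableAt.differentiableWithinAt ?_
      refine DifferentiableAt.div (DifferentiableAt.sub ?_ (by fun_prop)) (by fun_prop)
        (pow_ne_zero _ hy0)
      exact (differentiableAt_powLower (one_add_mem_slitPlane_of_norm_lt hy1) γ).comp y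
        (f := fun y => 1 + y) (by fun_prop)
    have hd2 : DifferentiableOn ℂ F (Metric.ball 0 (1 / 2)) := by
      refine Complex.differentiableOn_update_limUnder_of_bddAbove
        (Metric.ball_mem_nhds _ (by norm_num))
        (hd.mono (sdiff_subset_sdiff_left (Metric.ball_subset_ball (by norm_num)))) ?_
      refine ⟨C, ?_⟩
      rintro _ ⟨y, hy, rfl⟩
      have : ‖y‖ < 1 / 2 := by simpa using hy.1
      exact hC y this.le
    intro y hy
    by_cases hy0 : y = 0
    · subst hy0
      exact (hd2.differentiableAt (Metric.ball_mem_nhds _ (by norm_num))).differentiableWithinAt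
    · have : DifferentiableAt ℂ (rr p γ) y :=
        (hd.differentiableAt ((Metric.isOpen_ball.sdiff isClosed_singleton).mem_nhds ⟨hy, hy0⟩))
      refine (this.congr_of_eventuallyEq ?_).differentiableWithinAt
      filter_upwards [isOpen_ne.mem_nhds hy0] with v hv
      exact hF' v hv
  have hρ : ∀ ρ : ℝ, ‖x‖ < ρ → ρ < 1 → ‖rr p γ x‖ ≤ c / ρ ^ (p + 1) := by
    intro ρ h1 h2
    have hρ0 : 0 < ρ := (norm_nonneg x).trans_lt h1
    have hcl : DiffContOnCl ℂ F (Metric.ball 0 ρ) := by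
      refine DifferentiableOn.diffContOnCl (hdiff.mono ?_)
      rw [closure_ball _ hρ0.ne']
      exact Metric.closedBall_subset_ball h2
    rw [← hF' x hx0]
    refine Complex.norm_le_of_forall_mem_frontier_norm_le Metric.isBounded_ball hcl
      (fun y hy => ?_) (subset_closure (by simpa using h1))
    rw [frontier_ball _ hρ0.ne'] at hy
    have hy' : ‖y‖ = ρ := by simpa using hy
    have hy0 : y ≠ 0 := norm_pos_iff.mp (by rw [hy']; exact hρ0)
    rw [hF' y hy0]
    exact norm_rr_le_of_one_le p hγ.le hρ0 h2.le hy'.ge (hm y (by rw [hy']; exact h2))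
  have hlim : Tendsto (fun ρ : ℝ => c / ρ ^ (p + 1)) (𝓝[<] 1) (𝓝 (c / 1 ^ (p + 1))) := by
    have : ContinuousAt (fun ρ : ℝ => c / ρ ^ (p + 1)) 1 := by
      fun_prop (disch := norm_num)
    exact this.tendsto.mono_left nhdsWithin_le_nhds
  rw [one_pow, div_one] at hlim
  refine ge_of_tendsto hlim ?_
  filter_upwards [Ioo_mem_nhdsLT hx] with ρ hρ'
  exact hρ ρ hρ'.1 hρ'.2

theorem norm_r_le_m1 (p : ℕ) {γ : ℂ} (hγ : 0 ≤ γ.re) {ψ : ℂ} (hψ : ψ ≠ 0) {u : ℝ}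
    (hu : u ∈ Ioc (0 : ℝ) 1) :
    ‖r p u ψ γ‖ ≤ m1 ψ γ + p * Real.exp (‖γ‖ ^ 2 + γ.re) + 1 := by
  rw [r_eq_rr p (by linarith)]
  have hx0 : ψ * (u : ℂ) ≠ 0 := mul_ne_zero hψ (by exact_mod_cast hu.1.ne')
  have hle : ‖ψ * (u : ℂ)‖ ≤ ‖ψ‖ := by
    rw [norm_mul, Complex.norm_real, Real.norm_of_nonneg hu.1.le]
    exact mul_le_of_le_one_right (norm_nonneg _) hu.2
  rcases lt_or_ge ‖ψ * (u : ℂ)‖ 1 with h | h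
  · refine norm_rr_le_of_norm_lt_one p (by linarith) (fun x hx => ?_) hx0 h
    refine (norm_powLower_le _ _).trans ?_
    rw [m1]
    refine mul_le_mul_of_nonneg_left ?_ (Real.exp_pos _).le
    refine le_trans ?_ (le_max_left _ _)
    refine Real.rpow_le_rpow (norm_nonneg _) ?_ hγ
    refine (norm_add_le _ _).trans ?_
    rw [norm_one]; linarith
  · have := norm_rr_le_of_one_le p (γ := γ) (by linarith) one_pos le_rfl h (m := m1 ψ γ) (by
      refine (norm_powLower_le _ _).trans ?_
      rw [m1]
      refine mul_le_mul_of_nonneg_left ?_ (Real.exp_pos _).le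
      refine le_trans ?_ (le_max_right _ _)
      refine Real.rpow_le_rpow (norm_nonneg _) ?_ hγ
      refine (norm_add_le _ _).trans ?_
      rw [norm_one]; linarith)
    simpa using this

/-- The coefficient `bc γ (p+1)` is the limit of the remainder at `u = 0`. That it stays strictly
below the bound is what makes the estimate of `J` strict. -/
theorem norm_bc_lt_m1 (p : ℕ) {γ : ℂ} (hγ : 0 ≤ γ.re) (ψ : ℂ) :
    ‖bc γ (p + 1)‖ < m1 ψ γ + p * Real.exp (‖γ‖ ^ 2 + γ.re) + 1 := by
  have h2 : (1 : ℝ) ≤ 2 ^ γ.re := Real.one_le_rpow (by norm_num) hγ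
  have hm : Real.exp (Real.pi * |γ.im|) * 2 ^ γ.re ≤ m1 ψ γ := by
    rw [m1]; gcongr; exact le_max_left _ _
  cases p with
  | zero =>
    rw [zero_add, bc_one]
    have hexp := Real.add_one_le_exp (Real.pi * |γ.im|)
    have h3 : γ.re ≤ 2 ^ γ.re := by
      rcases le_total γ.re 1 with h | h
      · linarith
      · have := one_add_mul_self_le_rpow_one_add (s := 1) (by norm_num) h
        norm_num at this
        linarith
    have h4 : ‖γ‖ ≤ |γ.re| + |γ.im| := Complex.norm_le_abs_re_add_abs_im γ
    rw [abs_of_nonneg hγ] at h4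
    have h5 : |γ.im| ≤ Real.pi * |γ.im| :=
      le_mul_of_one_le_left (abs_nonneg _) (by linarith [Real.pi_gt_three])
    have h6 : (1 + |γ.im|) * 2 ^ γ.re ≤ Real.exp (Real.pi * |γ.im|) * 2 ^ γ.re := by
      gcongr; linarith
    have h7 : |γ.im| ≤ |γ.im| * 2 ^ γ.re := le_mul_of_one_le_right (abs_nonneg _) h2
    push_cast
    nlinarith
  | succ p =>
    have h3 := norm_bc_succ_le (γ := γ) (by linarith) (p + 1)
    have h4 : 0 < m1 ψ γ := lt_of_lt_of_le (by positivity) hm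
    have h5 : 0 ≤ (p : ℝ) * Real.exp (‖γ‖ ^ 2 + γ.re) := by positivity
    push_cast
    linarith

theorem norm_J_le_of_norm_r_le (n p : ℕ) {a γ ψ : ℂ} (ha : 0 < a.re) {c : ℝ}
    (hr : ∀ u ∈ Ioc (0 : ℝ) 1, ‖r p u ψ γ‖ ≤ c) :
    ‖J n p a γ ψ‖ ≤ c * rbeta n (p + 1 + a.re) := by
  have hX : 0 < (p : ℝ) + 1 + a.re := by positivity
  rw [rbeta, ← intervalIntegral.integral_const_mul]
  refine intervalIntegral.norm_integral_le_of_norm_le zero_le_one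
    (Eventually.of_forall fun u hu => ?_) ((intervalIntegrable_rbeta n hX).const_mul _)
  have h0 : 0 ≤ 1 - u := by linarith [hu.2]
  have h1 : 0 ≤ u ^ ((p : ℝ) + a.re) := Real.rpow_nonneg hu.1.le _
  rw [norm_mul, norm_remainder_weight n p a hu,
    show (p : ℝ) + 1 + a.re - 1 = p + a.re by ring, mul_comm c]
  have := hr u hu
  gcongr

/-- As `u → 0` the remainder tends to `bc γ (p+1)`, of norm less than `c`; hence the pointwise bound
is strict on some interval `(0, ε)`, a set of positive measure. -/
theorem norm_J_lt_of_norm_r_le (n p : ℕ) {a γ ψ : ℂ} (ha : 0 < a.re) (hγ : -1 < γ.re)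
    (hψ : ψ ≠ 0) {c : ℝ} (hr : ∀ u ∈ Ioc (0 : ℝ) 1, ‖r p u ψ γ‖ ≤ c)
    (hb : ‖bc γ (p + 1)‖ < c) :
    ‖J n p a γ ψ‖ < c * rbeta n (p + 1 + a.re) := by
  have hX : 0 < (p : ℝ) + 1 + a.re := by positivity
  obtain ⟨C, hC⟩ := norm_rr_le_of_norm_le_half (p + 1) hγ
  have hn := norm_pos_iff.mpr hψ
  obtain ⟨ε, hε0, hε1, hε⟩ : ∃ ε : ℝ, 0 < ε ∧ ε ≤ 1 ∧ ∀ u ∈ Ioo (0 : ℝ) ε, ‖r p u ψ γ‖ < c := by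
    have hC0 : 0 ≤ C := (norm_nonneg _).trans (hC 0 (by simp))
    set η := c - ‖bc γ (p + 1)‖ with hη
    have hη0 : 0 < η := by linarith
    -- The second entry keeps `‖ψ u‖ ≤ 1/2`, where `C` bounds the next remainder; the third keeps
    -- `‖ψ u‖ C` below the gap `η`. The `+ 1` covers `C = 0`.
    refine ⟨min 1 (min (1 / (2 * ‖ψ‖)) (η / (‖ψ‖ * (C + 1)))), by positivity, min_le_left _ _,
      fun u hu => ?_⟩
    have hu1 : u < 1 / (2 * ‖ψ‖) :=
      hu.2.trans_le ((min_le_right _ _).trans (min_le_left _ _))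
    have hu2 : u < η / (‖ψ‖ * (C + 1)) :=
      hu.2.trans_le ((min_le_right _ _).trans (min_le_right _ _))
    have hx : ‖ψ * (u : ℂ)‖ = ‖ψ‖ * u := by
      rw [norm_mul, Complex.norm_real, Real.norm_of_nonneg hu.1.le]
    have hx0 : ψ * (u : ℂ) ≠ 0 := mul_ne_zero hψ (by exact_mod_cast hu.1.ne')
    rw [lt_div_iff₀ (by positivity)] at hu1 hu2
    have h1 := hC (ψ * u) (by rw [hx]; linarith)
    rw [r_eq_rr p hγ, rr_eq_add p γ hx0]
    refine (norm_add_le _ _).trans_lt ?_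
    rw [norm_mul, hx]
    have h2 : ‖ψ‖ * u * ‖rr (p + 1) γ (ψ * u)‖ ≤ ‖ψ‖ * u * C := by
      have := hu.1.le
      gcongr
    have h3 : 0 < ‖ψ‖ * u := mul_pos hn hu.1
    nlinarith
  have hi1 := (intervalIntegrable_remainder n p ha hγ ψ).norm
  have hi2 := (intervalIntegrable_rbeta n hX).const_mul c
  have hle : ∀ u ∈ Ioc (0 : ℝ) 1, ‖(1 - (u : ℂ)) ^ n * (u : ℂ) ^ (p + a) * r p u ψ γ‖ ≤
      c * ((1 - u) ^ n * u ^ ((p : ℝ) + 1 + a.re - 1)) := by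
    intro u hu
    have h0 : 0 ≤ 1 - u := by linarith [hu.2]
    have h1 : 0 ≤ u ^ ((p : ℝ) + a.re) := Real.rpow_nonneg hu.1.le _
    rw [norm_mul, norm_remainder_weight n p a hu,
      show (p : ℝ) + 1 + a.re - 1 = p + a.re by ring, mul_comm c]
    have := hr u hu
    gcongr
  refine (intervalIntegral.norm_integral_le_integral_norm zero_le_one).trans_lt ?_
  rw [rbeta, ← intervalIntegral.integral_const_mul]
  refine intervalIntegral.integral_lt_integral_of_ae_le_of_measure_setOfPred_lt_ne_zero zero_le_one
    hi1 hi2 ?_ ?_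
  · filter_upwards [ae_restrict_mem measurableSet_Ioc] with u hu
    exact hle u hu
  · have hsub : Ioo (0 : ℝ) ε ⊆ {u : ℝ | ‖(1 - (u : ℂ)) ^ n * (u : ℂ) ^ (p + a) * r p u ψ γ‖ <
        c * ((1 - u) ^ n * u ^ ((p : ℝ) + 1 + a.re - 1))} := by
      intro u hu
      have hu1 : u < 1 := hu.2.trans_le hε1
      have h0 : 0 < 1 - u := by linarith
      have h1 : 0 < u ^ ((p : ℝ) + a.re) := Real.rpow_pos_of_pos hu.1 _
      change ‖_‖ < _
      rw [norm_mul, norm_remainder_weight n p a ⟨hu.1, hu1.le⟩,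
        show (p : ℝ) + 1 + a.re - 1 = p + a.re by ring, mul_comm c]
      have := hε u hu
      gcongr
    have hpos : 0 < volume.restrict (Ioc (0 : ℝ) 1) (Ioo (0 : ℝ) ε) := by
      have hss : Ioo (0 : ℝ) ε ⊆ Ioc 0 1 := fun u hu => ⟨hu.1, hu.2.le.trans hε1⟩
      rw [Measure.restrict_apply measurableSet_Ioo, inter_eq_left.mpr hss, Real.volume_Ioo]
      simpa using hε0
    exact (hpos.trans_le (measure_mono hsub)).ne'

end BiorthAsymp

end

noncomputable section

namespace BiorthAsymp

open Set

/-! ### Scalar inequalities -/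

/-- Notation of the scalar inequalities: `ω = Re w`, `Y = |Im w|`, `W = ‖w‖`, `V = ‖1 - w‖`, `h =
e^(πY/2)`; for `0 < s < 1`, `lam = -log(s(1-s))` and `ρ = (s(1-s))^ω = e^(-ω lam)`, where `s(1-s) ≤
1/4` accounts for `4^(-ω)` and `2 log 2`. `N` bounds the coefficients of `(1-s)^(w-1)` after the
first, and `D₀`, `D₁` stand for differences of consecutive tails. -/
theorem quarter_rpow_le {ω : ℝ} (h0 : 0 ≤ ω) (h1 : ω ≤ 1) :
    (1 / 4 : ℝ) ^ ω ≤ 1 - 3 / 4 * ω := by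
  have := rpow_one_add_le_one_add_mul_self (s := -(3 / 4)) (by norm_num) h0 h1
  norm_num at this ⊢
  linarith

theorem quarter_rpow_eq {q : ℝ} {k : ℕ} (hq : 0 ≤ q) (hqk : q ^ k = 1 / 4) (ω : ℝ) :
    (1 / 4 : ℝ) ^ ω = q ^ (k * ω) := by
  rw [← hqk, ← Real.rpow_natCast, ← Real.rpow_mul hq]

/-- The inequality `ω (ρ + 1 + (1 - ω) v) ≤ 2 (1 - ρ)` at `ρ = e^{-v} = 4^{-ω}`. -/
theorem real_ineq_quarter {ω : ℝ} (h0 : 0 ≤ ω) (h1 : ω ≤ 1) :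
    (2 + ω) * (1 / 4 : ℝ) ^ ω + ω + 13863 / 10000 * ω ^ 2 * (1 - ω) ≤ 2 := by
  -- The convex function `4^(-ω)` lies below its chords over `[0,1/4]`, `[1/4,1/2]` and `[1/2,1]`;
  -- each chord bound is Bernoulli's inequality for a power of `2^(-1/2)` or of `1/2`.
  rcases le_total ω (1 / 2) with h | h
  · set q := √(1 / 2 : ℝ) with hq
    have hq0 : 0 ≤ q := Real.sqrt_nonneg _
    have hq2 : q ^ 2 = 1 / 2 := Real.sq_sqrt (by norm_num)
    have hqu : q ≤ 70711 / 100000 := by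
      rw [hq, Real.sqrt_le_left (by norm_num)]; norm_num
    have hq4 : q ^ 4 = 1 / 4 := by rw [show 4 = 2 * 2 by norm_num, pow_mul, hq2]; norm_num
    have hqp : 0 < q := by nlinarith
    rw [quarter_rpow_eq hq0 hq4]
    rcases le_total ω (1 / 4) with h' | h'
    · have := rpow_one_add_le_one_add_mul_self (s := q - 1) (p := 4 * ω) (by linarith)
        (by linarith) (by linarith)
      rw [add_sub_cancel] at this
      push_cast
      have h2 : q ^ (4 * ω) ≤ 1 - 11715 / 10000 * ω := by nlinarith
      nlinarith
    · have := rpow_one_add_le_one_add_mul_self (s := q - 1) (p := 4 * ω - 1) (by linarith)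
        (by linarith) (by linarith)
      rw [add_sub_cancel] at this
      push_cast
      have h2 : q ^ (4 * ω) ≤ 914222 / 1000000 - 8284 / 10000 * ω := by
        have e : q ^ (4 * ω) = q * q ^ (4 * ω - 1) := by
          rw [Real.rpow_sub_one hqp.ne']; field_simp
        rw [e]
        calc q * q ^ (4 * ω - 1) ≤ q * (1 + (4 * ω - 1) * (q - 1)) := by gcongr
          _ = q * (2 - 4 * ω) + (4 * ω - 1) * q ^ 2 := by ring
          _ ≤ _ := by rw [hq2]; nlinarith
      nlinarith [mul_nonneg h0 (sq_nonneg (ω - 3 / 8)), sq_nonneg (ω - 3 / 8)]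
  · rw [quarter_rpow_eq (q := 1 / 2) (k := 2) (by norm_num) (by norm_num)]
    have := rpow_one_add_le_one_add_mul_self (s := -(1 / 2)) (p := 2 * ω - 1) (by norm_num)
      (by linarith) (by linarith)
    have e : (1 / 2 : ℝ) ^ ((2 : ℕ) * ω) = 1 / 2 * (1 / 2 : ℝ) ^ (2 * ω - 1) := by
      rw [Real.rpow_sub_one (by norm_num)]; push_cast; ring
    have h2 : (1 / 2 : ℝ) ^ ((2 : ℕ) * ω) ≤ 3 / 4 - 1 / 2 * ω := by
      rw [e]; norm_num at this ⊢; linarith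
    nlinarith [mul_nonneg h0 (sq_nonneg (ω - 688 / 1000)), sq_nonneg (ω - 688 / 1000)]

theorem two_log_two_bounds : 13862 / 10000 ≤ 2 * Real.log 2 ∧ 2 * Real.log 2 ≤ 13863 / 10000 := by
  constructor
  · linarith [Real.log_two_gt_d9]
  · linarith [Real.log_two_lt_d9]

theorem quarter_rpow_eq_exp (ω : ℝ) : (1 / 4 : ℝ) ^ ω = Real.exp (-(ω * (2 * Real.log 2))) := by
  rw [Real.rpow_def_of_pos (by norm_num)]
  congr 1
  rw [one_div, Real.log_inv, show (4 : ℝ) = 2 ^ 2 by norm_num, Real.log_pow]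
  push_cast; ring

/-- This is the case `Im w = 0` of `base_ineq`. For `ρ ≤ 3/10` the bound `min 2 v ≤ 2` is enough.
Otherwise the claim reduces to `v₀ = 2 ω log 2`: passing from `v₀` to `v`, the left side gains at
most `(v - v₀)/4` from the logarithmic term, while `2ρ` loses at least `2 · 3/10 · (v - v₀)`. -/
theorem real_ineq {ω v ρ : ℝ} (h0 : 0 < ω) (h1 : ω < 1) (hv : ω * (2 * Real.log 2) ≤ v)
    (hρ : ρ = Real.exp (-v)) :
    ω * (ρ + 1 + (1 - ω) * min 2 v) ≤ 2 * (1 - ρ) := by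
  have hρ0 : 0 < ρ := hρ ▸ Real.exp_pos _
  have hk : 0 ≤ ω * (1 - ω) := mul_nonneg h0.le (by linarith)
  rcases le_total ρ (3 / 10) with h | h
  · have h2 : min 2 v ≤ 2 := min_le_left _ _
    have h3 : ω * (1 - ω) * min 2 v ≤ ω * (1 - ω) * 2 := by gcongr
    nlinarith [sq_nonneg (ω - 825 / 1000)]
  · have h2 : min 2 v ≤ v := min_le_right _ _
    have h3 : ω * (1 - ω) * min 2 v ≤ ω * (1 - ω) * v := by gcongr
    set v₀ := ω * (2 * Real.log 2) with hv₀
    have hq := real_ineq_quarter h0.le h1.le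
    rw [quarter_rpow_eq_exp, ← hv₀] at hq
    have h4 : ρ * (1 + (v - v₀)) ≤ Real.exp (-v₀) := by
      have e : Real.exp (-v₀) = ρ * Real.exp (v - v₀) := by
        rw [hρ, ← Real.exp_add]; congr 1; ring
      rw [e]
      have := Real.add_one_le_exp (v - v₀)
      gcongr
      linarith
    have h5 : v₀ ≤ 13863 / 10000 * ω := by
      rw [hv₀, mul_comm]; exact mul_le_mul_of_nonneg_right two_log_two_bounds.2 h0.le
    have h6 : ω * (1 - ω) ≤ 1 / 4 := by nlinarith [sq_nonneg (ω - 1 / 2)]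
    have h7 : 0 ≤ v - v₀ := by linarith
    have h8 : ω * (1 - ω) * (v - v₀) ≤ 1 / 4 * (v - v₀) := by gcongr
    have h9 : 3 / 10 * (v - v₀) ≤ ρ * (v - v₀) := by gcongr
    have h10 : ω * (1 - ω) * v₀ ≤ ω * (1 - ω) * (13863 / 10000 * ω) := by gcongr
    have h11 : (2 + ω) * (ρ * (1 + (v - v₀))) ≤ (2 + ω) * Real.exp (-v₀) := by gcongr
    have h12 : 0 ≤ ω * (ρ * (v - v₀)) := by positivity
    nlinarith

/-- The constant is `2 / (1 - 3/19)`, where `19/3` is the value at `2` of the cubic Taylor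
polynomial of `exp`. -/
theorem min_le_mul_one_sub_exp {v : ℝ} (hv : 0 ≤ v) :
    min 2 v ≤ 2375 / 1000 * (1 - Real.exp (-v)) := by
  have key : ∀ x : ℝ, 0 ≤ x → x ≤ 2 → x ≤ 2375 / 1000 * (1 - Real.exp (-x)) := by
    intro x hx hx2
    have h1 : 1 + x + x ^ 2 / 2 + x ^ 3 / 6 ≤ Real.exp x := by
      have := Real.sum_le_exp_of_nonneg hx 4
      simp [Finset.sum_range_succ, Nat.factorial] at this
      linarith
    have h0 : 0 < 1 + x + x ^ 2 / 2 + x ^ 3 / 6 := by positivity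
    have h2 : Real.exp (-x) ≤ 1 / (1 + x + x ^ 2 / 2 + x ^ 3 / 6) := by
      rw [Real.exp_neg, ← one_div]
      exact one_div_le_one_div_of_le h0 h1
    have h3 : 1 / (1 + x + x ^ 2 / 2 + x ^ 3 / 6) ≤ 1 - x / (2375 / 1000) := by
      rw [div_le_iff₀ h0]
      have h4 : 0 ≤ x * (2 - x) := mul_nonneg hx (by linarith)
      nlinarith [mul_nonneg h4 hx, mul_nonneg (mul_nonneg h4 hx) hx]
    linarith
  rcases le_total v 2 with h | h
  · rw [min_eq_right h]; exact key v hv h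
  · rw [min_eq_left h]
    refine (key 2 (by norm_num) le_rfl).trans ?_
    have : Real.exp (-v) ≤ Real.exp (-2) := Real.exp_le_exp.mpr (by linarith)
    linarith

/-- Lower bounds for `h = e^{πY/2}`. -/
theorem exp_half_pi_bounds {Y h : ℝ} (hY : 0 ≤ Y) (hh : h = Real.exp (Real.pi * Y / 2)) :
    1 + 157 / 100 * Y + 123 / 100 * Y ^ 2 + 64 / 100 * Y ^ 3 ≤ h ∧ h - 1 ≤ 1571 / 1000 * Y * h := by
  have hp1 := Real.pi_gt_d2
  have hp2 := Real.pi_lt_d4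
  set c := Real.pi * Y / 2 with hc
  have hc0 : 0 ≤ c := by positivity
  have hc1 : 157 / 100 * Y ≤ c := by rw [hc]; nlinarith
  have hc2 : c ≤ 1571 / 1000 * Y := by rw [hc]; nlinarith
  constructor
  · have := Real.sum_le_exp_of_nonneg hc0 4
    simp [Finset.sum_range_succ, Nat.factorial] at this
    rw [hh]
    have h2 : (157 / 100 * Y) ^ 2 ≤ c ^ 2 := by gcongr
    have h3 : (157 / 100 * Y) ^ 3 ≤ c ^ 3 := by gcongr
    have : 0 ≤ Y ^ 2 := by positivity
    have : 0 ≤ Y ^ 3 := by positivity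
    nlinarith
  · have h1 := Real.add_one_le_exp (-c)
    rw [Real.exp_neg, ← hh] at h1
    have hpos : 0 < h := hh ▸ Real.exp_pos _
    have h2 : (-c + 1) * h ≤ 1 := by
      calc (-c + 1) * h ≤ h⁻¹ * h := by gcongr
        _ = 1 := inv_mul_cancel₀ hpos.ne'
    nlinarith

theorem norm_le_add_half {ω Y W : ℝ} (hω : 0 ≤ ω) (hY : 0 ≤ Y) (hYω : Y ≤ ω)
    (hW : W ^ 2 = ω ^ 2 + Y ^ 2) : W ≤ ω + Y / 2 := by
  refine le_of_sq_le_sq ?_ (by positivity)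
  rw [hW]; nlinarith [mul_nonneg hY (sub_nonneg.mpr hYω)]

theorem mul_min_le {ω W V h D lam : ℝ} (hω : 0 < ω) (hWω : ω ≤ W)
    (hV : 0 ≤ V) (hh : 0 ≤ h) (hD2 : D ≤ 2 * (V * h)) (hDl : D ≤ V * h * (W * lam)) :
    W * D ≤ W ^ 2 / ω * V * (h * min 2 (ω * lam)) := by
  have hW : 0 ≤ W := by linarith
  have h1 : D ≤ V * h * (W / ω * min 2 (ω * lam)) := by
    have hr : 1 ≤ W / ω := (one_le_div hω).mpr hWω
    rw [mul_min_of_nonneg _ _ (by positivity), mul_min_of_nonneg _ _ (by positivity)]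
    refine le_min (hD2.trans ?_) (hDl.trans (le_of_eq ?_))
    · have : 0 ≤ V * h := by positivity
      nlinarith
    · field_simp
  calc W * D ≤ W * (V * h * (W / ω * min 2 (ω * lam))) := by gcongr
    _ = _ := by ring

/-- The estimate of the second difference in the range `Y ≤ ω`. -/
theorem mul_second_le {ω Y W V h D lam : ℝ} (hω : 0 < ω) (hω1 : ω < 1) (hY : 0 ≤ Y) (hYω : Y ≤ ω)
    (hW0 : 0 ≤ W) (hW : W ^ 2 = ω ^ 2 + Y ^ 2) (hV0 : 0 ≤ V) (hV : V ^ 2 = (1 - ω) ^ 2 + Y ^ 2)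
    (hh : 0 ≤ h) (hlam : 0 ≤ lam) (hD2 : D ≤ 2 * (V * h)) (hDl : D ≤ V * h * (W * lam)) :
    W * D ≤ (ω * (1 - ω) + Y + Y ^ 2) * (h * min 2 (ω * lam)) := by
  have hWω : ω ≤ W := le_of_sq_le_sq (by rw [hW]; nlinarith) hW0
  have hμ : 0 ≤ min 2 (ω * lam) := le_min (by norm_num) (by positivity)
  refine (mul_min_le hω hWω hV0 hh hD2 hDl).trans ?_
  refine mul_le_mul_of_nonneg_right ?_ (by positivity)
  have hV' : V ≤ 1 - ω + Y := by
    refine le_of_sq_le_sq ?_ (by linarith)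
    rw [hV]; nlinarith [mul_nonneg hY (by linarith : 0 ≤ 1 - ω)]
  have hW2 : W ^ 2 / ω ≤ ω + Y := by
    rw [div_le_iff₀ hω, hW]; nlinarith
  calc W ^ 2 / ω * V ≤ (ω + Y) * (1 - ω + Y) := by gcongr
    _ = _ := by ring

/-- It pays, in `base_ineq`, for all terms that disappear when `Y = 0` and `h = 1`. -/
theorem excess_ineq {Y h : ℝ} (hY : 0 ≤ Y)
    (hb : 1 + 157 / 100 * Y + 123 / 100 * Y ^ 2 + 64 / 100 * Y ^ 3 ≤ h) :
    3 / 2 * Y + 1 / 2 * (h - 1) + 2 * (Y + Y ^ 2) * h ≤ 2 * (h ^ 2 - 1) := by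
  have hY2 : 0 ≤ Y ^ 2 := by positivity
  have hY3 : 0 ≤ Y ^ 3 := by positivity
  have hh0 : 0 ≤ h := by linarith
  have e : (157 / 100 * Y + 123 / 100 * Y ^ 2) * (2 * h + 3 / 2) ≤ (h - 1) * (2 * h + 3 / 2) := by
    gcongr; linarith
  have h1 := mul_nonneg hY hh0
  have h2 := mul_nonneg hY2 hh0
  linarith

/-- For `Y ≤ ω` this is a perturbation of `Y = 0`: `real_ineq` is the main part and `excess_ineq`
the rest. For `Y ≥ ω` the crude bound `W (2 + 3h)` of the left side suffices, against `ρ ≤ 1 - 3ω/4`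
and the cubic lower bound of `h`. -/
theorem base_ineq {ω Y W V h N lam ρ D₀ D₁ : ℝ} (hω : 0 < ω) (hω1 : ω < 1) (hY : 0 ≤ Y)
    (hW0 : 0 ≤ W) (hW : W ^ 2 = ω ^ 2 + Y ^ 2) (hV0 : 0 ≤ V) (hV : V ^ 2 = (1 - ω) ^ 2 + Y ^ 2)
    (hh : h = Real.exp (Real.pi * Y / 2)) (hlam : 2 * Real.log 2 ≤ lam)
    (hρ : ρ = Real.exp (-(ω * lam))) (hNh : N ≤ h) (hNV : N ≤ V * h)
    (hD₀ : D₀ ≤ 1 + N) (hD₀' : D₀ ≤ W / ω) (hD₁ : D₁ ≤ 2 * N) (hD₁' : D₁ ≤ N * (W * lam)) :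
    W * (ρ + D₀ + D₁) ≤ 2 * (h ^ 2 - ρ) := by
  obtain ⟨hb1, hb2⟩ := exp_half_pi_bounds hY hh
  have hY3 : 0 ≤ Y ^ 3 := by positivity
  have hh1 : 1 ≤ h := by linarith [sq_nonneg Y]
  have hlam0 : 0 ≤ lam := by linarith [two_log_two_bounds.1]
  have hv : ω * (2 * Real.log 2) ≤ ω * lam := by gcongr
  have hρ0 : 0 < ρ := hρ ▸ Real.exp_pos _
  have hρ4 : ρ ≤ 1 - 3 / 4 * ω := by
    refine le_trans ?_ (quarter_rpow_le hω.le hω1.le)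
    rw [hρ, quarter_rpow_eq_exp]
    exact Real.exp_le_exp.mpr (by linarith)
  rcases le_total Y ω with hYω | hYω
  · have h1 := norm_le_add_half hω.le hY hYω hW
    have h2 := real_ineq hω hω1 hv hρ
    have h3 := mul_second_le (D := D₁) (h := h) hω hω1 hY hYω hW0 hW hV0 hV (by linarith) hlam0
      (by linarith) (hD₁'.trans (by gcongr))
    set μ := min 2 (ω * lam)
    have hμ2 : μ ≤ 2 := min_le_left _ _
    have hμ0 : 0 ≤ μ := le_min (by norm_num) (by positivity)
    have hk : ω * (1 - ω) ≤ 1 / 4 := by nlinarith [sq_nonneg (ω - 1 / 2)]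
    have hk0 : 0 ≤ ω * (1 - ω) := mul_nonneg hω.le (by linarith)
    have h4 : W * D₀ ≤ ω + Y := by
      calc W * D₀ ≤ W * (W / ω) := by gcongr
        _ = W ^ 2 / ω := by ring
        _ ≤ ω + Y := by rw [div_le_iff₀ hω, hW]; nlinarith
    have h5 : W * ρ ≤ ω * ρ + Y / 2 := by
      calc W * ρ ≤ (ω + Y / 2) * ρ := by gcongr
        _ = ω * ρ + Y / 2 * ρ := by ring
        _ ≤ ω * ρ + Y / 2 * 1 := by gcongr; linarith
        _ = _ := by ring
    have h6 : ω * (1 - ω) * ((h - 1) * μ) ≤ 1 / 4 * ((h - 1) * 2) := by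
      have : 0 ≤ h - 1 := by linarith
      gcongr
    have h7 : (Y + Y ^ 2) * (h * μ) ≤ (Y + Y ^ 2) * (h * 2) := by gcongr
    have h8 := excess_ineq hY hb1
    have e1 : (ω * (1 - ω) + Y + Y ^ 2) * (h * μ) = ω * (1 - ω) * μ + ω * (1 - ω) * ((h - 1) * μ) +
        (Y + Y ^ 2) * (h * μ) := by ring
    have e2 : W * (ρ + D₀ + D₁) = W * ρ + W * D₀ + W * D₁ := by ring
    have e3 : ω * (ρ + 1 + (1 - ω) * μ) = ω * ρ + ω + ω * (1 - ω) * μ := by ring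
    rw [e2]
    rw [e1] at h3
    rw [e3] at h2
    linarith
  · have h1 : W ≤ Y + ω / 2 := norm_le_add_half hY hω.le hYω (by rw [hW]; ring)
    have h2 : W * (ρ + D₀ + D₁) ≤ W * (2 + 3 * h) :=
      mul_le_mul_of_nonneg_left (by linarith) hW0
    have h3 : W * (2 + 3 * h) ≤ (Y + ω / 2) * (2 + 3 * h) :=
      mul_le_mul_of_nonneg_right h1 (by linarith)
    have h4 : (157 / 100 * Y + 123 / 100 * Y ^ 2) * (h + 1) ≤ (h - 1) * (h + 1) :=
      mul_le_mul_of_nonneg_right (by linarith) (by linarith)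
    have h5 : ω * (3 / 2 * h - 1 / 2) ≤ Y * (3 / 2 * h - 1 / 2) :=
      mul_le_mul_of_nonneg_right hYω (by linarith)
    have h6 : 0 ≤ Y ^ 2 * h := by positivity
    have h7 : Y * (h - 1) ≤ Y * (1571 / 1000 * Y * h) := by gcongr
    have h8 : 0 ≤ Y ^ 2 := by positivity
    linarith

/-- Equivalently `h (h - 2Y - 2Y²) ≥ 1`. In terms of `c = πY/2` the factors are bounded below by the
polynomials `B` and `d` with `B d ≥ 1`; the constant `637/1000` exceeds `2/π`. -/
theorem two_mul_add_sq_le {Y h : ℝ} (hY : 0 ≤ Y) (hY1 : Y ≤ 1)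
    (hh : h = Real.exp (Real.pi * Y / 2)) : (2 * Y + 2 * Y ^ 2) * h ≤ h ^ 2 - 1 := by
  have hp1 := Real.pi_gt_d2
  have hp2 := Real.pi_lt_d4
  set c := Real.pi * Y / 2 with hc
  have hc0 : 0 ≤ c := by positivity
  have hc1 : Y ≤ 637 / 1000 * c := by rw [hc]; nlinarith
  have hc2 : c ≤ 158 / 100 := by rw [hc]; nlinarith
  have hexp := Real.sum_le_exp_of_nonneg hc0 4
  simp [Finset.sum_range_succ, Nat.factorial] at hexp
  rw [← hh] at hexp
  set B := 1 + c + c ^ 2 / 2 with hB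
  have hB1 : B + c ^ 3 / 6 ≤ h := by rw [hB]; linarith
  have hc3 : 0 ≤ c ^ 3 := by positivity
  have h1 : 2 * Y + 2 * Y ^ 2 ≤ 1274 / 1000 * c + 812 / 1000 * c ^ 2 := by nlinarith
  set d := B + c ^ 3 / 6 - (1274 / 1000 * c + 812 / 1000 * c ^ 2) with hd
  have hB0 : 0 < B := by positivity
  have h2 : 1 ≤ B * d := by
    rw [hd, hB]
    have : 0 ≤ 726 / 1000 - 85 / 1000 * c - 282 / 1000 * c ^ 2 + 83 / 1000 * c ^ 4 := by
      nlinarith [sq_nonneg (c ^ 2 - 17 / 10)]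
    have h4 : 0 ≤ c ^ 4 := by positivity
    have h5 := mul_nonneg hc0 this
    nlinarith
  have hd0 : 0 < d := by
    by_contra hneg
    have : B * d ≤ 0 := mul_nonpos_of_nonneg_of_nonpos hB0.le (not_lt.mp hneg)
    linarith
  have h3 : d ≤ h - (2 * Y + 2 * Y ^ 2) := by rw [hd]; linarith
  have h4 : B ≤ h := by linarith
  have h0 : 0 ≤ h := by linarith
  have h5 : B * d ≤ h * (h - (2 * Y + 2 * Y ^ 2)) := by gcongr
  linarith

theorem pi_mul_le {Y h : ℝ} (hY : 0 ≤ Y) (hh : h = Real.exp (Real.pi * Y / 2)) :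
    314 / 100 * Y * h ≤ h ^ 2 - 1 := by
  have hp1 := Real.pi_gt_d2
  have h1 := Real.self_le_sinh_iff.mpr (show 0 ≤ Real.pi * Y / 2 by positivity)
  rw [Real.sinh_eq, Real.exp_neg, ← hh] at h1
  have hpos : 0 < h := hh ▸ Real.exp_pos _
  have h2 : Real.pi * Y * h ≤ (h - h⁻¹) * h := by gcongr; linarith
  have h3 : (h - h⁻¹) * h = h ^ 2 - 1 := by field_simp
  have h4 : 314 / 100 * Y * h ≤ Real.pi * Y * h := by gcongr; linarith
  linarith

/-- `W V` is the modulus of `w (1 - w̄)`, whose real part is `ω(1-ω) - Y²` and whose imaginary part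
is `±Y`. -/
theorem norm_mul_norm_one_sub_le {ω Y W V : ℝ} (hY : 0 ≤ Y) (hW : W ^ 2 = ω ^ 2 + Y ^ 2)
    (hV : V ^ 2 = (1 - ω) ^ 2 + Y ^ 2) : W * V ≤ |ω * (1 - ω) - Y ^ 2| + Y := by
  refine le_of_sq_le_sq ?_ (by positivity)
  have h1 := sq_abs (ω * (1 - ω) - Y ^ 2)
  have h2 : (W * V) ^ 2 = (ω * (1 - ω) - Y ^ 2) ^ 2 + Y ^ 2 := by
    rw [mul_pow, hW, hV]; ring
  rw [h2]
  nlinarith [mul_nonneg (abs_nonneg (ω * (1 - ω) - Y ^ 2)) hY]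

/-- For `Y ≥ ω`, `W D₁ ≤ 3 Y h` is beaten by `π Y h ≤ h² - 1`. For `Y ≤ ω` and `Y ≥ 0.34`, `D₁ ≤ 2 V
h` is used with the estimate of `W V`. For small `Y` the right side may be as small as a multiple of
`1 - ρ`; the logarithmic bound of `D₁` provides such a factor through `min 2 (ω lam) ≤ 2.375 (1 -
ρ)`. -/
theorem slope_ineq {ω Y W V h N lam ρ D₁ : ℝ} (hω : 0 < ω) (hω1 : ω < 1) (hY : 0 ≤ Y)
    (hW0 : 0 ≤ W) (hW : W ^ 2 = ω ^ 2 + Y ^ 2) (hV0 : 0 ≤ V) (hV : V ^ 2 = (1 - ω) ^ 2 + Y ^ 2)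
    (hh : h = Real.exp (Real.pi * Y / 2)) (hlam : 2 * Real.log 2 ≤ lam)
    (hρ : ρ = Real.exp (-(ω * lam))) (hNh : N ≤ h) (hNV : N ≤ V * h)
    (hD₁ : D₁ ≤ 2 * N) (hD₁' : D₁ ≤ N * (W * lam)) :
    W * D₁ ≤ h ^ 2 - ρ := by
  obtain ⟨hb1, hb2⟩ := exp_half_pi_bounds hY hh
  have hY3 : 0 ≤ Y ^ 3 := by positivity
  have hh1 : 1 ≤ h := by linarith [sq_nonneg Y]
  have hlam0 : 0 ≤ lam := by linarith [two_log_two_bounds.1]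
  have hρ1 : ρ ≤ 1 := by
    rw [hρ]; exact Real.exp_le_one_iff.mpr (neg_nonpos.mpr (by positivity))
  have hρ0 : 0 < ρ := hρ ▸ Real.exp_pos _
  have hpi := pi_mul_le hY hh
  have hk : ω * (1 - ω) ≤ 1 / 4 := by nlinarith [sq_nonneg (ω - 1 / 2)]
  have hk0 : 0 ≤ ω * (1 - ω) := mul_nonneg hω.le (by linarith)
  rcases le_total Y ω with hYω | hYω
  · rcases le_total Y (34 / 100) with hYs | hYs
    · have h3 := mul_second_le (D := D₁) (h := h) hω hω1 hY hYω hW0 hW hV0 hV (by linarith) hlam0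
        (by linarith) (hD₁'.trans (by gcongr))
      have h4 := min_le_mul_one_sub_exp (v := ω * lam) (by positivity)
      rw [← hρ] at h4
      set q := 1 - ρ with hq
      have hq0 : 0 ≤ q := by linarith
      have hq1 : q ≤ 1 := by linarith
      have h5 : W * D₁ ≤ (1 / 4 + Y + Y ^ 2) * (h * (2375 / 1000 * q)) := by
        refine h3.trans ?_
        have : 0 ≤ min 2 (ω * lam) := le_min (by norm_num) (by positivity)
        gcongr
      have h6 : (1 / 4 + Y + Y ^ 2) * (2375 / 1000) ≤ h := by
        have : Y ^ 2 ≤ 34 / 100 * Y := by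
          rw [sq]; exact mul_le_mul_of_nonneg_right hYs hY
        linarith
      have h7 : (1 / 4 + Y + Y ^ 2) * (h * (2375 / 1000 * q)) ≤ h * h * q := by
        have : 0 ≤ h * q := by positivity
        calc _ = (1 / 4 + Y + Y ^ 2) * (2375 / 1000) * (h * q) := by ring
          _ ≤ h * (h * q) := by gcongr
          _ = _ := by ring
      have h8 : 0 ≤ (h * h - 1) * (1 - q) := mul_nonneg (sub_nonneg.mpr (one_le_mul_of_one_le_of_one_le hh1 hh1)) (by linarith)
      linarith
    · have h1 := norm_mul_norm_one_sub_le hY hW hV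
      have h2 : W * D₁ ≤ 2 * (W * V) * h := by
        calc W * D₁ ≤ W * (2 * (V * h)) := mul_le_mul_of_nonneg_left (by linarith) hW0
          _ = _ := by ring
      have h3 : 2 * (W * V) * h ≤ 2 * (|ω * (1 - ω) - Y ^ 2| + Y) * h :=
        mul_le_mul_of_nonneg_right (by linarith) (by linarith)
      rcases le_total 0 (ω * (1 - ω) - Y ^ 2) with hs | hs
      · rw [abs_of_nonneg hs] at h3
        have h4 : 2 * (ω * (1 - ω) - Y ^ 2 + Y) ≤ 314 / 100 * Y := by
          have : 34 / 100 * Y ≤ Y ^ 2 := by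
            rw [sq]; exact mul_le_mul_of_nonneg_right hYs hY
          linarith
        have h5 : 2 * (ω * (1 - ω) - Y ^ 2 + Y) * h ≤ 314 / 100 * Y * h :=
          mul_le_mul_of_nonneg_right h4 (by linarith)
        linarith
      · rw [abs_of_nonpos hs] at h3
        have h4 := two_mul_add_sq_le hY (by linarith) hh
        have h5 : 2 * (-(ω * (1 - ω) - Y ^ 2) + Y) * h ≤ (2 * Y + 2 * Y ^ 2) * h :=
          mul_le_mul_of_nonneg_right (by linarith) (by linarith)
        linarith
  · have h1 : W ≤ 15 / 10 * Y := by
      refine le_of_sq_le_sq ?_ (by positivity)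
      rw [hW]; nlinarith
    have h2 : W * D₁ ≤ 15 / 10 * Y * (2 * h) := by
      calc W * D₁ ≤ W * (2 * h) := mul_le_mul_of_nonneg_left (by linarith) hW0
        _ ≤ _ := mul_le_mul_of_nonneg_right h1 (by linarith)
    linarith [mul_nonneg hY (by linarith : 0 ≤ h)]

end BiorthAsymp

end

/-! ### The estimate beyond the branch point, and integrals with an approximate primitive -/

noncomputable section

namespace BiorthAsymp

open Set Filter Topology

/-- The constant `7/10` lies just below `√3 - 1`: for `z = 0` the minimum of `2√(Q² + d²) - |d|`
over `d` is `√3 Q`. For `z ≥ Q/2` the stronger inequality `B - z ≤ 2(A - Q)` holds. -/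
theorem add_sqrt_le_two_mul_sqrt {Q z d A B : ℝ} (hz : 0 ≤ z) (hzQ : z ≤ Q) (hA0 : 0 ≤ A)
    (hB0 : 0 ≤ B) (hA : A ^ 2 = Q ^ 2 + d ^ 2) (hB : B ^ 2 = z ^ 2 + d ^ 2) :
    Q + B + 7 / 10 * (Q - z) ≤ 2 * A := by
  have hQ : 0 ≤ Q := hz.trans hzQ
  have hBA : B ≤ A := le_of_sq_le_sq (by rw [hA, hB]; nlinarith) hA0
  rcases le_total z (Q / 2) with h | h
  · have h1 : 17 / 10 * Q - 7 / 10 * z ≤ 2 * A - B := by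
      refine le_of_sq_le_sq ?_ (by linarith)
      have h2 : 3 * (Q ^ 2 - z ^ 2) ≤ (2 * A - B) ^ 2 := by nlinarith [sq_nonneg (A - 2 * B)]
      refine le_trans ?_ h2
      nlinarith [mul_nonneg hz (sub_nonneg.mpr h), sq_nonneg Q]
    linarith
  · have hAB : A ≤ 2 * B := le_of_sq_le_sq (by nlinarith [sq_nonneg d]) (by linarith)
    have h1 : B - z ≤ 2 * (A - Q) := by
      by_contra hcon
      push Not at hcon
      have hzB : z ≤ B := le_of_sq_le_sq (by rw [hB]; nlinarith [sq_nonneg d]) hB0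
      have hQA : Q ≤ A := le_of_sq_le_sq (by rw [hA]; nlinarith [sq_nonneg d]) hA0
      have h2 : (B - z) * (A + Q) ≤ (B - z) * (2 * (B + z)) :=
        mul_le_mul_of_nonneg_left (by linarith) (by linarith)
      rcases hQ.eq_or_lt with h0 | h0
      · have hz0 : z = 0 := by linarith
        have : A = B := (sq_eq_sq₀ hA0 hB0).mp (by rw [hA, hB, hz0, ← h0])
        linarith
      · have h3 : 2 * (A - Q) * (A + Q) < (B - z) * (A + Q) :=
          mul_lt_mul_of_pos_right hcon (by linarith)
        linarith
    linarith

theorem small_ineq {ω Y W V h : ℝ} (hω : 0 < ω) (hω1 : ω < 1) (hY : 0 ≤ Y)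
    (hW : W ^ 2 = ω ^ 2 + Y ^ 2) (hV : V ^ 2 = (1 - ω) ^ 2 + Y ^ 2)
    (hh : h = Real.exp (Real.pi * Y / 2)) :
    Y + W * V * h ≤ 7 / 10 * (1 - ω / 4) * h ^ 2 := by
  obtain ⟨hb1, -⟩ := exp_half_pi_bounds hY hh
  have hY2 : 0 ≤ Y ^ 2 := by positivity
  have hY3 : 0 ≤ Y ^ 3 := by positivity
  have hh1 : 1 ≤ h := by linarith
  have hWV := norm_mul_norm_one_sub_le hY hW hV
  suffices hs : ∃ e, Y ≤ e * h ∧ e + (|ω * (1 - ω) - Y ^ 2| + Y) ≤ 7 / 10 * (1 - ω / 4) * h by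
    obtain ⟨e, he, hs⟩ := hs
    calc Y + W * V * h ≤ e * h + (|ω * (1 - ω) - Y ^ 2| + Y) * h :=
          add_le_add he (mul_le_mul_of_nonneg_right hWV (by linarith))
      _ = (e + (|ω * (1 - ω) - Y ^ 2| + Y)) * h := by ring
      _ ≤ 7 / 10 * (1 - ω / 4) * h * h := mul_le_mul_of_nonneg_right hs (by linarith)
      _ = _ := by ring
  have hlow : (1 - ω / 4) * (1 + 157 / 100 * Y + 123 / 100 * Y ^ 2 + 64 / 100 * Y ^ 3) ≤
      (1 - ω / 4) * h := mul_le_mul_of_nonneg_left hb1 (by linarith)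
  rcases le_total 0 (ω * (1 - ω) - Y ^ 2) with hs | hs
  · refine ⟨Y, le_mul_of_one_le_right hY hh1, ?_⟩
    rw [abs_of_nonneg hs]
    have h1 : 0 ≤ Y * (1 - ω) := mul_nonneg hY (by linarith)
    have h2 : 0 ≤ Y ^ 2 * (1 - ω) := mul_nonneg hY2 (by linarith)
    have h3 : 0 ≤ Y ^ 3 * (1 - ω) := mul_nonneg hY3 (by linarith)
    have h4 := sq_nonneg (ω - 5875 / 10000)
    have h5 := sq_nonneg (Y - 36 / 100)
    nlinarith
  · refine ⟨235 / 1000, ?_, ?_⟩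
    · have h1 := Real.add_one_le_exp (Real.pi * Y / 2 - 1)
      rw [Real.exp_sub, ← hh] at h1
      have he := Real.exp_one_gt_d9
      have hpi := Real.pi_gt_d2
      have h2 : Real.pi * Y / 2 * Real.exp 1 ≤ h := by
        rw [← le_div_iff₀ (Real.exp_pos 1)]; linarith
      have h3 : 157 / 100 * Y * (2718 / 1000) ≤ Real.pi * Y / 2 * Real.exp 1 :=
        mul_le_mul (by nlinarith) (by linarith) (by norm_num) (by positivity)
      linarith
    · rw [abs_of_nonpos hs]
      have hk0 : 0 ≤ ω * (1 - ω) := mul_nonneg hω.le (by linarith)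
      have h1 : 3 / 4 * h ≤ (1 - ω / 4) * h := mul_le_mul_of_nonneg_right (by linarith) (by linarith)
      have h2 := mul_nonneg hY (sq_nonneg (Y - 9 / 10))
      have h3 := sq_nonneg (Y - 9 / 10)
      linarith

/-- The estimate behind the bound of the remainder beyond the branch point. -/
theorem outer_ineq {ω Y W V h X η d ρ P A : ℝ} (hω : 0 < ω) (hω1 : ω < 1) (hY : 0 ≤ Y)
    (hW0 : 0 ≤ W) (hW : W ^ 2 = ω ^ 2 + Y ^ 2) (hV : V ^ 2 = (1 - ω) ^ 2 + Y ^ 2)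
    (hh : h = Real.exp (Real.pi * Y / 2)) (hX : 0 < X) (hP : 2 ≤ P) (hρ0 : 0 ≤ ρ)
    (hρ : ρ ≤ 1 - 3 / 4 * ω) (hη : |η| ≤ |d| + Y) (hA0 : 0 ≤ A)
    (hA : A ^ 2 = (P + X - ω) ^ 2 + d ^ 2) {M : ℝ} (hM : M ^ 2 = (X - 1) ^ 2 + η ^ 2) :
    h ^ 2 * (ρ * M) + W * (1 + (P - 1) * (V * h)) ≤ h ^ 2 * (W + 2 * A - (P + X - ω)) := by
  have hsmall := small_ineq hω hω1 hY hW hV hh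
  set Q := P + X - ω with hQ
  -- `z` stays below `Q` by at least `P - 1 - ω/4`. The resulting slack `7/10 (Q - z)` pays for the
  -- `P - 1` coefficients of the subtracted polynomial, by `small_ineq`.
  set z := ρ * |X - 1| with hz
  have hz0 : 0 ≤ z := by positivity
  have hzQ : P - 1 - ω / 4 ≤ Q - z := by
    rcases le_total 1 X with h1 | h1
    · have : z ≤ 1 * (X - 1) := by
        rw [hz, abs_of_nonneg (by linarith)]
        exact mul_le_mul_of_nonneg_right (by linarith) (by linarith)
      linarith
    · have : z ≤ (1 - 3 / 4 * ω) * 1 := by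
        rw [hz, abs_of_nonpos (by linarith)]
        exact mul_le_mul hρ (by linarith) (by linarith) (by linarith)
      linarith
  set B := √(z ^ 2 + d ^ 2) with hB
  have hB0 : 0 ≤ B := Real.sqrt_nonneg _
  have hB2 : B ^ 2 = z ^ 2 + d ^ 2 := Real.sq_sqrt (by positivity)
  have h1 := add_sqrt_le_two_mul_sqrt hz0 (by linarith) hA0 hB0 hA hB2
  have hdB : |d| ≤ B := abs_le_of_sq_le_sq (by rw [hB2]; nlinarith) hB0
  have h2 : ρ * M ≤ B + Y := by
    refine le_of_sq_le_sq ?_ (by positivity)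
    have e1 : (ρ * M) ^ 2 = z ^ 2 + (ρ * |η|) ^ 2 := by
      rw [mul_pow, hM, hz, mul_pow, mul_pow, sq_abs, sq_abs]; ring
    have e2 : (ρ * |η|) ^ 2 ≤ (|d| + Y) ^ 2 := by
      refine pow_le_pow_left₀ (by positivity) ?_ 2
      exact (mul_le_of_le_one_left (abs_nonneg _) (by linarith)).trans hη
    have e3 : |d| * Y ≤ B * Y := mul_le_mul_of_nonneg_right hdB hY
    have e4 := sq_abs d
    rw [e1]
    linarith [hB2, e2, e3, e4, (by ring : (|d| + Y) ^ 2 = |d| ^ 2 + 2 * (|d| * Y) + Y ^ 2),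
      (by ring : (B + Y) ^ 2 = B ^ 2 + 2 * (B * Y) + Y ^ 2)]
  have hh1 : 1 ≤ h := by rw [hh]; exact Real.one_le_exp (by positivity)
  have hh2 : 1 ≤ h ^ 2 := one_le_pow₀ hh1
  have hYW : Y ≤ W := le_of_sq_le_sq (by rw [hW]; nlinarith) hW0
  have h3 : (P - 1) * (Y + W * V * h) ≤ (P - 1) * (7 / 10 * (1 - ω / 4) * h ^ 2) :=
    mul_le_mul_of_nonneg_left hsmall (by linarith)
  have h4 : h ^ 2 * (ρ * M) ≤ h ^ 2 * (B + Y) := mul_le_mul_of_nonneg_left h2 (by positivity)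
  have h5 : h ^ 2 * (Q + B + 7 / 10 * (P - 1 - ω / 4)) ≤ h ^ 2 * (2 * A) :=
    mul_le_mul_of_nonneg_left (by linarith) (by positivity)
  have h6 : 0 ≤ (h ^ 2 - 1) * (W - Y) := mul_nonneg (by linarith) (by linarith)
  have h7 : 0 ≤ (P - 2) * Y := mul_nonneg (by linarith) hY
  have h8 : 0 ≤ (P - 2) * (ω * h ^ 2) := mul_nonneg (by linarith) (by positivity)
  linarith

/-- A primitive `G` of an approximation of `I` bounds the integral of `I`. -/
theorem norm_integral_le_of_norm_sub_deriv_le {I G : ℝ → ℂ} {B : ℝ → ℝ} {s : Set ℝ}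
    (hs : s.Countable) (hG : ContinuousOn G (Icc 0 1)) (hG0 : G 0 = 0)
    (hI : IntervalIntegrable I MeasureTheory.volume 0 1)
    (hB : IntervalIntegrable B MeasureTheory.volume 0 1)
    (hd : ∀ u ∈ Ioo (0 : ℝ) 1 \ s, DifferentiableAt ℝ G u ∧ ‖I u - deriv G u‖ ≤ B u) :
    ‖∫ u in (0 : ℝ)..1, I u‖ ≤ ‖G 1‖ + ∫ u in (0 : ℝ)..1, B u := by
  have hae : ∀ᵐ u ∂MeasureTheory.volume.restrict (Ioc (0 : ℝ) 1), ‖I u - deriv G u‖ ≤ B u := by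
    have h1 : ∀ᵐ u : ℝ ∂MeasureTheory.volume, u ∉ s ∪ {1} :=
      (hs.union (countable_singleton 1)).ae_notMem _
    filter_upwards [MeasureTheory.ae_restrict_mem measurableSet_Ioc,
      MeasureTheory.ae_restrict_of_ae h1] with u hu hus
    simp only [mem_union, mem_singleton_iff, not_or] at hus
    exact (hd u ⟨⟨hu.1, lt_of_le_of_ne hu.2 hus.2⟩, hus.1⟩).2
  -- Integrability of `deriv G` is not a hypothesis: it follows from that of `I` and of the
  -- dominated difference.
  have hE : IntervalIntegrable (fun u => I u - deriv G u) MeasureTheory.volume 0 1 := by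
    refine hB.mono_fun' ?_ (by rwa [uIoc_of_le zero_le_one])
    rw [uIoc_of_le zero_le_one]
    exact hI.aestronglyMeasurable.sub (measurable_deriv G).aestronglyMeasurable
  have hG' : IntervalIntegrable (deriv G) MeasureTheory.volume 0 1 := by
    have := hI.sub hE
    refine this.congr (fun u _ => by simp)
  have h1 := MeasureTheory.integral_eq_of_hasDerivAt_off_countable_of_le G (deriv G) zero_le_one hs
    hG (fun u hu => (hd u hu).1.hasDerivAt) hG'
  have h2 : ∫ u in (0 : ℝ)..1, I u = G 1 + ∫ u in (0 : ℝ)..1, (I u - deriv G u) := by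
    rw [intervalIntegral.integral_sub hI hG', h1, hG0]; ring
  rw [h2]
  refine (norm_add_le _ _).trans (add_le_add le_rfl ?_)
  refine intervalIntegral.norm_integral_le_of_norm_le zero_le_one ?_ hB
  exact (MeasureTheory.ae_restrict_iff' measurableSet_Ioc).mp hae

end BiorthAsymp

end

noncomputable section

namespace BiorthAsymp

open Set Filter Topology

/-! ### Coefficients of `(1 - s) ^ (w - 1)` -/

/-- The partial products increase to `sinh(πy)/(πy)`, Euler's product for the sine at `iy`, and
`sinh x ≤ x e^x` for `x ≥ 0`. -/
theorem prod_one_add_sq_div_le (y : ℝ) (k : ℕ) :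
    ∏ j ∈ Finset.range k, (1 + y ^ 2 / ((j : ℝ) + 1) ^ 2) ≤ Real.exp (Real.pi * |y|) := by
  rcases eq_or_ne y 0 with rfl | hy
  · simp
  have hx : 0 < Real.pi * |y| := by positivity
  have ht := (Complex.tendsto_euler_sin_prod (y * Complex.I)).norm
  have e1 : ∀ n : ℕ, ‖(Real.pi : ℂ) * (y * Complex.I) * ∏ j ∈ Finset.range n,
      ((1 : ℂ) - (y * Complex.I) ^ 2 / ((j : ℂ) + 1) ^ 2)‖ =
      Real.pi * |y| * ∏ j ∈ Finset.range n, (1 + y ^ 2 / ((j : ℝ) + 1) ^ 2) := by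
    intro n
    have e : ∏ j ∈ Finset.range n, ((1 : ℂ) - (y * Complex.I) ^ 2 / ((j : ℂ) + 1) ^ 2) =
        ((∏ j ∈ Finset.range n, (1 + y ^ 2 / ((j : ℝ) + 1) ^ 2) : ℝ) : ℂ) := by
      push_cast
      refine Finset.prod_congr rfl fun j _ => ?_
      rw [mul_pow, Complex.I_sq]; ring
    rw [e, norm_mul, Complex.norm_real, norm_mul, norm_mul, Complex.norm_real, Complex.norm_real,
      Complex.norm_I, Real.norm_of_nonneg Real.pi_nonneg, mul_one, Real.norm_eq_abs,
      Real.norm_of_nonneg (Finset.prod_nonneg fun j _ => by positivity)]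
  have e2 : ‖Complex.sin (Real.pi * (y * Complex.I))‖ = Real.sinh (Real.pi * |y|) := by
    have : (Real.pi : ℂ) * (y * Complex.I) = ((Real.pi * y : ℝ) : ℂ) * Complex.I := by
      push_cast; ring
    rw [this, Complex.sin_mul_I, norm_mul, Complex.norm_I, mul_one, ← Complex.ofReal_sinh,
      Complex.norm_real, Real.norm_eq_abs, Real.abs_sinh, abs_mul, abs_of_pos Real.pi_pos]
  simp only [e1] at ht
  rw [e2] at ht
  have hmono : Monotone fun n : ℕ => Real.pi * |y| *
      ∏ j ∈ Finset.range n, (1 + y ^ 2 / ((j : ℝ) + 1) ^ 2) := by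
    refine monotone_nat_of_le_succ fun n => ?_
    rw [Finset.prod_range_succ]
    refine mul_le_mul_of_nonneg_left (le_mul_of_one_le_right
      (Finset.prod_nonneg fun j _ => by positivity) ?_) hx.le
    linarith [show 0 ≤ y ^ 2 / ((n : ℝ) + 1) ^ 2 by positivity]
  have h1 := hmono.ge_of_tendsto ht k
  have h2 : Real.sinh (Real.pi * |y|) ≤ Real.pi * |y| * Real.exp (Real.pi * |y|) := by
    rw [Real.sinh_eq]
    have h3 := Real.add_one_le_exp (-(2 * (Real.pi * |y|)))
    have h4 : Real.exp (-(Real.pi * |y|)) =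
        Real.exp (Real.pi * |y|) * Real.exp (-(2 * (Real.pi * |y|))) := by
      rw [← Real.exp_add]; congr 1; ring
    rw [h4]
    nlinarith [Real.exp_pos (Real.pi * |y|)]
  exact le_of_mul_le_mul_left (h1.trans h2) hx

/-- The coefficient of `s ^ k` in `(1 - s) ^ (w - 1)`. -/
def nbc (w : ℂ) (k : ℕ) : ℂ := ∏ j ∈ Finset.range k, (1 - w / (j + 1))

@[simp] theorem nbc_zero (w : ℂ) : nbc w 0 = 1 := by simp [nbc]

theorem nbc_succ (w : ℂ) (k : ℕ) : nbc w (k + 1) = nbc w k * (1 - w / (k + 1)) := by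
  rw [nbc, nbc, Finset.prod_range_succ]

theorem neg_one_pow_mul_bc (γ : ℂ) (k : ℕ) : (-1) ^ k * bc γ k = nbc (γ + 1) k := by
  induction k with
  | zero => simp
  | succ k ih =>
    rw [bc_succ, nbc_succ, ← ih, bc_factor, pow_succ]; ring

theorem norm_one_sub_div_sq_le {w : ℂ} (h0 : 0 ≤ w.re) (h1 : w.re ≤ 1) (j : ℕ) :
    ‖1 - w / (j + 1)‖ ^ 2 ≤ 1 + w.im ^ 2 / ((j : ℝ) + 1) ^ 2 := by
  rw [normSq_one_sub_div, ← Complex.normSq_eq_norm_sq, Complex.normSq_apply]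
  have hj : 0 < 1 / ((j : ℝ) + 1) := by positivity
  have hj1 : 1 / ((j : ℝ) + 1) ≤ 1 := by
    rw [div_le_one (by positivity)]; linarith [j.cast_nonneg (α := ℝ)]
  have e : (1 : ℝ) / ((j : ℝ) + 1) ^ 2 = (1 / ((j : ℝ) + 1)) ^ 2 := by rw [div_pow, one_pow]
  rw [div_eq_mul_one_div (w.im ^ 2), e]
  set x := 1 / ((j : ℝ) + 1)
  have h2 : w.re * x * (w.re * x) ≤ w.re * x * 1 :=
    mul_le_mul_of_nonneg_left (mul_le_one₀ h1 hj.le hj1) (by positivity)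
  have h3 : 0 ≤ w.re * x := by positivity
  linarith

/-- For `0 ≤ Re w ≤ 1` each factor satisfies `|1 - w/(j+1)|² ≤ 1 + (Im w)²/(j+1)²`. Setting the
factor `j = 0` aside produces the alternative `‖1 - w‖`. -/
theorem norm_nbc_succ_le {w : ℂ} (h0 : 0 ≤ w.re) (h1 : w.re ≤ 1) (k : ℕ) :
    ‖nbc w (k + 1)‖ ≤ min 1 ‖1 - w‖ * Real.exp (Real.pi * |w.im| / 2) := by
  have hsq : Real.exp (Real.pi * |w.im| / 2) ^ 2 = Real.exp (Real.pi * |w.im|) := by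
    rw [← Real.exp_nat_mul]; congr 1; push_cast; ring
  have hprod : ∀ s : Finset ℕ, (∏ j ∈ s, ‖1 - w / (j + 1)‖) ^ 2 ≤
      ∏ j ∈ s, (1 + w.im ^ 2 / ((j : ℝ) + 1) ^ 2) := fun s => by
    rw [← Finset.prod_pow]
    exact Finset.prod_le_prod (fun j _ => by positivity) fun j _ => norm_one_sub_div_sq_le h0 h1 j
  rw [min_mul_of_nonneg _ _ (Real.exp_nonneg _), one_mul]
  refine le_min ?_ ?_
  · refine le_of_sq_le_sq ?_ (Real.exp_nonneg _)
    rw [nbc, norm_prod, hsq]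
    exact (hprod _).trans (prod_one_add_sq_div_le _ _)
  · rw [nbc, norm_prod, Finset.prod_range_succ']
    simp only [Nat.cast_zero, zero_add, div_one]
    rw [mul_comm]
    refine mul_le_mul_of_nonneg_left (le_of_sq_le_sq ?_ (Real.exp_nonneg _)) (norm_nonneg _)
    rw [hsq]
    refine le_trans ?_ (prod_one_add_sq_div_le w.im (k + 1))
    rw [Finset.prod_range_succ', ← Finset.prod_pow]
    refine (Finset.prod_le_prod (fun j _ => by positivity) fun j _ =>
      norm_one_sub_div_sq_le h0 h1 (j + 1)).trans
      (le_mul_of_one_le_right (Finset.prod_nonneg fun j _ => by positivity) ?_)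
    linarith [show 0 ≤ w.im ^ 2 / (((0 : ℕ) : ℝ) + 1) ^ 2 by positivity]

theorem hasSum_nbc (w : ℂ) {s : ℂ} (hs : ‖s‖ < 1) :
    HasSum (fun k => nbc w k * s ^ k) ((1 - s) ^ (w - 1)) := by
  have h := (Complex.one_add_cpow_hasFPowerSeriesOnBall_zero (a := w - 1)).hasSum (y := -s) (by
    rw [← ENNReal.ofReal_one, Metric.eball_ofReal]
    simpa using hs)
  simp only [binomialSeries, zero_add, FormalMultilinearSeries.ofScalars_apply_eq] at h
  rw [← sub_eq_add_neg] at h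
  refine (funext fun k => ?_ : (fun k => nbc w k * s ^ k) = _) ▸ h
  rw [← bc_eq_choose, smul_eq_mul, neg_pow, ← mul_assoc, mul_comm (bc _ _), neg_one_pow_mul_bc,
    sub_add_cancel]

/-- The tails `∑ⱼ nbc w (i + j) sʲ` of the binomial series. -/
def tail (w : ℂ) (i : ℕ) (s : ℂ) : ℂ :=
  ((1 - s) ^ (w - 1) - ∑ k ∈ Finset.range i, nbc w k * s ^ k) / s ^ i

theorem tail_zero (w s : ℂ) : tail w 0 s = (1 - s) ^ (w - 1) := by simp [tail]

theorem tail_eq_add (w : ℂ) (i : ℕ) {s : ℂ} (hs : s ≠ 0) :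
    tail w i s = nbc w i + s * tail w (i + 1) s := by
  rw [tail, tail, Finset.sum_range_succ]
  field_simp
  ring

theorem tail_sub_tail (w : ℂ) (i : ℕ) {s : ℂ} (hs : s ≠ 0) :
    tail w i s - tail w (i + 1) s = nbc w i - (1 - s) * tail w (i + 1) s := by
  rw [tail_eq_add w i hs]; ring

theorem hasSum_tail (w : ℂ) (i : ℕ) {s : ℂ} (hs0 : s ≠ 0) (hs : ‖s‖ < 1) :
    HasSum (fun j => nbc w (i + j) * s ^ j) (tail w i s) := by
  have h := (hasSum_nat_add_iff' i).mpr (hasSum_nbc w hs)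
  have h2 := h.div_const (s ^ i)
  refine (funext fun j => ?_ : (fun j => nbc w (i + j) * s ^ j) = _) ▸ h2
  rw [pow_add, add_comm i j]
  field_simp

theorem norm_tail_le {w : ℂ} {N : ℝ} (hN : ∀ k, ‖nbc w (k + 1)‖ ≤ N) (i : ℕ) {s : ℝ} (hs0 : 0 < s)
    (hs1 : s < 1) : (1 - s) * ‖tail w (i + 1) s‖ ≤ N := by
  have hs : ‖(s : ℂ)‖ < 1 := by rwa [Complex.norm_real, Real.norm_of_nonneg hs0.le]
  have h := hasSum_tail w (i + 1) (by exact_mod_cast hs0.ne') hs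
  have hg := (hasSum_geometric_of_lt_one hs0.le hs1).mul_left N
  have h1 : ‖tail w (i + 1) s‖ ≤ N * (1 - s)⁻¹ := by
    rw [← h.tsum_eq]
    refine tsum_of_norm_bounded hg fun j => ?_
    rw [norm_mul, norm_pow, Complex.norm_real, Real.norm_of_nonneg hs0.le, add_right_comm]
    exact mul_le_mul_of_nonneg_right (hN _) (by positivity)
  have h2 : 0 < 1 - s := by linarith
  calc (1 - s) * ‖tail w (i + 1) s‖ ≤ (1 - s) * (N * (1 - s)⁻¹) := by gcongr
    _ = N := by field_simp

/-- All tails share the singularity `(1-s)^(w-1)` at `s = 1`, so consecutive ones differ by a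
bounded quantity. -/
theorem norm_tail_sub_tail_le {w : ℂ} {N c : ℝ} (hN : ∀ k, ‖nbc w (k + 1)‖ ≤ N) {i : ℕ}
    (hi : ‖nbc w i‖ ≤ c) {s : ℝ} (hs0 : 0 < s) (hs1 : s < 1) :
    ‖tail w i s - tail w (i + 1) s‖ ≤ c + N := by
  rw [tail_sub_tail w i (by exact_mod_cast hs0.ne')]
  refine (norm_sub_le _ _).trans (add_le_add hi ?_)
  rw [norm_mul, show (1 : ℂ) - s = ((1 - s : ℝ) : ℂ) by push_cast; rfl, Complex.norm_real,
    Real.norm_of_nonneg (by linarith)]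
  exact norm_tail_le hN i hs0 hs1

theorem hasSum_pow_div_add_two {s : ℝ} (hs0 : 0 < s) (hs1 : s < 1) :
    HasSum (fun j : ℕ => s ^ j / (j + 2)) ((-Real.log (1 - s) - s) / s ^ 2) := by
  have h := Real.hasSum_pow_div_log_of_abs_lt_one (x := s) (by rwa [abs_of_pos hs0])
  have h2 := ((hasSum_nat_add_iff' 1).mpr h).div_const (s ^ 2)
  simp only [Finset.sum_range_one, Nat.cast_zero, zero_add, pow_one, div_one] at h2
  refine (funext fun j => ?_ : (fun j : ℕ => s ^ j / ((j : ℝ) + 2)) = _) ▸ h2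
  have : (0 : ℝ) < j + 2 := by positivity
  push_cast
  rw [show (j : ℝ) + 1 + 1 = j + 2 by ring, pow_add, pow_add]
  field_simp

/-- `(-log (1 - s) - s) / s² ≤ -log (s (1 - s))`. -/
theorem neg_log_sub_div_sq_le {s : ℝ} (hs0 : 0 < s) (hs1 : s < 1) :
    (-Real.log (1 - s) - s) / s ^ 2 ≤ -Real.log (s * (1 - s)) := by
  have h1s : 0 < 1 - s := by linarith
  rw [Real.log_mul hs0.ne' h1s.ne', div_le_iff₀ (by positivity)]
  set L := -Real.log (1 - s) with hL
  have hlogs : 1 - s ≤ -Real.log s := by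
    have := Real.log_le_sub_one_of_pos hs0; linarith
  have hL0 : 0 ≤ L := by
    rw [hL]; linarith [Real.log_nonpos h1s.le (by linarith)]
  have hLs : L * (1 - s) ≤ s - s ^ 2 / 2 := by
    have := Real.self_le_sinh_iff.mpr hL0
    rw [Real.sinh_eq, hL, neg_neg, Real.exp_log h1s, Real.exp_neg, Real.exp_log h1s, ← hL] at this
    calc L * (1 - s) ≤ ((1 - s)⁻¹ - (1 - s)) / 2 * (1 - s) := by gcongr
      _ = s - s ^ 2 / 2 := by field_simp; ring
  have h3 : L * (1 - s) * (1 + s) ≤ (s - s ^ 2 / 2) * (1 + s) := by gcongr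
  have h4 : (1 - s) * s ^ 2 ≤ -Real.log s * s ^ 2 := by gcongr
  have h5 : 0 ≤ (1 - s) * s ^ 2 := by positivity
  linarith

/-- Consecutive coefficients differ by `nbc w k · w/(k+1)`. This yields a factor `w`, needed for
small `w`, at the price of the logarithm `∑ s^j/(j+2)`. -/
theorem norm_tail_sub_tail_le_mul {w : ℂ} {N : ℝ} (hN : ∀ k, ‖nbc w (k + 1)‖ ≤ N) (i : ℕ) {s : ℝ}
    (hs0 : 0 < s) (hs1 : s < 1) :
    ‖tail w (i + 1) s - tail w (i + 2) s‖ ≤ N * (‖w‖ * -Real.log (s * (1 - s))) := by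
  have hs : ‖(s : ℂ)‖ < 1 := by rwa [Complex.norm_real, Real.norm_of_nonneg hs0.le]
  have hsC : (s : ℂ) ≠ 0 := by exact_mod_cast hs0.ne'
  have hN0 : 0 ≤ N := (norm_nonneg _).trans (hN 0)
  have h := (hasSum_tail w (i + 1) hsC hs).sub (hasSum_tail w (i + 2) hsC hs)
  have hg := (hasSum_pow_div_add_two hs0 hs1).mul_left (N * ‖w‖)
  have h1 : ‖tail w (i + 1) s - tail w (i + 2) s‖ ≤
      N * ‖w‖ * ((-Real.log (1 - s) - s) / s ^ 2) := by
    rw [← h.tsum_eq]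
    refine tsum_of_norm_bounded hg fun j => ?_
    have e : nbc w (i + 1 + j) * (s : ℂ) ^ j - nbc w (i + 2 + j) * (s : ℂ) ^ j =
        nbc w (i + j + 1) * w * ((s ^ j / ((i + j + 1 : ℕ) + 1) : ℝ) : ℂ) := by
      rw [show i + 2 + j = i + j + 1 + 1 by ring, show i + 1 + j = i + j + 1 by ring,
        nbc_succ w (i + j + 1)]
      push_cast; ring
    rw [e, norm_mul, norm_mul, Complex.norm_real, Real.norm_of_nonneg (by positivity)]
    refine mul_le_mul (mul_le_mul_of_nonneg_right (hN _) (norm_nonneg _)) ?_ (by positivity)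
      (by positivity)
    refine div_le_div_of_nonneg_left (by positivity) (by positivity) ?_
    push_cast
    linarith [i.cast_nonneg (α := ℝ)]
  calc _ ≤ _ := h1
    _ ≤ N * ‖w‖ * -Real.log (s * (1 - s)) := by
      gcongr; exact neg_log_sub_div_sq_le hs0 hs1
    _ = _ := by ring

/-- Both sides vanish at `L = 0`, and the norm of the derivative of `1 - exp(-wL)` equals the
derivative of the right side. -/
theorem norm_one_sub_exp_le {w : ℂ} (hw : 0 < w.re) {L : ℝ} (hL : 0 ≤ L) :
    ‖1 - Complex.exp (-(w * L))‖ ≤ ‖w‖ / w.re * (1 - Real.exp (-(w.re * L))) := by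
  have hd : ∀ τ : ℝ, HasDerivAt (fun τ : ℝ => 1 - Complex.exp (-(w * τ)))
      (w * Complex.exp (-(w * τ))) τ := fun τ => by
    have h1 : HasDerivAt (fun τ : ℂ => 1 - Complex.exp (-(w * τ)))
        (-(Complex.exp (-(w * τ)) * -(w * 1))) (τ : ℂ) :=
      (((hasDerivAt_id (τ : ℂ)).const_mul w).neg.cexp).const_sub 1
    convert h1.comp_ofReal using 1; ring
  have hB : ∀ τ : ℝ, HasDerivAt (fun τ : ℝ => ‖w‖ / w.re * (1 - Real.exp (-(w.re * τ))))
      (‖w‖ / w.re * -(Real.exp (-(w.re * τ)) * -(w.re * 1))) τ := fun τ =>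
    ((((hasDerivAt_id τ).const_mul w.re).neg.exp).const_sub 1).const_mul _
  refine image_norm_le_of_norm_deriv_right_le_deriv_boundary (a := 0) (b := L)
    (fun τ _ => (hd τ).continuousAt.continuousWithinAt) (fun τ _ => (hd τ).hasDerivWithinAt)
    (by simp) hB (fun τ _ => le_of_eq ?_) ⟨hL, le_rfl⟩
  rw [norm_mul, Complex.norm_exp]
  simp only [Complex.neg_re, Complex.mul_re, Complex.ofReal_re, Complex.ofReal_im, mul_zero,
    sub_zero]
  field_simp

theorem norm_tail_zero_sub_le {w : ℂ} (hw : 0 < w.re) (hw1 : w.re ≤ 1) {s : ℝ} (hs0 : 0 < s)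
    (hs1 : s < 1) : ‖tail w 0 s - tail w 1 s‖ ≤ ‖w‖ / w.re := by
  have h1s : 0 < 1 - s := by linarith
  have hsC : (s : ℂ) ≠ 0 := by exact_mod_cast hs0.ne'
  have h1C : (1 : ℂ) - s ≠ 0 := by exact_mod_cast h1s.ne'
  have e : tail w 0 s - tail w 1 s = (1 - (1 - (s : ℂ)) ^ w) / s := by
    rw [tail_sub_tail w 0 hsC, tail]
    simp only [Finset.sum_range_one, pow_zero, nbc_zero, pow_one, zero_add]
    rw [Complex.cpow_sub _ _ h1C, Complex.cpow_one]
    field_simp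
    ring
  have e2 : (1 - (s : ℂ)) ^ w = Complex.exp (-(w * ((-Real.log (1 - s) : ℝ) : ℂ))) := by
    rw [Complex.cpow_def_of_ne_zero h1C, Complex.ofReal_neg, Complex.ofReal_log h1s.le]
    push_cast; congr 1; ring
  have h := norm_one_sub_exp_le hw (L := -Real.log (1 - s))
    (by linarith [Real.log_nonpos h1s.le (by linarith)])
  have h3 : 1 - s ≤ Real.exp (-(w.re * -Real.log (1 - s))) := by
    calc 1 - s = Real.exp (Real.log (1 - s)) := (Real.exp_log h1s).symm
      _ ≤ _ := by
        rw [Real.exp_le_exp]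
        nlinarith [Real.log_nonpos h1s.le (by linarith)]
  rw [e, e2, norm_div, Complex.norm_real, Real.norm_of_nonneg hs0.le, div_le_iff₀ hs0]
  refine h.trans ?_
  gcongr
  linarith

/-- The sum of the differences of the tails, in the form used for the primitive. -/
theorem norm_mul_sum_tail_le {w : ℂ} (hw : 0 < w.re) (hw1 : w.re < 1) (m : ℕ) {s : ℝ} (hs0 : 0 < s)
    (hs1 : s < 1) :
    ‖w‖ * ((s * (1 - s)) ^ w.re +
      ∑ i ∈ Finset.range (m + 2), ‖tail w i s - tail w (i + 1) s‖) ≤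
      (Real.exp (Real.pi * |w.im|) - (s * (1 - s)) ^ w.re) * (‖w‖ + (m + 2) - w.re) := by
  set h := Real.exp (Real.pi * |w.im| / 2) with hh
  have hsq : Real.exp (Real.pi * |w.im|) = h ^ 2 := by
    rw [hh, ← Real.exp_nat_mul]; congr 1; push_cast; ring
  set N := min 1 ‖1 - w‖ * h with hN
  have hNb := norm_nbc_succ_le hw.le hw1.le
  have hh0 : 0 ≤ h := Real.exp_nonneg _
  have hh1 : 1 ≤ h := Real.one_le_exp (by positivity)
  have hss : 0 < s * (1 - s) := mul_pos hs0 (by linarith)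
  have hss4 : s * (1 - s) ≤ 1 / 4 := by nlinarith [sq_nonneg (s - 1 / 2)]
  set lam := -Real.log (s * (1 - s)) with hlam
  have hlam2 : 2 * Real.log 2 ≤ lam := by
    have := Real.log_le_log hss hss4
    rw [one_div, Real.log_inv, show (4 : ℝ) = 2 ^ 2 by norm_num, Real.log_pow] at this
    push_cast at this
    linarith
  set ρ := (s * (1 - s)) ^ w.re with hρ
  have hρe : ρ = Real.exp (-(w.re * lam)) := by
    rw [hρ, Real.rpow_def_of_pos hss, hlam]; congr 1; ring
  have hρ1 : ρ ≤ 1 := Real.rpow_le_one hss.le (by linarith) hw.le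
  have hW : ‖w‖ ^ 2 = w.re ^ 2 + |w.im| ^ 2 := by
    rw [sq_abs, ← Complex.normSq_eq_norm_sq, Complex.normSq_apply]; ring
  have hV : ‖1 - w‖ ^ 2 = (1 - w.re) ^ 2 + |w.im| ^ 2 := by
    rw [sq_abs, ← Complex.normSq_eq_norm_sq, Complex.normSq_apply]
    simp only [Complex.sub_re, Complex.one_re, Complex.sub_im, Complex.one_im]; ring
  have hNh : N ≤ h := mul_le_of_le_one_left hh0 (min_le_left _ _)
  have hNV : N ≤ ‖1 - w‖ * h := mul_le_mul_of_nonneg_right (min_le_right _ _) hh0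
  have hD : ∀ i : ℕ, ‖tail w (i + 1) s - tail w (i + 2) s‖ ≤ 2 * N := fun i =>
    (norm_tail_sub_tail_le hNb (hNb i) hs0 hs1).trans (le_of_eq (by ring))
  have hD' : ∀ i : ℕ, ‖tail w (i + 1) s - tail w (i + 2) s‖ ≤ N * (‖w‖ * lam) := fun i =>
    norm_tail_sub_tail_le_mul hNb i hs0 hs1
  have hbase := base_ineq hw hw1 (abs_nonneg w.im) (norm_nonneg w) hW (norm_nonneg (1 - w)) hV hh
    hlam2 hρe hNh hNV (norm_tail_sub_tail_le hNb (c := 1) (by simp) hs0 hs1)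
    (norm_tail_zero_sub_le hw hw1.le hs0 hs1) (hD 0) (hD' 0)
  have hslope : ∀ i : ℕ, ‖w‖ * ‖tail w (i + 1) s - tail w (i + 2) s‖ ≤ h ^ 2 - ρ := fun i =>
    slope_ineq hw hw1 (abs_nonneg w.im) (norm_nonneg w) hW (norm_nonneg (1 - w)) hV hh
      hlam2 hρe hNh hNV (hD i) (hD' i)
  -- The first two differences, together with `ρ`, are covered by `2(h² - ρ)`; every further one
  -- costs at most `h² - ρ`. Then `ω ≤ ‖w‖` gives the stated form.
  have key : ‖w‖ * (ρ + ∑ i ∈ Finset.range (m + 2), ‖tail w i s - tail w (i + 1) s‖) ≤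
      (m + 2) * (h ^ 2 - ρ) := by
    induction m with
    | zero =>
      rw [Finset.sum_range_succ, Finset.sum_range_one]
      simp only [Nat.cast_zero, zero_add]
      calc _ = _ := by rw [← add_assoc]
        _ ≤ _ := hbase
    | succ m ih =>
      rw [Finset.sum_range_succ, ← add_assoc, mul_add]
      have := hslope (m + 1)
      push_cast
      rw [show m + 1 + 1 = m + 2 by ring] at *
      linarith
  rw [hsq]
  refine key.trans ?_
  rw [mul_comm]
  refine mul_le_mul_of_nonneg_left ?_ (by nlinarith)
  linarith [(le_abs_self w.re).trans (Complex.abs_re_le_norm w)]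

end BiorthAsymp

end

noncomputable section

namespace BiorthAsymp

open Set Filter Topology

/-! ### The remainder integral on the lower lip of the cut -/

theorem hasDerivAt_beta_mul_powLower (n : ℕ) (b w ψ : ℂ) {u : ℝ} (hu : 0 < u)
    (hx : 1 + ψ * u ≠ 0) :
    HasDerivAt (fun v : ℝ => (1 - (v : ℂ)) ^ n * (v : ℂ) ^ b * powLower (1 + ψ * v) w)
      (-(n * (1 - (u : ℂ)) ^ (n - 1)) * (u : ℂ) ^ b * powLower (1 + ψ * u) w +
        (1 - (u : ℂ)) ^ n * (b * (u : ℂ) ^ (b - 1)) * powLower (1 + ψ * u) w +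
        (1 - (u : ℂ)) ^ n * (u : ℂ) ^ b * (w * ψ * powLower (1 + ψ * u) (w - 1))) u := by
  have h1 : HasDerivAt (fun v : ℝ => (1 - (v : ℂ)) ^ n) (n * (1 - (u : ℂ)) ^ (n - 1) * -1) u :=
    (((hasDerivAt_id (u : ℂ)).const_sub 1).pow n).comp_ofReal
  have h2 : HasDerivAt (fun v : ℝ => (v : ℂ) ^ b) (b * (u : ℂ) ^ (b - 1) * 1) u :=
    ((hasDerivAt_id (u : ℂ)).cpow_const (c := b)
      (Complex.ofReal_mem_slitPlane.mpr hu)).comp_ofReal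
  refine ((h1.mul h2).mul (hasDerivAt_powLower ψ w hx)).congr_deriv ?_
  simp only [Pi.mul_apply]
  ring

/-- The primitive of the leading part of the remainder on the lower lip. -/
def lipPrim (n p : ℕ) (a w : ℂ) (T u : ℝ) : ℂ :=
  -((1 - (u : ℂ)) ^ n * (u : ℂ) ^ (p + 2 + a) * powLower (1 + -(T : ℂ) * u) w /
    (w * ((max 1 (T * u) : ℝ) : ℂ) ^ (p + 3)))

theorem continuousOn_lipPrim (n p : ℕ) {a w : ℂ} (ha : 0 < a.re) (hw : 0 < w.re) (T : ℝ) :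
    ContinuousOn (lipPrim n p a w T) (Icc 0 1) := by
  have hw0 : w ≠ 0 := fun h => by simp [h] at hw
  have h1 : Continuous fun u : ℝ => (u : ℂ) ^ (p + 2 + a) :=
    Complex.continuous_ofReal_cpow_const (by simp; positivity)
  have h2 : Continuous fun u : ℝ => powLower (1 + -(T : ℂ) * u) w := by
    refine (continuousOn_powLower hw).comp_continuous (by fun_prop) fun u => ?_
    simp
  have h3 : ∀ u : ℝ, w * ((max 1 (T * u) : ℝ) : ℂ) ^ (p + 3) ≠ 0 := fun u => by
    have : 0 < max 1 (T * u) := lt_max_of_lt_left one_pos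
    exact mul_ne_zero hw0 (pow_ne_zero _ (by exact_mod_cast this.ne'))
  refine Continuous.continuousOn (Continuous.neg (Continuous.div ?_ ?_ h3))
  · exact ((by fun_prop : Continuous fun u : ℝ => (1 - (u : ℂ)) ^ n).mul h1).mul h2
  · exact continuous_const.mul ((Complex.continuous_ofReal.comp (by fun_prop)).pow _)

/-- The majorant of the difference between the remainder and the derivative of `lipPrim`. -/
def lipMaj (n : ℕ) (Q c C : ℝ) (u : ℝ) : ℝ :=
  c * (n * ((1 - u) ^ (n - 1) * u ^ (Q + 1 - 1)) + C * ((1 - u) ^ n * u ^ (Q - 1)))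

theorem intervalIntegrable_lipMaj (n : ℕ) {Q : ℝ} (hQ : 0 < Q) (c C : ℝ) :
    IntervalIntegrable (lipMaj n Q c C) MeasureTheory.volume 0 1 :=
  (((intervalIntegrable_rbeta (n - 1) (X := Q + 1) (by linarith)).const_mul _).add
    ((intervalIntegrable_rbeta n hQ).const_mul _)).const_mul _

/-- Since `n B(n, Q+1) = Q B(n+1, Q)` for `n ≥ 1`, the first summand exactly compensates the `-Q` in
the second. For `n = 0` a defect `c` remains, which will cancel the value of the primitive at `u =
1`. -/
theorem integral_lipMaj (n : ℕ) {Q : ℝ} (hQ : 0 < Q) (c C : ℝ) :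
    ∫ u in (0 : ℝ)..1, lipMaj n Q c (C - Q) u = c * C * rbeta n Q - if n = 0 then c else 0 := by
  have h1 : IntervalIntegrable (fun u : ℝ => (n : ℝ) * ((1 - u) ^ (n - 1) * u ^ (Q + 1 - 1)))
      MeasureTheory.volume 0 1 :=
    (intervalIntegrable_rbeta (n - 1) (X := Q + 1) (by linarith)).const_mul _
  have h2 : IntervalIntegrable (fun u : ℝ => (C - Q) * ((1 - u) ^ n * u ^ (Q - 1)))
      MeasureTheory.volume 0 1 := (intervalIntegrable_rbeta n hQ).const_mul _
  have h3 : ∫ u in (0 : ℝ)..1, lipMaj n Q c (C - Q) u =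
      c * (n * rbeta (n - 1) (Q + 1) + (C - Q) * rbeta n Q) := by
    simp only [lipMaj]
    rw [intervalIntegral.integral_const_mul, intervalIntegral.integral_add h1 h2,
      intervalIntegral.integral_const_mul, intervalIntegral.integral_const_mul, rbeta, rbeta]
  have h4 : n * rbeta (n - 1) (Q + 1) = Q * rbeta n Q - if n = 0 then 1 else 0 := by
    rw [rbeta_eq _ (by linarith), rbeta_eq n hQ, Real.Gamma_add_one hQ.ne']
    have hG := (Real.Gamma_pos_of_pos hQ).ne'
    cases n with
    | zero =>
      simp only [Nat.cast_zero, zero_mul, zero_add, Nat.factorial_zero, Nat.cast_one, one_mul,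
        if_true]
      rw [add_comm, Real.Gamma_add_one hQ.ne']
      field_simp
      ring
    | succ n =>
      rw [if_neg n.succ_ne_zero, Nat.add_sub_cancel, Nat.factorial_succ]
      push_cast
      rw [show (n : ℝ) + 1 + (Q + 1) = n + 1 + 1 + Q by ring]
      ring
  rw [h3, h4]
  split_ifs <;> ring

theorem norm_sub_le_lipMaj (n : ℕ) {Q W c C ε u : ℝ} {E Z Z' : ℂ} (hu : 0 < u) (hu1 : u < 1)
    (hW : 0 < W) (hE : ‖E‖ = u ^ (Q - 1) * ε) (hZ : W * (ε * ‖Z‖) ≤ c * C)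
    (hZ' : W * (ε * ‖Z'‖) ≤ c) :
    ‖(1 - (u : ℂ)) ^ n * E * Z - n * (1 - (u : ℂ)) ^ (n - 1) * u * E * Z'‖ ≤
      lipMaj n Q (c / W) C u := by
  have ht : ‖(1 : ℂ) - u‖ = 1 - u := by
    rw [show (1 : ℂ) - u = ((1 - u : ℝ) : ℂ) by push_cast; rfl, Complex.norm_real,
      Real.norm_of_nonneg (by linarith)]
  refine (norm_sub_le _ _).trans ?_
  simp only [norm_mul, norm_pow, ht, Complex.norm_natCast, Complex.norm_real,
    Real.norm_of_nonneg hu.le, hE]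
  have h1 : ε * ‖Z‖ ≤ c / W * C := by
    rw [div_mul_eq_mul_div, le_div_iff₀ hW]; linarith
  have h2 : ε * ‖Z'‖ ≤ c / W := by
    rw [le_div_iff₀ hW]; linarith
  have hq : 0 < u ^ (Q - 1) := Real.rpow_pos_of_pos hu _
  have ht0 : 0 ≤ 1 - u := by linarith
  have e1 : u ^ (Q + 1 - 1) = u * u ^ (Q - 1) := by
    rw [add_sub_cancel_right, Real.rpow_sub_one hu.ne']; field_simp
  rw [lipMaj, e1]
  calc _ = ((1 - u) ^ n * u ^ (Q - 1)) * (ε * ‖Z‖) +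
        (n * (1 - u) ^ (n - 1) * (u * u ^ (Q - 1))) * (ε * ‖Z'‖) := by ring
    _ ≤ ((1 - u) ^ n * u ^ (Q - 1)) * (c / W * C) +
        (n * (1 - u) ^ (n - 1) * (u * u ^ (Q - 1))) * (c / W) := by gcongr
    _ = _ := by ring

theorem neg_one_pow_mul_r (p : ℕ) {γ : ℂ} (hγ : -1 < γ.re) (T : ℂ) (u : ℂ) :
    (-1) ^ (p + 2) * r (p + 1) u (-T) γ = (powLower (1 + -T * u) γ -
      ∑ k ∈ Finset.range (p + 2), nbc (γ + 1) k * (T * u) ^ k) / (T * u) ^ (p + 2) := by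
  rw [r_eq_rr _ hγ, rr, show -T * u = -(T * u) by ring]
  have e : ∀ k, bc γ k * (-(T * u)) ^ k = nbc (γ + 1) k * (T * u) ^ k := fun k => by
    rw [neg_pow, ← mul_assoc, mul_comm (bc γ k), neg_one_pow_mul_bc]
  simp only [e]
  rw [neg_pow (T * u) (p + 1 + 1), show p + 1 + 1 = p + 2 by ring]
  have h1 : ((-1 : ℂ) ^ (p + 2)) ≠ 0 := pow_ne_zero _ (by norm_num)
  field_simp

/-- Telescoping from `tail w 0 s = (1-s)^(w-1)`, with `(1-s)^(w-1) - s(1-s)^(w-1) = (1-s)^w`. -/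
theorem norm_tail_sub_mul_le (w : ℂ) (P : ℕ) {s : ℝ} (hs1 : s < 1) :
    ‖tail w P s - s * (1 - (s : ℂ)) ^ (w - 1)‖ ≤ (1 - s) ^ w.re +
      ∑ i ∈ Finset.range P, ‖tail w i s - tail w (i + 1) s‖ := by
  have h1s : 0 < 1 - s := by linarith
  have h1C : (1 : ℂ) - s ≠ 0 := by exact_mod_cast h1s.ne'
  have h1 := Finset.sum_range_sub' (fun i => tail w i (s : ℂ)) P
  have e : tail w P s - s * (1 - (s : ℂ)) ^ (w - 1) = (1 - (s : ℂ)) ^ w -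
      ∑ i ∈ Finset.range P, (tail w i s - tail w (i + 1) s) := by
    rw [h1, tail_zero]
    have : (1 - (s : ℂ)) ^ w = (1 - s) * (1 - (s : ℂ)) ^ (w - 1) := by
      rw [Complex.cpow_sub _ _ h1C, Complex.cpow_one]; field_simp
    rw [this]; ring
  rw [e]
  refine (norm_sub_le _ _).trans (add_le_add (le_of_eq ?_) (norm_sum_le _ _))
  rw [show (1 : ℂ) - s = ((1 - s : ℝ) : ℂ) by push_cast; rfl, Complex.norm_cpow_eq_rpow_re_of_pos h1s]

theorem norm_sum_nbc_le {w : ℂ} (h0 : 0 ≤ w.re) (h1 : w.re ≤ 1) (m : ℕ) {s : ℝ} (hs : 1 ≤ s) :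
    ‖(∑ k ∈ Finset.range (m + 1), nbc w k * (s : ℂ) ^ k) / (s : ℂ) ^ (m + 1)‖ ≤
      1 + m * (‖1 - w‖ * Real.exp (Real.pi * |w.im| / 2)) := by
  have hs0 : 0 < s := by linarith
  set N := ‖1 - w‖ * Real.exp (Real.pi * |w.im| / 2)
  have hN : ∀ k, ‖nbc w (k + 1)‖ ≤ N := fun k => (norm_nbc_succ_le h0 h1 k).trans
    (mul_le_mul_of_nonneg_right (min_le_right _ _) (Real.exp_nonneg _))
  rw [norm_div, norm_pow, Complex.norm_real, Real.norm_of_nonneg hs0.le, div_le_iff₀ (by positivity),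
    Finset.sum_range_succ']
  refine (norm_add_le _ _).trans ?_
  have h2 : ‖∑ k ∈ Finset.range m, nbc w (k + 1) * (s : ℂ) ^ (k + 1)‖ ≤ m * (N * s ^ (m + 1)) := by
    refine (norm_sum_le _ _).trans ((Finset.sum_le_sum (g := fun _ => N * s ^ (m + 1))
      fun k hk => ?_).trans (le_of_eq (by simp)))
    rw [norm_mul, norm_pow, Complex.norm_real, Real.norm_of_nonneg hs0.le]
    refine mul_le_mul (hN k) (pow_le_pow_right₀ hs ?_) (by positivity)
      ((norm_nonneg _).trans (hN k))
    have := Finset.mem_range.mp hk; omega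
  have h3 : (1 : ℝ) ≤ s ^ (m + 1) := one_le_pow₀ hs
  simp only [nbc_zero, pow_zero, mul_one, norm_one]
  linarith

/-- The quotient `(s-1)/s²` is at most `1/4`, with equality at `s = 2`. -/
theorem sub_one_rpow_div_le {ω s : ℝ} (h0 : 0 ≤ ω) (h1 : ω ≤ 1) (hs : 1 ≤ s) {m : ℕ} (hm : 2 ≤ m) :
    (s - 1) ^ ω / s ^ m ≤ 1 - 3 / 4 * ω := by
  have hs0 : 0 < s := by linarith
  refine le_trans ?_ (quarter_rpow_le h0 h1)
  have h2 : (s - 1) / s ^ 2 ≤ 1 / 4 := by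
    rw [div_le_iff₀ (by positivity)]; nlinarith [sq_nonneg (s - 2)]
  have h3 : 0 ≤ (s - 1) / s ^ 2 := div_nonneg (by linarith) (by positivity)
  have h4 : (s ^ 2) ^ ω ≤ s ^ m := by
    have h5 : (1 : ℝ) ≤ s ^ 2 := one_le_pow₀ hs
    calc (s ^ 2) ^ ω ≤ (s ^ 2) ^ (1 : ℝ) := Real.rpow_le_rpow_of_exponent_le h5 h1
      _ = s ^ 2 := Real.rpow_one _
      _ ≤ s ^ m := pow_le_pow_right₀ hs hm
  calc (s - 1) ^ ω / s ^ m ≤ (s - 1) ^ ω / (s ^ 2) ^ ω := by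
        refine div_le_div_of_nonneg_left (Real.rpow_nonneg (by linarith) _)
          (Real.rpow_pos_of_pos (by positivity) _) h4
    _ = ((s - 1) / s ^ 2) ^ ω := (Real.div_rpow (by linarith) (by positivity) _).symm
    _ ≤ _ := Real.rpow_le_rpow h3 h2 h0

theorem norm_ofReal_cpow_eq_mul (p : ℕ) (a : ℂ) (ω : ℝ) {u : ℝ} (hu : 0 < u) :
    ‖(u : ℂ) ^ ((p : ℂ) + 1 + a)‖ = u ^ (p + 2 + a.re - ω - 1) * u ^ ω := by
  rw [Complex.norm_cpow_eq_rpow_re_of_pos hu, ← Real.rpow_add hu]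
  congr 1
  simp; ring

theorem sq_norm_eq_abs (w : ℂ) : ‖w‖ ^ 2 = w.re ^ 2 + |w.im| ^ 2 := by
  rw [sq_abs, ← Complex.normSq_eq_norm_sq, Complex.normSq_apply]; ring

/-- With `s = T u < 1`, the remainder is `tail w (p+2) s`, and the derivative of the primitive
contributes `s (1-s)^(w-1)`, so the singularity at `s = 1` cancels. What is left is a sum of tail
differences and terms with `(1-s)^w / w`, controlled by `norm_mul_sum_tail_le`. -/
theorem lip_inner (n p : ℕ) {a w : ℂ} (ha : 0 < a.re) (hw : 0 < w.re) (hw1 : w.re < 1) {T u : ℝ}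
    (hT : 1 ≤ T) (hu : 0 < u) (hu1 : u < 1) (hs1 : T * u < 1) :
    DifferentiableAt ℝ (lipPrim n p a w T) u ∧
    ‖(-1) ^ (p + 2) * ((1 - (u : ℂ)) ^ n * (u : ℂ) ^ ((p + 1 : ℕ) + a) *
        r (p + 1) u (-(T : ℂ)) (w - 1)) - deriv (lipPrim n p a w T) u‖ ≤
      lipMaj n (p + 2 + a.re - w.re) (Real.exp (Real.pi * |w.im|) / ‖w‖)
        (‖w‖ + 2 * ‖(p : ℂ) + 2 + a - w‖ - (p + 2 + a.re - w.re)) u := by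
  have hw0 : w ≠ 0 := fun h => by simp [h] at hw
  have hW : 0 < ‖w‖ := norm_pos_iff.mpr hw0
  have huC : (u : ℂ) ≠ 0 := by exact_mod_cast hu.ne'
  have hTC : (T : ℂ) ≠ 0 := by exact_mod_cast (by linarith : T ≠ 0)
  set s := T * u with hs
  have hs0 : 0 < s := by positivity
  have h1s : 0 < 1 - s := by linarith
  have hxs : 1 + -(T : ℂ) * u = ((1 - s : ℝ) : ℂ) := by rw [hs]; push_cast; ring
  have hx : 1 + -(T : ℂ) * u ≠ 0 := by rw [hxs]; exact_mod_cast h1s.ne'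
  have hslit : ((1 - s : ℝ) : ℂ) ∈ Complex.slitPlane := Complex.ofReal_mem_slitPlane.mpr h1s
  set E := (u : ℂ) ^ ((p : ℂ) + 1 + a) with hE
  have hEu : (u : ℂ) ^ ((p : ℂ) + 2 + a) = u * E := by
    rw [hE, show (p : ℂ) + 2 + a = p + 1 + a + 1 by ring, Complex.cpow_add _ _ huC,
      Complex.cpow_one, mul_comm]
  set L := powLower (1 + -(T : ℂ) * u) (w - 1) with hL
  have hLs : L = (1 - (s : ℂ)) ^ (w - 1) := by
    rw [hL, hxs, powLower_eq_cpow hslit]; push_cast; rfl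
  set v := powLower (1 + -(T : ℂ) * u) w with hv
  have hvL : v = (1 + -(T : ℂ) * u) * L := by
    rw [hv, hL, ← powLower_add_one hx, sub_add_cancel]
  have hvn : ‖v‖ = (1 - s) ^ w.re := by
    rw [hv, hxs, powLower_eq_cpow hslit, Complex.norm_cpow_eq_rpow_re_of_pos h1s]
  have hd : HasDerivAt (lipPrim n p a w T) _ u :=
    ((hasDerivAt_beta_mul_powLower n (p + 2 + a) w (-T) hu hx).div_const w).neg.congr_of_eventuallyEq
      (by
        have : ∀ᶠ y : ℝ in 𝓝 u, T * y < 1 :=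
          (continuous_const.mul continuous_id).continuousAt.eventually_lt_const hs1
        filter_upwards [this] with y hy
        simp only [lipPrim, Pi.neg_apply]
        rw [max_eq_left hy.le]; simp)
  refine ⟨hd.differentiableAt, ?_⟩
  rw [hd.deriv]
  have hr := neg_one_pow_mul_r p (γ := w - 1) (by simpa using hw) T u
  rw [sub_add_cancel, ← hL, hLs] at hr
  have hr' : (-1) ^ (p + 2) * r (p + 1) u (-(T : ℂ)) (w - 1) = tail w (p + 2) s := by
    rw [hr, tail, hs]; push_cast; rfl
  set Z := tail w (p + 2) s - s * (1 - (s : ℂ)) ^ (w - 1) + (p + 2 + a) * v / w with hZ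
  have e : (-1) ^ (p + 2) * ((1 - (u : ℂ)) ^ n * (u : ℂ) ^ ((p + 1 : ℕ) + a) *
        r (p + 1) u (-(T : ℂ)) (w - 1)) = (1 - (u : ℂ)) ^ n * E * tail w (p + 2) s := by
    rw [← hr', hE]; push_cast; ring
  have e2 : (p : ℂ) + 2 + a - 1 = p + 1 + a := by ring
  rw [e, e2, ← hE, hEu, ← hL, ← hv]
  have hA := (norm_sub_le_lipMaj n (E := E) (Z := Z) (Z' := v / w) hu hu1 hW
    (norm_ofReal_cpow_eq_mul p a w.re hu) (c := Real.exp (Real.pi * |w.im|))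
    (C := ‖w‖ + 2 * ‖(p : ℂ) + 2 + a - w‖ - (p + 2 + a.re - w.re)) ?_ ?_)
  · convert hA using 2
    rw [hZ, ← hLs, hs]
    push_cast
    field_simp
    ring
  · have hstar := norm_mul_sum_tail_le hw hw1 p hs0 hs1
    have htail := norm_tail_sub_mul_le w (p + 2) hs1
    set D := ∑ i ∈ Finset.range (p + 2), ‖tail w i s - tail w (i + 1) s‖
    set ρ := (s * (1 - s)) ^ w.re with hρ
    set c := Real.exp (Real.pi * |w.im|)
    set A := ‖(p : ℂ) + 2 + a - w‖ with hA'
    have hD0 : 0 ≤ D := Finset.sum_nonneg fun _ _ => norm_nonneg _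
    have hu0 : 0 ≤ u ^ w.re := Real.rpow_nonneg hu.le _
    have hu1' : u ^ w.re ≤ 1 := Real.rpow_le_one hu.le hu1.le hw.le
    have hus : u ≤ s := by rw [hs]; exact le_mul_of_one_le_left hu.le hT
    -- `T ≥ 1` gives `u ≤ s`, so the spare factor `u^ω` of the weight turns `(1-s)^ω` into
    -- `(s(1-s))^ω`.
    have hρv : u ^ w.re * (1 - s) ^ w.re ≤ ρ := by
      rw [hρ, Real.mul_rpow hs0.le h1s.le]
      exact mul_le_mul_of_nonneg_right (Real.rpow_le_rpow hu.le hus hw.le)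
        (Real.rpow_nonneg h1s.le _)
    have hρ1 : ρ ≤ 1 := Real.rpow_le_one (by positivity) (by nlinarith) hw.le
    have hc1 : 1 ≤ c := Real.one_le_exp (by positivity)
    have hPa : ‖(p : ℂ) + 2 + a‖ ≤ A + ‖w‖ := by
      have := norm_add_le ((p : ℂ) + 2 + a - w) w
      rwa [sub_add_cancel] at this
    have hQA : (p : ℝ) + 2 + a.re - w.re ≤ A := by
      have := (le_abs_self _).trans (Complex.abs_re_le_norm ((p : ℂ) + 2 + a - w))
      simpa using this
    have hZn : ‖w‖ * ‖Z‖ ≤ ‖w‖ * ((1 - s) ^ w.re + D) + ‖(p : ℂ) + 2 + a‖ * (1 - s) ^ w.re := by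
      have h1 : ‖Z‖ ≤ ((1 - s) ^ w.re + D) + ‖(p : ℂ) + 2 + a‖ * (1 - s) ^ w.re / ‖w‖ := by
        refine (norm_add_le _ _).trans (add_le_add htail (le_of_eq ?_))
        rw [norm_div, norm_mul, hvn]
      calc _ ≤ ‖w‖ * (((1 - s) ^ w.re + D) + ‖(p : ℂ) + 2 + a‖ * (1 - s) ^ w.re / ‖w‖) := by gcongr
        _ = _ := by field_simp
    calc ‖w‖ * (u ^ w.re * ‖Z‖) = u ^ w.re * (‖w‖ * ‖Z‖) := by ring
      _ ≤ u ^ w.re * (‖w‖ * ((1 - s) ^ w.re + D) + ‖(p : ℂ) + 2 + a‖ * (1 - s) ^ w.re) := by gcongr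
      _ = ‖w‖ * (u ^ w.re * (1 - s) ^ w.re) + ‖w‖ * (u ^ w.re * D) +
          ‖(p : ℂ) + 2 + a‖ * (u ^ w.re * (1 - s) ^ w.re) := by ring
      _ ≤ ‖w‖ * ρ + ‖w‖ * (1 * D) + (A + ‖w‖) * ρ := by gcongr
      _ = ‖w‖ * (ρ + D) + (A + ‖w‖) * ρ := by ring
      _ ≤ (c - ρ) * (‖w‖ + (p + 2) - w.re) + (A + ‖w‖) * ρ := by gcongr
      _ ≤ c * (‖w‖ + 2 * A - (p + 2 + a.re - w.re)) := by
        have h1 : 0 ≤ (c - ρ) * (A - (p + 2 - w.re)) := mul_nonneg (by linarith) (by linarith)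
        have h2 : 0 ≤ c * (A - (p + 2 + a.re - w.re)) := mul_nonneg (by linarith) (by linarith)
        linarith
  · rw [norm_div, hvn]
    calc ‖w‖ * (u ^ w.re * ((1 - s) ^ w.re / ‖w‖)) = u ^ w.re * (1 - s) ^ w.re := by field_simp
      _ ≤ 1 * 1 := mul_le_mul (Real.rpow_le_one hu.le hu1.le hw.le)
        (Real.rpow_le_one h1s.le (by linarith) hw.le) (Real.rpow_nonneg h1s.le _) zero_le_one
      _ ≤ _ := by rw [one_mul]; exact Real.one_le_exp (by positivity)

/-- For `s = T u > 1` the primitive is `-(1-u)^n u^(a-1) (1-Tu)^w / (w T^(p+3))`, with the lower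
power. Its derivative reproduces the whole term with exponent `w - 1`; only the subtracted
polynomial and terms with exponent `w` remain, and `outer_ineq` bounds them. -/
theorem lip_outer (n p : ℕ) {a w : ℂ} (ha : 0 < a.re) (hw : 0 < w.re) (hw1 : w.re < 1) {T u : ℝ}
    (hT : 1 ≤ T) (hu : 0 < u) (hu1 : u < 1) (hs1 : 1 < T * u) :
    DifferentiableAt ℝ (lipPrim n p a w T) u ∧
    ‖(-1) ^ (p + 2) * ((1 - (u : ℂ)) ^ n * (u : ℂ) ^ ((p + 1 : ℕ) + a) *
        r (p + 1) u (-(T : ℂ)) (w - 1)) - deriv (lipPrim n p a w T) u‖ ≤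
      lipMaj n (p + 2 + a.re - w.re) (Real.exp (Real.pi * |w.im|) / ‖w‖)
        (‖w‖ + 2 * ‖(p : ℂ) + 2 + a - w‖ - (p + 2 + a.re - w.re)) u := by
  have hw0 : w ≠ 0 := fun h => by simp [h] at hw
  have hW : 0 < ‖w‖ := norm_pos_iff.mpr hw0
  have huC : (u : ℂ) ≠ 0 := by exact_mod_cast hu.ne'
  have hTC : (T : ℂ) ≠ 0 := by exact_mod_cast (by linarith : T ≠ 0)
  set s := T * u with hs
  have hs0 : 0 < s := by positivity
  have hsC : (s : ℂ) ≠ 0 := by exact_mod_cast hs0.ne'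
  have hsTu : (s : ℂ) = T * u := by rw [hs]; push_cast; rfl
  have h1s : 0 < s - 1 := by linarith
  have hxs : 1 + -(T : ℂ) * u = -((s - 1 : ℝ) : ℂ) := by rw [hs]; push_cast; ring
  have hx : 1 + -(T : ℂ) * u ≠ 0 := by
    rw [hxs, neg_ne_zero]; exact_mod_cast h1s.ne'
  set E := (u : ℂ) ^ ((p : ℂ) + 1 + a) with hE
  have hpow : ∀ y : ℝ, 0 < y → (y : ℂ) ^ ((p : ℂ) + 2 + a) = (y : ℂ) ^ (a - 1) * (y : ℂ) ^ (p + 3) := by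
    intro y hy
    have hyC : (y : ℂ) ≠ 0 := by exact_mod_cast hy.ne'
    rw [← Complex.cpow_natCast, ← Complex.cpow_add _ _ hyC]
    congr 1; push_cast; ring
  have hE1 : E = (u : ℂ) ^ (a - 1 - 1) * (u : ℂ) ^ (p + 3) := by
    rw [hE, ← Complex.cpow_natCast, ← Complex.cpow_add _ _ huC]
    congr 1; push_cast; ring
  have hE2 : (u : ℂ) ^ (a - 1) = (u : ℂ) ^ (a - 1 - 1) * u := by
    nth_rewrite 3 [← Complex.cpow_one (u : ℂ)]
    rw [← Complex.cpow_add _ _ huC]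
    congr 1; ring
  set e0 := (u : ℂ) ^ (a - 1 - 1)
  set L := powLower (1 + -(T : ℂ) * u) (w - 1) with hL
  set v := powLower (1 + -(T : ℂ) * u) w with hv
  have hvn : ‖v‖ ≤ Real.exp (Real.pi * |w.im|) * (s - 1) ^ w.re := by
    refine (norm_powLower_le _ _).trans (le_of_eq ?_)
    rw [hxs, norm_neg, Complex.norm_real, Real.norm_of_nonneg h1s.le]
  have hd : HasDerivAt (lipPrim n p a w T) _ u :=
    ((hasDerivAt_beta_mul_powLower n (a - 1) w (-T) hu hx).div_const
      (w * (T : ℂ) ^ (p + 3))).neg.congr_of_eventuallyEq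
      (by
        have : ∀ᶠ y : ℝ in 𝓝 u, 1 < T * y :=
          (continuous_const.mul continuous_id).continuousAt.eventually_const_lt hs1
        filter_upwards [this, eventually_gt_nhds hu] with y hy hy0
        have hyC : (y : ℂ) ≠ 0 := by exact_mod_cast hy0.ne'
        simp only [lipPrim, Pi.neg_apply]
        rw [max_eq_right hy.le, hpow y hy0]
        push_cast
        rw [mul_pow]
        field_simp)
  refine ⟨hd.differentiableAt, ?_⟩
  rw [hd.deriv]
  have hr := neg_one_pow_mul_r p (γ := w - 1) (by simpa using hw) T u
  rw [sub_add_cancel, ← hL, ← hsTu] at hr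
  set S := ∑ k ∈ Finset.range (p + 2), nbc w k * (s : ℂ) ^ k with hS
  set Z := -(S / (s : ℂ) ^ (p + 2)) + (a - 1) * v / (w * (s : ℂ) ^ (p + 3)) with hZ
  have e : (-1) ^ (p + 2) * ((1 - (u : ℂ)) ^ n * (u : ℂ) ^ ((p + 1 : ℕ) + a) *
        r (p + 1) u (-(T : ℂ)) (w - 1)) = (1 - (u : ℂ)) ^ n * E * ((L - S) / (s : ℂ) ^ (p + 2)) := by
    rw [← hr, hE]; push_cast; ring
  rw [e, hE2, ← hL, ← hv]
  have hρ := sub_one_rpow_div_le hw.le hw1.le hs1.le (m := p + 3) (by omega)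
  have hρ0 : 0 ≤ (s - 1) ^ w.re / s ^ (p + 3) := by positivity
  set ρ := (s - 1) ^ w.re / s ^ (p + 3) with hρd
  set c := Real.exp (Real.pi * |w.im|) with hc
  have hc0 : 0 < c := Real.exp_pos _
  have hvs : ‖v‖ / s ^ (p + 3) ≤ c * ρ := by
    rw [hρd, ← mul_div_assoc]; gcongr
  have hu0 : 0 ≤ u ^ w.re := Real.rpow_nonneg hu.le _
  have hu1' : u ^ w.re ≤ 1 := Real.rpow_le_one hu.le hu1.le hw.le
  have hA := (norm_sub_le_lipMaj n (E := E) (Z := Z) (Z' := v / (w * (s : ℂ) ^ (p + 3))) hu hu1 hW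
    (norm_ofReal_cpow_eq_mul p a w.re hu) (c := c)
    (C := ‖w‖ + 2 * ‖(p : ℂ) + 2 + a - w‖ - (p + 2 + a.re - w.re)) ?_ ?_)
  · convert hA using 2
    rw [hZ, hE1, hsTu]
    field_simp
    ring
  · set A := ‖(p : ℂ) + 2 + a - w‖ with hA'
    set N := ‖1 - w‖ * Real.exp (Real.pi * |w.im| / 2) with hN
    have hcsq : c = Real.exp (Real.pi * |w.im| / 2) ^ 2 := by
      rw [hc, ← Real.exp_nat_mul]; congr 1; push_cast; ring
    have hV : ‖1 - w‖ ^ 2 = (1 - w.re) ^ 2 + |w.im| ^ 2 := by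
      rw [sq_norm_eq_abs]; simp
    have hA2 : A ^ 2 = ((p + 2 : ℝ) + a.re - w.re) ^ 2 + (a.im - w.im) ^ 2 := by
      rw [hA', sq_norm_eq_abs, sq_abs]; simp
    have hM2 : ‖a - 1‖ ^ 2 = (a.re - 1) ^ 2 + a.im ^ 2 := by
      rw [sq_norm_eq_abs, sq_abs]; simp
    have hη : |a.im| ≤ |a.im - w.im| + |w.im| := by
      have := abs_add_le (a.im - w.im) w.im
      rwa [sub_add_cancel] at this
    have hout := outer_ineq hw hw1 (abs_nonneg w.im) (norm_nonneg w) (sq_norm_eq_abs w) hV rfl ha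
      (P := p + 2) (by linarith [p.cast_nonneg (α := ℝ)]) hρ0 hρ hη (norm_nonneg _) hA2 hM2
    rw [← hcsq, ← hN] at hout
    have hSn := norm_sum_nbc_le hw.le hw1.le (p + 1) hs1.le
    have hZn : ‖w‖ * ‖Z‖ ≤ ‖w‖ * (1 + (p + 1) * N) + ‖a - 1‖ * (‖v‖ / s ^ (p + 3)) := by
      have h1 : ‖Z‖ ≤ (1 + (p + 1) * N) + ‖a - 1‖ * (‖v‖ / s ^ (p + 3)) / ‖w‖ := by
        refine (norm_add_le _ _).trans (add_le_add ?_ (le_of_eq ?_))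
        · rw [norm_neg]; push_cast at hSn; exact hSn
        · rw [norm_div, norm_mul, norm_mul, norm_pow, Complex.norm_real,
            Real.norm_of_nonneg hs0.le]
          field_simp
      calc _ ≤ ‖w‖ * ((1 + (p + 1) * N) + ‖a - 1‖ * (‖v‖ / s ^ (p + 3)) / ‖w‖) := by gcongr
        _ = _ := by field_simp
    calc ‖w‖ * (u ^ w.re * ‖Z‖) = u ^ w.re * (‖w‖ * ‖Z‖) := by ring
      _ ≤ 1 * (‖w‖ * ‖Z‖) := by gcongr
      _ ≤ ‖w‖ * (1 + (p + 1) * N) + ‖a - 1‖ * (c * ρ) := by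
        rw [one_mul]; exact hZn.trans (by gcongr)
      _ = c * (ρ * ‖a - 1‖) + ‖w‖ * (1 + ((p + 2 : ℝ) - 1) * N) := by ring
      _ ≤ _ := hout
  · rw [norm_div, norm_mul, norm_pow, Complex.norm_real, Real.norm_of_nonneg hs0.le]
    calc ‖w‖ * (u ^ w.re * (‖v‖ / (‖w‖ * s ^ (p + 3)))) = u ^ w.re * (‖v‖ / s ^ (p + 3)) := by
          field_simp
      _ ≤ 1 * (c * 1) := by
        refine mul_le_mul hu1' (hvs.trans (mul_le_mul_of_nonneg_left (by linarith) hc0.le))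
          (by positivity) zero_le_one
      _ = c := by ring

theorem norm_lipPrim_one_le (n p : ℕ) (a : ℂ) {w : ℂ} (hw : 0 < w.re) (hw1 : w.re < 1) {T : ℝ}
    (hT : 1 ≤ T) :
    ‖lipPrim n p a w T 1‖ ≤ if n = 0 then Real.exp (Real.pi * |w.im|) / ‖w‖ else 0 := by
  have hw0 : w ≠ 0 := fun h => by simp [h] at hw
  have hW : 0 < ‖w‖ := norm_pos_iff.mpr hw0
  have hT0 : 0 < T := by linarith
  split_ifs with hn
  · have h1 : ‖powLower (1 + -(T : ℂ) * (1 : ℝ)) w‖ ≤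
        Real.exp (Real.pi * |w.im|) * (T - 1) ^ w.re := by
      refine (norm_powLower_le _ _).trans (le_of_eq ?_)
      rw [show 1 + -(T : ℂ) * (1 : ℝ) = -((T - 1 : ℝ) : ℂ) by push_cast; ring, norm_neg,
        Complex.norm_real, Real.norm_of_nonneg (by linarith)]
    have h2 := sub_one_rpow_div_le hw.le hw1.le hT (m := p + 3) (by omega)
    rw [lipPrim, norm_neg, norm_div, norm_mul, hn, mul_one, max_eq_right hT, norm_mul w, norm_mul,
      norm_pow, norm_pow, Complex.norm_real T, Real.norm_of_nonneg hT0.le]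
    simp only [pow_zero, Complex.ofReal_one, Complex.one_cpow, mul_one, norm_one, one_mul]
    simp only [Complex.ofReal_one, mul_one] at h1
    calc _ ≤ Real.exp (Real.pi * |w.im|) * (T - 1) ^ w.re / (‖w‖ * T ^ (p + 3)) := by gcongr
      _ = Real.exp (Real.pi * |w.im|) / ‖w‖ * ((T - 1) ^ w.re / T ^ (p + 3)) := by field_simp
      _ ≤ Real.exp (Real.pi * |w.im|) / ‖w‖ * 1 := by gcongr; linarith
      _ = _ := mul_one _
  · simp [lipPrim, hn]

/-- The primitive may fail to be differentiable only at `u = 1/T`. For `n = 0` its boundary value is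
offset by the defect in `integral_lipMaj`, so the same bound results for every `n`. -/
theorem norm_J_le_of_lip (n p : ℕ) {a w : ℂ} (ha : 0 < a.re) (hw : 0 < w.re) (hw1 : w.re < 1)
    {T : ℝ} (hT : 1 ≤ T) :
    ‖J n (p + 1) a (w - 1) (-(T : ℂ))‖ ≤ Real.exp (Real.pi * |w.im|) *
      (1 + 2 * (‖(p : ℂ) + 2 + a - w‖ / ‖w‖)) * rbeta n (p + 2 + a.re - w.re) := by
  have hw0 : w ≠ 0 := fun h => by simp [h] at hw
  have hW : 0 < ‖w‖ := norm_pos_iff.mpr hw0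
  have hQ : 0 < (p : ℝ) + 2 + a.re - w.re := by linarith [p.cast_nonneg (α := ℝ)]
  have hI := (intervalIntegrable_remainder n (p + 1) ha (γ := w - 1) (by simpa using hw)
    (-(T : ℂ))).const_mul ((-1) ^ (p + 2))
  have h := norm_integral_le_of_norm_sub_deriv_le (countable_singleton (1 / T))
    (continuousOn_lipPrim n p ha hw T) (by
      have : (p : ℂ) + 2 + a ≠ 0 := fun h => by
        have := congrArg Complex.re h
        simp at this
        linarith [p.cast_nonneg (α := ℝ)]
      simp [lipPrim, Complex.zero_cpow this]) hI
    (intervalIntegrable_lipMaj n hQ (Real.exp (Real.pi * |w.im|) / ‖w‖)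
      (‖w‖ + 2 * ‖(p : ℂ) + 2 + a - w‖ - (p + 2 + a.re - w.re))) (by
      rintro u ⟨⟨hu0, hu1⟩, hne⟩
      have hne : T * u ≠ 1 := fun h => hne (by
        rw [mem_singleton_iff, eq_div_iff (by linarith), mul_comm]; exact h)
      rcases lt_or_gt_of_ne hne with hlt | hgt
      · exact lip_inner n p ha hw hw1 hT hu0 hu1 hlt
      · exact lip_outer n p ha hw hw1 hT hu0 hu1 hgt)
  rw [integral_lipMaj n hQ, intervalIntegral.integral_const_mul, norm_mul, norm_pow, norm_neg,
    norm_one, one_pow, one_mul] at h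
  have h1 := norm_lipPrim_one_le n p a hw hw1 hT
  rw [J]
  refine h.trans ?_
  calc _ ≤ Real.exp (Real.pi * |w.im|) / ‖w‖ * (‖w‖ + 2 * ‖(p : ℂ) + 2 + a - w‖) *
        rbeta n (p + 2 + a.re - w.re) := by linarith
    _ = _ := by field_simp

end BiorthAsymp

end

noncomputable section

namespace BiorthAsymp

open Set Filter Topology MeasureTheory

/-! ### From the lip of the cut to the plane -/

theorem exists_norm_K_le_of_pos (n : ℕ) {a w : ℂ} (ha : 0 < a.re) (hw : 0 < w.re) (hw1 : w.re ≤ 1) :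
    ∃ C : ℝ, ∀ ψ : ℂ, ‖K n a w ψ‖ ≤ C * (1 + ‖ψ‖) := by
  refine ⟨∫ u in (0 : ℝ)..1, Real.exp (Real.pi * |w.im|) * u ^ (a.re - 1), fun ψ => ?_⟩
  have hint : IntervalIntegrable (fun u : ℝ => Real.exp (Real.pi * |w.im|) * u ^ (a.re - 1))
      volume 0 1 := (intervalIntegral.intervalIntegrable_rpow' (by linarith)).const_mul _
  rw [← intervalIntegral.integral_mul_const]
  refine intervalIntegral.norm_integral_le_of_norm_le zero_le_one
    (Eventually.of_forall fun u hu => (norm_kern_le n a w ψ hu).trans ?_) (hint.mul_const _)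
  rw [mul_assoc]
  have h1 : 1 ≤ 1 + ‖ψ‖ := by linarith [norm_nonneg ψ]
  have h2 : ‖1 + ψ * u‖ ≤ 1 + ‖ψ‖ := by
    refine (norm_add_le _ _).trans ?_
    rw [norm_one, norm_mul, Complex.norm_real, Real.norm_of_nonneg hu.1.le]
    linarith [mul_le_of_le_one_right (norm_nonneg ψ) hu.2]
  have h3 : ‖1 + ψ * u‖ ^ w.re ≤ 1 + ‖ψ‖ :=
    calc _ ≤ (1 + ‖ψ‖) ^ w.re := Real.rpow_le_rpow (norm_nonneg _) h2 hw.le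
      _ ≤ (1 + ‖ψ‖) ^ (1 : ℝ) := Real.rpow_le_rpow_of_exponent_le h1 hw1
      _ = _ := Real.rpow_one _
  have := Real.rpow_nonneg hu.1.le (a.re - 1)
  gcongr

/-- The exponent `w - 1` has nonpositive real part, so integration by parts is used to reach
exponent `w`. This crude growth bound only serves the a priori boundedness required by
Phragmén–Lindelöf. -/
theorem exists_norm_K_le (n : ℕ) {a w : ℂ} (ha : 0 < a.re) (hw : 0 < w.re) (hw1 : w.re ≤ 1) :
    ∃ C : ℝ, ∀ ψ : ℂ, ψ.im ≤ 0 → ‖K n a (w - 1) ψ‖ ≤ C * (1 + ‖ψ‖) := by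
  have hw0 : w ≠ 0 := fun h => by simp [h] at hw
  obtain ⟨C₁, h₁⟩ := exists_norm_K_le_of_pos n ha hw hw1
  obtain ⟨C₂, h₂⟩ := exists_norm_K_le_of_pos (n - 1) (a := a + 1) (by simp; linarith) hw hw1
  refine ⟨(‖w + a‖ * C₁ + n * C₂ + Real.exp (Real.pi * |w.im|)) / ‖w‖, fun ψ hψ => ?_⟩
  have hW : 0 < ‖w‖ := norm_pos_iff.mpr hw0
  have hb : ‖if n = 0 then powLower (1 + ψ) w else 0‖ ≤ Real.exp (Real.pi * |w.im|) * (1 + ‖ψ‖) := by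
    have h1 : 1 ≤ 1 + ‖ψ‖ := by linarith [norm_nonneg ψ]
    split_ifs
    · refine (norm_powLower_le _ _).trans ?_
      gcongr
      calc _ ≤ (1 + ‖ψ‖) ^ w.re := by
            refine Real.rpow_le_rpow (norm_nonneg _) ((norm_add_le _ _).trans ?_) hw.le
            rw [norm_one]
        _ ≤ (1 + ‖ψ‖) ^ (1 : ℝ) := Real.rpow_le_rpow_of_exponent_le h1 hw1
        _ = _ := Real.rpow_one _
    · rw [norm_zero]; positivity
  rw [div_mul_eq_mul_div, le_div_iff₀ hW, mul_comm, ← norm_mul, mul_K_sub_one n ha hw hψ]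
  refine (norm_sub_le _ _).trans ((add_le_add (norm_sub_le _ _) hb).trans ?_)
  rw [norm_mul, norm_mul, Complex.norm_natCast]
  have h3 : ‖w + a‖ * ‖K n a w ψ‖ ≤ ‖w + a‖ * (C₁ * (1 + ‖ψ‖)) := by gcongr; exact h₁ ψ
  have h4 : (n : ℝ) * ‖K (n - 1) (a + 1) w ψ‖ ≤ n * (C₂ * (1 + ‖ψ‖)) := by gcongr; exact h₂ ψ
  linarith

theorem J_eq_div (n q : ℕ) {a γ : ℂ} (ha : 0 < a.re) (hγ : -1 < γ.re) {ψ : ℂ} (hψ : ψ ≠ 0) :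
    J n q a γ ψ = (K n a γ ψ -
      ∑ k ∈ Finset.range (q + 1), bc γ k * ψ ^ k * beta (n + 1) (a + k)) / ψ ^ (q + 1) := by
  rw [← pow_mul_J n q ha hγ hψ]
  field_simp

theorem exists_norm_J_le_of_norm_le_half (n q : ℕ) {a γ : ℂ} (ha : 0 < a.re) (hγ : -1 < γ.re) :
    ∃ C : ℝ, ∀ ψ : ℂ, ‖ψ‖ ≤ 1 / 2 → ‖J n q a γ ψ‖ ≤ C := by
  obtain ⟨C, hC⟩ := norm_rr_le_of_norm_le_half q hγ
  refine ⟨_, fun ψ hψ => norm_J_le_of_norm_r_le n q ha (c := C) fun u hu => ?_⟩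
  rw [r_eq_rr q hγ]
  refine hC _ ?_
  rw [norm_mul, Complex.norm_real, Real.norm_of_nonneg hu.1.le]
  exact (mul_le_of_le_one_right (norm_nonneg _) hu.2).trans hψ

/-- Away from `0`, division by `ψ^(q+1)` outweighs the linear growth of `K` and the subtracted
polynomial of degree `q`; near `0` the remainder is bounded pointwise. -/
theorem exists_norm_J_le_of_im_nonpos (n q : ℕ) {a w : ℂ} (ha : 0 < a.re) (hw : 0 < w.re) (hw1 : w.re ≤ 1) :
    ∃ C : ℝ, ∀ ψ : ℂ, ψ.im ≤ 0 → ‖J n q a (w - 1) ψ‖ ≤ C := by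
  have hγ : -1 < (w - 1).re := by simpa using hw
  obtain ⟨C₁, h₁⟩ := exists_norm_J_le_of_norm_le_half n q ha hγ
  obtain ⟨C₂, h₂⟩ := exists_norm_K_le n ha hw hw1
  have hC₂ : 0 ≤ C₂ := by
    have := (norm_nonneg _).trans (h₂ 0 (by simp)); simpa using this
  refine ⟨max C₁ (C₂ * (3 * 2 ^ q) + ∑ k ∈ Finset.range (q + 1),
    ‖bc (w - 1) k‖ * ‖beta (n + 1) (a + k)‖ * 2 ^ (q + 1 - k)), fun ψ hψ => ?_⟩
  rcases le_total ‖ψ‖ (1 / 2) with h | h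
  · exact (h₁ ψ h).trans (le_max_left _ _)
  · refine le_trans ?_ (le_max_right _ _)
    have hpos : 0 < ‖ψ‖ := by linarith
    have hinv : ∀ m : ℕ, (1 : ℝ) ≤ 2 ^ m * ‖ψ‖ ^ m := fun m => by
      rw [← mul_pow]; exact one_le_pow₀ (by linarith)
    rw [J_eq_div n q ha hγ (norm_pos_iff.mp hpos), norm_div, norm_pow, div_le_iff₀ (by positivity)]
    refine (norm_sub_le _ _).trans ?_
    rw [add_mul, Finset.sum_mul]
    refine add_le_add ((h₂ ψ hψ).trans ?_) ((norm_sum_le _ _).trans (Finset.sum_le_sum fun k hk => ?_))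
    · rw [mul_assoc]
      refine mul_le_mul_of_nonneg_left ?_ hC₂
      have h3 := hinv q
      have h4 : ‖ψ‖ ≤ ‖ψ‖ * (2 ^ q * ‖ψ‖ ^ q) := le_mul_of_one_le_right hpos.le h3
      rw [pow_succ]
      linarith
    · rw [norm_mul, norm_mul, norm_pow]
      have hk := Finset.mem_range.mp hk
      have h3 : ‖ψ‖ ^ k ≤ 2 ^ (q + 1 - k) * ‖ψ‖ ^ (q + 1) := by
        calc ‖ψ‖ ^ k ≤ ‖ψ‖ ^ k * (2 ^ (q + 1 - k) * ‖ψ‖ ^ (q + 1 - k)) :=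
              le_mul_of_one_le_right (by positivity) (hinv _)
          _ = 2 ^ (q + 1 - k) * (‖ψ‖ ^ k * ‖ψ‖ ^ (q + 1 - k)) := by ring
          _ = _ := by rw [← pow_add]; congr 2; omega
      calc _ = ‖bc (w - 1) k‖ * ‖beta (n + 1) (a + k)‖ * ‖ψ‖ ^ k := by ring
        _ ≤ ‖bc (w - 1) k‖ * ‖beta (n + 1) (a + k)‖ * (2 ^ (q + 1 - k) * ‖ψ‖ ^ (q + 1)) := by gcongr
        _ = _ := by ring

theorem differentiableAt_J (n q : ℕ) {a γ : ℂ} (ha : 0 < a.re) (hγ : -1 < γ.re) {ψ : ℂ}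
    (hψ : 1 + ψ ∈ Complex.slitPlane) (h0 : ψ ≠ 0) : DifferentiableAt ℂ (J n q a γ) ψ := by
  have hK := differentiableAt_K n ha hγ hψ
  have h : DifferentiableAt ℂ (fun ψ => (K n a γ ψ -
      ∑ k ∈ Finset.range (q + 1), bc γ k * ψ ^ k * beta (n + 1) (a + k)) / ψ ^ (q + 1)) ψ :=
    (hK.sub (by fun_prop)).div (by fun_prop) (pow_ne_zero _ h0)
  refine h.congr_of_eventuallyEq ?_
  filter_upwards [isOpen_ne.mem_nhds h0] with φ hφ
  exact J_eq_div n q ha hγ hφ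

theorem J_conj (n q : ℕ) {a γ : ℂ} (ha : 0 < a.re) (hγ : -1 < γ.re) {ψ : ℂ}
    (hψ : 1 + ψ ∈ Complex.slitPlane) (h0 : ψ ≠ 0) :
    J n q (starRingEnd ℂ a) (starRingEnd ℂ γ) (starRingEnd ℂ ψ) = starRingEnd ℂ (J n q a γ ψ) := by
  have hbc : ∀ k, bc (starRingEnd ℂ γ) k = starRingEnd ℂ (bc γ k) := fun k => by
    simp [bc, map_prod]
  have hbeta : ∀ k : ℕ, beta (n + 1) (starRingEnd ℂ a + k) =
      starRingEnd ℂ (beta (n + 1) (a + k)) := fun k => by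
    simp only [beta, map_div₀, map_mul, ← Complex.Gamma_conj]
    simp
  rw [J_eq_div n q (by simpa using ha) (by simpa using hγ) (by simpa using h0), J_eq_div n q ha hγ h0,
    K_conj n a γ hψ]
  simp only [hbc, hbeta, map_div₀, map_sub, map_sum, map_mul, map_pow]

/-- The integral `J`, with the removable singularity at `ψ = 0` removed. -/
def Jx (n q : ℕ) (a γ : ℂ) : ℂ → ℂ :=
  Function.update (J n q a γ) 0 (limUnder (𝓝[≠] 0) (J n q a γ))

theorem Jx_of_ne (n q : ℕ) (a γ : ℂ) {ψ : ℂ} (h : ψ ≠ 0) : Jx n q a γ ψ = J n q a γ ψ :=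
  Function.update_of_ne h _ _

theorem Jx_eventuallyEq (n q : ℕ) (a γ : ℂ) {ψ : ℂ} (h : ψ ≠ 0) :
    Jx n q a γ =ᶠ[𝓝 ψ] J n q a γ := by
  filter_upwards [isOpen_ne.mem_nhds h] with φ hφ using Jx_of_ne n q a γ hφ

theorem differentiableAt_Jx (n q : ℕ) {a γ : ℂ} (ha : 0 < a.re) (hγ : -1 < γ.re) {ψ : ℂ}
    (hψ : 1 + ψ ∈ Complex.slitPlane) : DifferentiableAt ℂ (Jx n q a γ) ψ := by
  by_cases h0 : ψ = 0
  · subst h0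
    obtain ⟨C, hC⟩ := exists_norm_J_le_of_norm_le_half n q ha hγ
    have hs : Metric.ball (0 : ℂ) (1 / 2) ∈ 𝓝 (0 : ℂ) := Metric.ball_mem_nhds _ (by norm_num)
    have h := Complex.differentiableOn_update_limUnder_of_bddAbove (f := J n q a γ) hs
      (fun φ hφ => (differentiableAt_J n q ha hγ (one_add_mem_slitPlane_of_norm_lt (by
        have := hφ.1
        rw [mem_ball_zero_iff] at this
        linarith)) hφ.2).differentiableWithinAt)
      ⟨C, by
        rintro _ ⟨φ, hφ, rfl⟩
        have := hφ.1
        rw [mem_ball_zero_iff] at this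
        exact hC φ this.le⟩
    exact h.differentiableAt hs
  · exact (differentiableAt_J n q ha hγ hψ h0).congr_of_eventuallyEq (Jx_eventuallyEq n q a γ h0)

theorem continuousOn_Jx (n q : ℕ) {a γ : ℂ} (ha : 0 < a.re) (hγ : -1 < γ.re) :
    ContinuousOn (Jx n q a γ) {ψ | ψ.im ≤ 0} := by
  intro ψ hψ
  by_cases h0 : ψ = 0
  · subst h0
    exact (differentiableAt_Jx n q ha hγ (by simp)).continuousAt.continuousWithinAt
  · have h : ContinuousWithinAt (fun ψ => (K n a γ ψ -
        ∑ k ∈ Finset.range (q + 1), bc γ k * ψ ^ k * beta (n + 1) (a + k)) / ψ ^ (q + 1))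
        {ψ | ψ.im ≤ 0} ψ :=
      ((continuousOn_K n ha hγ ψ hψ).sub
        (continuous_finsetSum _ fun k _ => by fun_prop).continuousWithinAt).div (by fun_prop) (pow_ne_zero _ h0)
    refine h.congr_of_eventuallyEq ?_ ?_
    · filter_upwards [nhdsWithin_le_nhds (isOpen_ne.mem_nhds h0)] with φ hφ
      rw [Jx_of_ne n q a γ hφ, J_eq_div n q ha hγ hφ]
    · rw [Jx_of_ne n q a γ h0, J_eq_div n q ha hγ h0]

theorem norm_Jx_le_of_lip_le (n q : ℕ) {a γ : ℂ} {C : ℝ}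
    (hC : ∀ T : ℝ, 1 ≤ T → ‖J n q a γ (-(T : ℂ))‖ ≤ C) (x : ℝ) :
    ‖Jx n q a γ ((x * Complex.I) ^ 2 - 1)‖ ≤ C := by
  have e : (x * Complex.I) ^ 2 - 1 = -(((1 + x ^ 2 : ℝ)) : ℂ) := by
    rw [mul_pow, Complex.I_sq]; push_cast; ring
  have h1 : 1 ≤ 1 + x ^ 2 := by nlinarith
  rw [e, Jx_of_ne]
  · exact hC _ h1
  · rw [neg_ne_zero]; exact_mod_cast (by linarith : (1 + x ^ 2 : ℝ) ≠ 0)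

theorem exists_sq_eq (x : ℂ) : ∃ ζ : ℂ, ζ ^ 2 = x ∧ 0 ≤ ζ.re ∧ (ζ.re = 0 → ζ.im ≤ 0) := by
  obtain ⟨ζ, hζ⟩ := IsAlgClosed.exists_pow_nat_eq x (n := 2) two_pos
  rcases lt_trichotomy ζ.re 0 with h | h | h
  · exact ⟨-ζ, by rw [neg_sq, hζ], by simp [h.le], fun h' => by simp at h'; linarith⟩
  · rcases le_total ζ.im 0 with hi | hi
    · exact ⟨ζ, hζ, h.ge, fun _ => hi⟩
    · exact ⟨-ζ, by rw [neg_sq, hζ], by simp [h], fun _ => by simpa using hi⟩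
  · exact ⟨ζ, hζ, h.le, fun h' => by linarith⟩

theorem sq_mem_slitPlane {ζ : ℂ} (h : 0 < ζ.re) : ζ ^ 2 ∈ Complex.slitPlane := by
  rw [Complex.mem_slitPlane_iff, sq, Complex.mul_re, Complex.mul_im]
  by_cases hi : ζ.im = 0
  · left; rw [hi]; nlinarith
  · right
    have : ζ.re * ζ.im ≠ 0 := mul_ne_zero h.ne' hi
    intro h'; apply this; linarith

/-- The map `ψ = ζ² - 1` carries the right half-plane to the plane cut along `(-∞,-1]`, and the
imaginary axis to the two lips. On the cut `J` has its lower values, so `f` is `J` on the lower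
quadrant and, on the upper one, the conjugate of `J` at conjugate parameters. The two agree in the
open half-plane wherever `ψ ≠ 0`, and `f` is bounded, so its values on the imaginary axis control
it. -/
theorem norm_J_le_of_lip_le (n q : ℕ) {a w : ℂ} (ha : 0 < a.re) (hw : 0 < w.re) (hw1 : w.re ≤ 1)
    {C : ℝ} (hC : ∀ T : ℝ, 1 ≤ T → ‖J n q a (w - 1) (-(T : ℂ))‖ ≤ C)
    (hC' : ∀ T : ℝ, 1 ≤ T →
      ‖J n q (starRingEnd ℂ a) (starRingEnd ℂ w - 1) (-(T : ℂ))‖ ≤ C) (ψ : ℂ) :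
    ‖J n q a (w - 1) ψ‖ ≤ C := by
  have hγ : -1 < (w - 1).re := by simpa using hw
  have ha' : 0 < (starRingEnd ℂ a).re := by simpa using ha
  have hw' : 0 < (starRingEnd ℂ w).re := by simpa using hw
  have hγ' : -1 < (starRingEnd ℂ w - 1).re := by simpa using hw
  have hC0 : 0 ≤ C := (norm_nonneg _).trans (hC 1 le_rfl)
  by_cases h0 : ψ = 0
  · subst h0
    have : J n q a (w - 1) 0 = 0 := by simp [J, r]
    rw [this, norm_zero]; exact hC0
  set f₁ : ℂ → ℂ := fun ζ => Jx n q a (w - 1) (ζ ^ 2 - 1) with hf₁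
  set f₂ : ℂ → ℂ := fun ζ => starRingEnd ℂ (Jx n q (starRingEnd ℂ a) (starRingEnd ℂ w - 1)
    (starRingEnd ℂ (ζ ^ 2 - 1))) with hf₂
  set f : ℂ → ℂ := fun ζ => if ζ.im ≤ 0 then f₁ ζ else f₂ ζ with hf
  set A : Set ℂ := {ζ | 0 ≤ ζ.re ∧ ζ.im ≤ 0} with hA
  set B : Set ℂ := {ζ | 0 ≤ ζ.re ∧ 0 ≤ ζ.im} with hB
  have him : ∀ ζ : ℂ, (ζ ^ 2 - 1).im = 2 * (ζ.re * ζ.im) := fun ζ => by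
    rw [sq, Complex.sub_im, Complex.mul_im, Complex.one_im]; ring
  have hmA : MapsTo (fun ζ : ℂ => ζ ^ 2 - 1) A {ψ | ψ.im ≤ 0} := fun ζ hζ => by
    have := mul_nonpos_of_nonneg_of_nonpos hζ.1 hζ.2
    rw [mem_ofPred_eq, him]; linarith
  have hmB : MapsTo (fun ζ : ℂ => starRingEnd ℂ (ζ ^ 2 - 1)) B {ψ | ψ.im ≤ 0} := fun ζ hζ => by
    have := mul_nonneg hζ.1 hζ.2
    rw [mem_ofPred_eq, Complex.conj_im, him]; linarith
  have hcA : ContinuousOn f₁ A := (continuousOn_Jx n q ha hγ).comp (by fun_prop) hmA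
  have hcB : ContinuousOn f₂ B :=
    Complex.continuous_conj.comp_continuousOn
      ((continuousOn_Jx n q ha' hγ').comp
        (Complex.continuous_conj.comp (by fun_prop)).continuousOn hmB)
  have heq : ∀ ζ : ℂ, 0 < ζ.re → ζ ^ 2 - 1 ≠ 0 → f₂ ζ = f₁ ζ := fun ζ hζ hne => by
    have hsl : 1 + (ζ ^ 2 - 1) ∈ Complex.slitPlane := by
      rw [add_sub_cancel]; exact sq_mem_slitPlane hζ
    have h := J_conj n q ha hγ hsl hne
    have e : starRingEnd ℂ (w - 1) = starRingEnd ℂ w - 1 := by simp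
    rw [e] at h
    simp only [hf₁, hf₂]
    rw [Jx_of_ne n q _ _ hne, Jx_of_ne n q _ _ ((map_ne_zero _).mpr hne), h, Complex.conj_conj]
  -- The conjugation identity is not available at `t = 1`, where `ψ = 0`, nor at `t = 0`, where `ψ =
  -- -1`; continuity supplies both points.
  have heqR : ∀ t : ℝ, 0 ≤ t → f₂ t = f₁ t := by
    have hc1 : ContinuousOn (fun t : ℝ => f₁ t) (Ici 0) :=
      hcA.comp Complex.continuous_ofReal.continuousOn fun t ht => ⟨by simpa using ht, by simp⟩
    have hc2 : ContinuousOn (fun t : ℝ => f₂ t) (Ici 0) :=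
      hcB.comp Complex.continuous_ofReal.continuousOn fun t ht => ⟨by simpa using ht, by simp⟩
    have hE : EqOn (fun t : ℝ => f₂ t) (fun t : ℝ => f₁ t) (Ioi 0 ∩ {1}ᶜ) := fun t ht => by
      refine heq t (by simpa using ht.1) ?_
      have ht1 : t ≠ 1 := ht.2
      have ht0 : 0 < t := ht.1
      have : t ^ 2 - 1 ≠ 0 := by
        rw [show t ^ 2 - 1 = (t - 1) * (t + 1) by ring]
        exact mul_ne_zero (sub_ne_zero.mpr ht1) (by linarith)
      exact_mod_cast this
    have hd : Dense ({1}ᶜ : Set ℝ) := dense_compl_singleton 1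
    have hcl : Ici (0 : ℝ) ⊆ closure (Ioi 0 ∩ {1}ᶜ) := by
      rw [← closure_Ioi]
      exact closure_minimal (hd.open_subset_closure_inter isOpen_Ioi) isClosed_closure
    exact fun t ht => hE.of_subset_closure hc2 hc1
      (fun t ht => mem_Ici.mpr (mem_Ioi.mp ht.1).le) hcl (mem_Ici.mpr ht)
  have hfA : EqOn f f₁ A := fun ζ hζ => if_pos hζ.2
  have hfB : EqOn f f₂ B := fun ζ hζ => by
    rcases hζ.2.eq_or_lt with h | h
    · have e : ζ = (ζ.re : ℂ) := Complex.ext rfl (by simp [← h])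
      rw [hf]
      simp only
      rw [if_pos h.ge, e]
      exact (heqR _ hζ.1).symm
    · exact if_neg (not_le.mpr h)
  have hfR : ∀ ζ : ℂ, 0 < ζ.re → f ζ = f₁ ζ := fun ζ hζ => by
    rcases le_or_gt ζ.im 0 with h | h
    · exact if_pos h
    · rw [hf]
      simp only
      rw [if_neg (not_le.mpr h)]
      refine heq ζ hζ fun h' => ?_
      have h2 := him ζ
      rw [h', Complex.zero_im] at h2
      have := mul_pos hζ h
      linarith
  have hAc : IsClosed A := (isClosed_Ici.preimage Complex.continuous_re).inter
    (isClosed_Iic.preimage Complex.continuous_im)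
  have hBc : IsClosed B := (isClosed_Ici.preimage Complex.continuous_re).inter
    (isClosed_Ici.preimage Complex.continuous_im)
  have hcf : ContinuousOn f (A ∪ B) :=
    (hcA.congr hfA).union_of_isClosed (hcB.congr hfB) hAc hBc
  have hd : DiffContOnCl ℂ f {ζ | 0 < ζ.re} := by
    refine ⟨fun ζ hζ => ?_, hcf.mono ?_⟩
    · have hζ : 0 < ζ.re := hζ
      have h1 : DifferentiableAt ℂ f₁ ζ :=
        (differentiableAt_Jx n q ha hγ (ψ := ζ ^ 2 - 1) (by
          rw [add_sub_cancel]; exact sq_mem_slitPlane hζ)).comp ζ (by fun_prop)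
      refine (h1.congr_of_eventuallyEq ?_).differentiableWithinAt
      filter_upwards [(isOpen_Ioi.preimage Complex.continuous_re).mem_nhds hζ] with ξ hξ
      exact hfR ξ hξ
    · rw [Complex.closure_setOfPred_lt_re]
      intro ζ hζ
      rcases le_total ζ.im 0 with h | h
      · exact Or.inl ⟨hζ, h⟩
      · exact Or.inr ⟨hζ, h⟩
  obtain ⟨M₁, hM₁⟩ := exists_norm_J_le_of_im_nonpos n q ha hw hw1
  obtain ⟨M₂, hM₂⟩ := exists_norm_J_le_of_im_nonpos n q ha' hw' (by simpa using hw1)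
  have hbd : ∀ ζ : ℂ, 0 < ζ.re → 1 < ‖ζ‖ → ‖f ζ‖ ≤ max M₁ M₂ := fun ζ hζ h1 => by
    have hne : ζ ^ 2 - 1 ≠ 0 := fun h => by
      have h2 := congrArg norm (sub_eq_zero.mp h)
      rw [norm_pow, norm_one] at h2
      nlinarith
    rcases le_total ζ.im 0 with h | h
    · rw [hfA ⟨hζ.le, h⟩, hf₁]
      simp only
      rw [Jx_of_ne n q _ _ hne]
      exact (hM₁ _ (hmA ⟨hζ.le, h⟩)).trans (le_max_left _ _)
    · rw [hfB ⟨hζ.le, h⟩, hf₂]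
      simp only
      rw [RCLike.norm_conj, Jx_of_ne n q _ _ ((map_ne_zero _).mpr hne)]
      exact (hM₂ _ (hmB ⟨hζ.le, h⟩)).trans (le_max_right _ _)
  have key : ∀ ζ : ℂ, 0 ≤ ζ.re → ‖f ζ‖ ≤ C := fun ζ hζ => by
    refine PhragmenLindelof.right_half_plane_of_bounded_on_real hd ⟨0, by norm_num, 0, ?_⟩ ?_
      (fun x => ?_) hζ
    · refine Asymptotics.IsBigO.of_bound (max M₁ M₂) ?_
      have h1 : ∀ᶠ ζ : ℂ in Bornology.cobounded ℂ, 1 < ‖ζ‖ :=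
        tendsto_norm_cobounded_atTop.eventually_gt_atTop 1
      filter_upwards [mem_inf_of_left h1, mem_inf_of_right (mem_principal_self _)] with ξ h2 h3
      simpa using hbd ξ h3 h2
    · refine ⟨max M₁ M₂, ?_⟩
      rw [eventually_map]
      filter_upwards [eventually_gt_atTop 1] with x hx
      refine hbd x (by simpa using by linarith) ?_
      rw [Complex.norm_real]
      exact hx.trans_le (le_abs_self _)
    · rcases le_total x 0 with h | h
      · rw [hfA ⟨by simp, by simpa using h⟩]
        exact norm_Jx_le_of_lip_le n q hC x
      · rw [hfB ⟨by simp, by simpa using h⟩, hf₂]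
        simp only
        rw [RCLike.norm_conj]
        have e : starRingEnd ℂ ((x * Complex.I) ^ 2 - 1) = (x * Complex.I) ^ 2 - 1 := by
          simp [mul_pow]
        rw [e]
        exact norm_Jx_le_of_lip_le n q hC' x
  -- On the imaginary axis the root with `Im ζ ≤ 0` is taken, so that `f ζ` is `J` itself rather
  -- than the value from the upper lip.
  obtain ⟨ζ, hζ, hre, hre'⟩ := exists_sq_eq (1 + ψ)
  have hζψ : ζ ^ 2 - 1 = ψ := by rw [hζ]; ring
  have hfζ : f ζ = f₁ ζ := by
    rcases hre.eq_or_lt with h | h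
    · exact hfA ⟨hre, hre' h.symm⟩
    · exact hfR ζ h
  have := key ζ hre
  rw [hfζ, hf₁] at this
  simp only at this
  rwa [hζψ, Jx_of_ne n q _ _ h0] at this

theorem norm_J_succ_le (n p : ℕ) {a w : ℂ} (ha : 0 < a.re) (hw : 0 < w.re) (hw1 : w.re < 1) (ψ : ℂ) :
    ‖J n (p + 1) a (w - 1) ψ‖ ≤ Real.exp (Real.pi * |w.im|) *
      (1 + 2 * (‖(p : ℂ) + 2 + a - w‖ / ‖w‖)) * rbeta n (p + 2 + a.re - w.re) := by
  refine norm_J_le_of_lip_le n (p + 1) ha hw hw1.le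
    (fun T hT => norm_J_le_of_lip n p ha hw hw1 hT) (fun T hT => ?_) ψ
  have h := norm_J_le_of_lip n p (a := starRingEnd ℂ a) (w := starRingEnd ℂ w) (by simpa using ha)
    (by simpa using hw) (by simpa using hw1) hT
  have e : (p : ℂ) + 2 + starRingEnd ℂ a - starRingEnd ℂ w =
      starRingEnd ℂ ((p : ℂ) + 2 + a - w) := by
    rw [map_sub, map_add, map_add, map_natCast, map_ofNat]
  rwa [e, RCLike.norm_conj, RCLike.norm_conj, Complex.conj_im, Complex.conj_re, Complex.conj_re,
    abs_neg] at h

end BiorthAsymp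

end

noncomputable section

namespace BiorthAsymp

open Set Filter Topology MeasureTheory

/-! ### The explicit bounds -/

/-- One more term is split off because the bound that is uniform in `ψ` concerns the index `p + 1`.
The factor `ψ` thus created is absorbed by `m₂`. -/
theorem J_eq_add (n p : ℕ) {a γ : ℂ} (ha : 0 < a.re) (hγ : -1 < γ.re) {ψ : ℂ} (hψ : ψ ≠ 0) :
    J n p a γ ψ = bc γ (p + 1) * beta (n + 1) (a + (p + 1 : ℕ)) + ψ * J n (p + 1) a γ ψ := by
  have h1 := pow_mul_J n p ha hγ hψ
  have h2 := pow_mul_J n (p + 1) ha hγ hψ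
  rw [Finset.sum_range_succ] at h2
  refine mul_left_cancel₀ (pow_ne_zero (p + 1) hψ) ?_
  rw [h1, mul_add]
  have : ψ ^ (p + 1) * (ψ * J n (p + 1) a γ ψ) = ψ ^ (p + 1 + 1) * J n (p + 1) a γ ψ := by
    rw [pow_succ ψ (p + 1)]; ring
  rw [this, h2]
  ring

theorem norm_beta_le_rbeta (n : ℕ) {b : ℂ} (hb : 0 < b.re) :
    ‖beta (n + 1) b‖ ≤ rbeta n b.re := by
  rw [← integral_beta n hb, rbeta]
  refine intervalIntegral.norm_integral_le_of_norm_le zero_le_one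
    (Eventually.of_forall fun u hu => le_of_eq ?_) (intervalIntegrable_rbeta n hb)
  rw [norm_mul, norm_pow, Complex.norm_cpow_eq_rpow_re_of_pos hu.1,
    show (1 : ℂ) - u = ((1 - u : ℝ) : ℂ) by push_cast; rfl, Complex.norm_real,
    Real.norm_of_nonneg (by linarith [hu.2])]
  simp

theorem norm_J_lt_of_re_neg (n p : ℕ) {a w ψ : ℂ} (ha : 0 < a.re) (hw : 0 < w.re) (hw1 : w.re < 1)
    (hψ : ψ ≠ 0) {M₂ M₃ : ℝ}
    (hM₂ : ‖ψ‖ * (Real.exp (Real.pi * |w.im|) * (1 + 2 * (‖(p : ℂ) + 2 + a - w‖ / ‖w‖))) ≤ M₂)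
    (hM₃ : ‖bc (w - 1) (p + 1)‖ < M₃) :
    ‖J n p a (w - 1) ψ‖ < (M₂ * (Real.Gamma (p + 2 + a.re - w.re) / Real.Gamma (p + 1 + a.re)) *
      (Real.Gamma (n + p + 2 + a.re) / Real.Gamma (n + 1 + (p + 2 + a.re - w.re))) + M₃) *
      rbeta n (p + 1 + a.re) := by
  have hp := p.cast_nonneg (α := ℝ)
  have hQ : 0 < (p : ℝ) + 2 + a.re - w.re := by linarith
  have hX : 0 < (p : ℝ) + 1 + a.re := by linarith
  -- The Gamma quotients in `c₁` and `c₂` are the ratio of the Beta value bounding `J_(p+1)` to the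
  -- one by which the bound is normalized.
  have hB1 : Real.Gamma (p + 2 + a.re - w.re) / Real.Gamma (p + 1 + a.re) *
      (Real.Gamma (n + p + 2 + a.re) / Real.Gamma (n + 1 + (p + 2 + a.re - w.re))) *
      rbeta n (p + 1 + a.re) = rbeta n (p + 2 + a.re - w.re) := by
    rw [rbeta_eq n hX, rbeta_eq n hQ]
    have h1 := (Real.Gamma_pos_of_pos hX).ne'
    have h2 := (Real.Gamma_pos_of_pos (by positivity : 0 < (n : ℝ) + p + 2 + a.re)).ne'
    rw [show (n : ℝ) + 1 + (p + 1 + a.re) = n + p + 2 + a.re by ring]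
    field_simp
  have hB0 := rbeta_pos n hX
  have hbeta : ‖beta (n + 1) (a + (p + 1 : ℕ))‖ ≤ rbeta n (p + 1 + a.re) := by
    have e : (a + (p + 1 : ℕ)).re = p + 1 + a.re := by
      rw [Complex.add_re, Complex.natCast_re]; push_cast; ring
    have := norm_beta_le_rbeta n (b := a + (p + 1 : ℕ)) (by rw [e]; exact hX)
    rwa [e] at this
  rw [J_eq_add n p ha (by simpa using hw) hψ, add_mul, mul_assoc M₂, mul_assoc M₂, hB1, add_comm]
  refine lt_of_le_of_lt (norm_add_le _ _) (add_lt_add_of_le_of_lt ?_ ?_)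
  · rw [norm_mul]
    calc _ ≤ ‖ψ‖ * (Real.exp (Real.pi * |w.im|) * (1 + 2 * (‖(p : ℂ) + 2 + a - w‖ / ‖w‖)) *
          rbeta n (p + 2 + a.re - w.re)) :=
          mul_le_mul_of_nonneg_left (norm_J_succ_le n p ha hw hw1 ψ) (norm_nonneg _)
      _ = ‖ψ‖ * (Real.exp (Real.pi * |w.im|) * (1 + 2 * (‖(p : ℂ) + 2 + a - w‖ / ‖w‖))) *
          rbeta n (p + 2 + a.re - w.re) := by ring
      _ ≤ _ := mul_le_mul_of_nonneg_right hM₂ (rbeta_pos n hQ).le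
  · rw [norm_mul]
    calc _ ≤ ‖bc (w - 1) (p + 1)‖ * rbeta n (p + 1 + a.re) :=
          mul_le_mul_of_nonneg_left hbeta (norm_nonneg _)
      _ < _ := mul_lt_mul_of_pos_right hM₃ hB0

theorem sinh_abs_im_le_norm_sin (z : ℂ) : Real.sinh |z.im| ≤ ‖Complex.sin z‖ := by
  refine le_of_sq_le_sq ?_ (norm_nonneg _)
  rw [← Complex.normSq_eq_norm_sq, Complex.sin_eq]
  have e : Complex.sin z.re * Complex.cosh z.im + Complex.cos z.re * Complex.sinh z.im * Complex.I =
      ((Real.sin z.re * Real.cosh z.im : ℝ) : ℂ) +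
        ((Real.cos z.re * Real.sinh z.im : ℝ) : ℂ) * Complex.I := by push_cast; ring
  rw [e, Complex.normSq_add_mul_I, ← Real.abs_sinh, sq_abs]
  have h1 := Real.sin_sq_add_cos_sq z.re
  have h2 := Real.cosh_sq z.im
  have h3 : (Real.sin z.re * Real.cosh z.im) ^ 2 + (Real.cos z.re * Real.sinh z.im) ^ 2 =
      Real.sin z.re ^ 2 + (Real.sin z.re ^ 2 + Real.cos z.re ^ 2) * Real.sinh z.im ^ 2 := by
    rw [mul_pow, mul_pow, h2]; ring
  rw [h3, h1]
  nlinarith [sq_nonneg (Real.sin z.re)]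

theorem sq_div_two_le_sinh {x : ℝ} (hx : 0 ≤ x) : x ^ 2 / 2 ≤ Real.sinh x := by
  have h1 : x / 4 ≤ Real.sinh (x / 4) := Real.self_le_sinh_iff.mpr (by positivity)
  have h2 : x / 2 ≤ Real.sinh (x / 2) := Real.self_le_sinh_iff.mpr (by positivity)
  have h3 : 1 + x ^ 2 / 8 ≤ Real.cosh (x / 2) := by
    have e : Real.cosh (x / 2) = 1 + 2 * Real.sinh (x / 4) ^ 2 := by
      rw [show x / 2 = 2 * (x / 4) by ring, Real.cosh_two_mul, Real.cosh_sq]; ring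
    rw [e]; nlinarith
  have e : Real.sinh x = 2 * Real.sinh (x / 2) * Real.cosh (x / 2) := by
    rw [← Real.sinh_two_mul]; congr 1; ring
  rw [e]
  calc x ^ 2 / 2 ≤ 2 * (x / 2) * (1 + x ^ 2 / 8) := by
        nlinarith [mul_nonneg hx (sq_nonneg (x - 2))]
    _ ≤ _ := by gcongr

/-- With `y = Im γ`, `|sin πγ| ≥ sinh(π|y|) ≥ π² y²/2`, and `D ≤ 3 < π` leaves at least `y²/2` after
division. Finally `‖γ‖² < 1 + y² ≤ (1 + y²/2)²`. -/
theorem norm_lt_one_add_norm_sin_div {γ : ℂ} (h1 : -1 < γ.re) (h0 : γ.re < 0) {D : ℝ} (hD0 : 0 < D)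
    (hD : D ≤ 3) : ‖γ‖ < 1 + ‖Complex.sin (Real.pi * γ)‖ / (Real.pi * D) := by
  have hpi := Real.pi_gt_three
  have h := sinh_abs_im_le_norm_sin (Real.pi * γ)
  rw [Complex.im_ofReal_mul, abs_mul, abs_of_pos Real.pi_pos] at h
  have h2 := (sq_div_two_le_sinh (mul_nonneg Real.pi_pos.le (abs_nonneg γ.im))).trans h
  have h3 : γ.im ^ 2 / 2 ≤ ‖Complex.sin (Real.pi * γ)‖ / (Real.pi * D) := by
    rw [le_div_iff₀ (by positivity)]
    refine le_trans ?_ h2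
    rw [mul_pow, sq_abs]
    have h4 : Real.pi * D ≤ Real.pi ^ 2 := by rw [sq]; gcongr; linarith
    have h5 : γ.im ^ 2 * (Real.pi * D) ≤ γ.im ^ 2 * Real.pi ^ 2 := by gcongr
    linarith
  refine lt_of_lt_of_le ?_ (add_le_add le_rfl h3)
  refine lt_of_pow_lt_pow_left₀ 2 (by positivity) ?_
  rw [sq_norm_eq_abs, sq_abs]
  nlinarith [sq_nonneg (γ.im ^ 2)]

/-- The parameter `δ` is `γ` for the first remainder and `γ + 2` for the second. For `p = 0` the
second entry of the maximum is needed; for larger `p` the summand `p exp(…)` of the first one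
suffices. -/
theorem norm_bc_lt_m3 (p : ℕ) {γ δ : ℂ} (h1 : -1 < γ.re) (h0 : γ.re < 0) (hδ0 : -1 < δ.re)
    (hδ : δ.re ≤ 2) (hs : Complex.sin (Real.pi * δ) = Complex.sin (Real.pi * γ))
    (hE : ‖γ‖ ^ 2 + γ.re ≤ ‖δ‖ ^ 2 + δ.re) : ‖bc γ (p + 1)‖ < m3 p δ := by
  rw [m3]
  cases p with
  | zero =>
    refine lt_max_of_lt_right ?_
    rw [zero_add, bc_one]
    have h := norm_lt_one_add_norm_sin_div h1 h0 (D := 1 + δ.re) (by linarith) (by linarith)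
    rwa [hs, norm_div, show (Real.pi : ℂ) * (1 + δ.re) = ((Real.pi * (1 + δ.re) : ℝ) : ℂ) by
      push_cast; rfl, Complex.norm_real,
      Real.norm_of_nonneg (mul_nonneg Real.pi_pos.le (by linarith))]
  | succ p =>
    refine lt_max_of_lt_left ((norm_bc_succ_le h1.le _).trans_lt ?_)
    have h2 := Real.exp_le_exp.mpr hE
    have h3 : 0 ≤ Real.exp (-Real.pi * δ.im) * ‖((p + 1 : ℕ) : ℂ) - δ + 1‖ := by positivity
    have h4 : 0 ≤ (p : ℝ) * Real.exp (‖δ‖ ^ 2 + δ.re) := by positivity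
    push_cast at h3 ⊢
    linarith

theorem norm_bc_lt_m3_add_two (p : ℕ) {γ : ℂ} (h1 : -1 < γ.re) (h0 : γ.re < 0) :
    ‖bc γ (p + 1)‖ < m3 p (γ + 2) := by
  refine norm_bc_lt_m3 p h1 h0 (by simp; linarith) (by simp; linarith) ?_ ?_
  · rw [show (Real.pi : ℂ) * (γ + 2) = Real.pi * γ + 2 * Real.pi by ring, Complex.sin_add_two_pi]
  · rw [sq_norm_eq_abs, sq_norm_eq_abs]
    simp only [Complex.add_re, Complex.add_im, Complex.re_ofNat, Complex.im_ofNat, add_zero]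
    nlinarith

/-- `‖z/(1-z)‖` is the middle factor of `m₂` with `‖z‖` in place of `‖z‖ + 1`, and the exponent `1 +
Re γ` is positive. -/
theorem norm_mul_le_m2_coe {z q γ : ℂ} (hz : z ≠ 0) (hγ : -1 < γ.re) :
    ‖z / (1 - z)‖ * (Real.exp (Real.pi * |γ.im|) * (1 + 2 * ‖(q + 1) / (γ + 1)‖)) ≤
      m2 (z : OnePoint ℂ) q γ := by
  change _ ≤ Real.exp (Real.pi * |γ.im|) *
      ((‖z‖ + 1) ^ (1 + γ.re) / (‖z - 1‖ * ‖z‖ ^ γ.re)) * (1 + 2 * ‖(q + 1) / (γ + 1)‖)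
  have hz0 : 0 < ‖z‖ := norm_pos_iff.mpr hz
  have h1 : ‖z / (1 - z)‖ ≤ (‖z‖ + 1) ^ (1 + γ.re) / (‖z - 1‖ * ‖z‖ ^ γ.re) := by
    have e : ‖z / (1 - z)‖ = ‖z‖ ^ (1 + γ.re) / (‖z - 1‖ * ‖z‖ ^ γ.re) := by
      have := (Real.rpow_pos_of_pos hz0 γ.re).ne'
      rw [norm_div, norm_sub_rev, Real.rpow_add hz0, Real.rpow_one, mul_comm ‖z - 1‖,
        mul_comm ‖z‖, mul_div_mul_left _ _ this]
    rw [e]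
    refine div_le_div_of_nonneg_right (Real.rpow_le_rpow hz0.le (by linarith) (by linarith))
      (by positivity)
  calc _ ≤ (‖z‖ + 1) ^ (1 + γ.re) / (‖z - 1‖ * ‖z‖ ^ γ.re) *
        (Real.exp (Real.pi * |γ.im|) * (1 + 2 * ‖(q + 1) / (γ + 1)‖)) := by gcongr
    _ = _ := by ring

theorem norm_mul_le_m2_sphereInv (z : ℂ) {q γ : ℂ} (hγ : -1 < γ.re) :
    ‖1 / (z - 1)‖ * (Real.exp (Real.pi * |γ.im|) * (1 + 2 * ‖(q + 1) / (γ + 1)‖)) ≤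
      m2 (sphereInv z) q γ := by
  rw [sphereInv]
  split_ifs with hz
  · subst hz
    change _ ≤ Real.exp (Real.pi * |γ.im|) * (1 + 2 * ‖(q + 1) / (γ + 1)‖)
    simp
  · refine le_trans (le_of_eq ?_) (norm_mul_le_m2_coe (inv_ne_zero hz) hγ)
    congr 2
    by_cases h1 : z = 1
    · simp [h1]
    · have h2 : z - 1 ≠ 0 := sub_ne_zero.mpr h1
      have h3 : 1 - z⁻¹ = (z - 1) / z := by field_simp
      rw [h3]; field_simp

theorem norm_xi1_le (n p : ℕ) {z α β : ℂ} (hz : z ≠ 1) (h : (α, β) ∈ Omega0) :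
    ‖xi1 n p z α β‖ ≤ 1 / poch ((n : ℝ) + 1 + (α - β).re) (p + 1) *
      (Real.Gamma (p + 1 + (α - β).re) / ‖Complex.Gamma (α - β)‖) *
      ‖z / (1 - z)‖ ^ (p + 1) * c1 n p z α β := by
  obtain ⟨hγ, ha⟩ : -1 < (α + β).re ∧ 0 < (α - β).re := h
  rw [xi1_eq]
  -- Both sides vanish here, which is why the first bound is not strict.
  by_cases hz0 : z = 0
  · simp [hz0]
  have hψ : z / (1 - z) ≠ 0 := div_ne_zero hz0 (sub_ne_zero.mpr hz.symm)
  rw [c1]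
  split_ifs with hg
  · exact explicit_bound n p ha (norm_J_le_of_norm_r_le n p ha fun u hu => norm_r_le_m1 p hg hψ hu)
  · push Not at hg
    refine (explicit_bound_lt n p ha hψ ?_).le
    have hw : (α + β + 1).re = (α + β).re + 1 := by simp
    have hwi : (α + β + 1).im = (α + β).im := by simp
    have h2 := norm_mul_le_m2_coe (q := p - 2 * β) hz0 hγ
    have hJ := norm_J_lt_of_re_neg n p (a := α - β) (w := α + β + 1) ha (by linarith) (by linarith)
      hψ (M₂ := m2 (z : OnePoint ℂ) (p - 2 * β) (α + β)) (M₃ := m3 p (α + β))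
      (by
        rw [hwi, ← norm_div, show (p : ℂ) + 2 + (α - β) - (α + β + 1) = p - 2 * β + 1 by ring]
        exact h2)
      (by
        rw [add_sub_cancel_right]
        exact norm_bc_lt_m3 p hγ hg hγ (by linarith) rfl le_rfl)
    have e : (p : ℝ) + 2 + (α - β).re - (α + β + 1).re = p + 1 - 2 * β.re := by
      simp; ring
    rw [e, add_sub_cancel_right,
      show (n : ℝ) + 1 + (p + 1 - 2 * β.re) = n + p + 2 - 2 * β.re by ring] at hJ
    exact hJ

theorem norm_xi2_lt (n p : ℕ) {z α β : ℂ} (hz : z ≠ 1) (h : (α, β) ∈ Omega0) :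
    ‖xi2 n p z α β‖ < 1 / poch ((n : ℝ) + 2 + (α + β).re) (p + 1) *
      (Real.Gamma (p + 2 + (α + β).re) / ‖Complex.Gamma (α + β + 1)‖) *
      (1 / ‖z - 1‖ ^ (p + 1)) * c2 n p z α β := by
  obtain ⟨hγ, ha⟩ : -1 < (α + β).re ∧ 0 < (α - β).re := h
  have hare : (α + β + 1).re = (α + β).re + 1 := by simp
  have hgre : (α - β - 1).re = (α - β).re - 1 := by simp
  have ha' : 0 < (α + β + 1).re := by linarith
  have hγ' : -1 < (α - β - 1).re := by linarith
  have hψ : 1 / (z - 1) ≠ 0 := one_div_ne_zero (sub_ne_zero.mpr hz)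
  suffices hJ : ‖J n p (α + β + 1) (α - β - 1) (1 / (z - 1))‖ <
      c2 n p z α β * rbeta n (p + 1 + (α + β + 1).re) by
    have := explicit_bound_lt n p ha' hψ hJ
    rw [← xi2_eq] at this
    rwa [hare, norm_div, norm_one, one_div_pow,
      show (n : ℝ) + 1 + ((α + β).re + 1) = n + 2 + (α + β).re by ring,
      show (p : ℝ) + 1 + ((α + β).re + 1) = p + 2 + (α + β).re by ring] at this
  rw [c2]
  split_ifs with hg
  · have hg' : 0 ≤ (α - β - 1).re := by linarith
    have e : ‖α - β - 1‖ ^ 2 + (α - β).re - 1 = ‖α - β - 1‖ ^ 2 + (α - β - 1).re := by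
      rw [hgre]; ring
    rw [e]
    exact norm_J_lt_of_norm_r_le n p ha' hγ' hψ (fun u hu => norm_r_le_m1 p hg' hψ hu)
      (norm_bc_lt_m1 p hg' _)
  · push Not at hg
    have h2 := norm_mul_le_m2_sphereInv z (q := p + 2 * β + 2) hγ'
    have hJ := norm_J_lt_of_re_neg n p (a := α + β + 1) (w := α - β) ha' ha hg
      hψ (M₂ := m2 (sphereInv z) (p + 2 * β + 2) (α - β - 1)) (M₃ := m3 p (α - β + 1))
      (by
        rw [← norm_div, show (p : ℂ) + 2 + (α + β + 1) - (α - β) = p + 2 * β + 2 + 1 by ring]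
        rw [sub_add_cancel, Complex.sub_im (α - β) 1, Complex.one_im, sub_zero] at h2
        exact h2)
      (by
        rw [show α - β + 1 = α - β - 1 + 2 by ring]
        exact norm_bc_lt_m3_add_two p hγ' (by linarith))
    have e : (p : ℝ) + 2 + (α + β + 1).re - (α - β).re = p + 2 * β.re + 3 := by
      simp; ring
    have e2 : (p : ℝ) + 1 + (α + β + 1).re = p + (α + β).re + 2 := by rw [hare]; ring
    have e3 : (n : ℝ) + p + 2 + (α + β + 1).re = n + p + 3 + (α + β).re := by rw [hare]; ring
    have e4 : (n : ℝ) + 1 + (p + 2 * β.re + 3) = n + p + 2 * β.re + 4 := by ring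
    rw [e, e2, e3, e4] at hJ
    rw [e2]
    exact hJ

end BiorthAsymp

end

theorem theorem1 :
    -- the exact decomposition, for all `n, p₁, p₂ ≥ 0`
    (∀ (n p₁ p₂ : ℕ) (z α β : ℂ), z ≠ 1 → (α, β) ∈ BiorthAsymp.Omega0 →
      BiorthAsymp.P n z α β =
        BiorthAsymp.g1 n z α β *
          (∑ k ∈ Finset.range (p₁ + 1), BiorthAsymp.term1 k n z α β +
            BiorthAsymp.xi1 n p₁ z α β) +
        BiorthAsymp.g2 n z α β *
          (∑ k ∈ Finset.range (p₂ + 1), BiorthAsymp.term2 k n z α β +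
            BiorthAsymp.xi2 n p₂ z α β)) ∧
    -- each remainder is `O` of the first omitted term as `n → ∞`, uniformly on compact sets
    (∀ (K : Set ℂ) (L : Set (ℂ × ℂ)), IsCompact K → K ⊆ {1}ᶜ →
      IsCompact L → L ⊆ BiorthAsymp.Omega0 → ∀ p : ℕ,
      (∃ (C : ℝ) (N : ℕ), ∀ n ≥ N, ∀ z ∈ K, ∀ α β : ℂ, (α, β) ∈ L →
        ‖BiorthAsymp.xi1 n p z α β‖ ≤ C * ‖BiorthAsymp.term1 (p + 1) n z α β‖) ∧
      (∃ (C : ℝ) (N : ℕ), ∀ n ≥ N, ∀ z ∈ K, ∀ α β : ℂ, (α, β) ∈ L →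
        ‖BiorthAsymp.xi2 n p z α β‖ ≤ C * ‖BiorthAsymp.term2 (p + 1) n z α β‖)) ∧
    -- the explicit bounds for the remainders
    (∀ (n p : ℕ) (z α β : ℂ), z ≠ 1 → (α, β) ∈ BiorthAsymp.Omega0 →
      ‖BiorthAsymp.xi1 n p z α β‖ ≤
        1 / BiorthAsymp.poch ((n : ℝ) + 1 + (α - β).re) (p + 1) *
          (Real.Gamma (p + 1 + (α - β).re) / ‖Complex.Gamma (α - β)‖) *
          ‖z / (1 - z)‖ ^ (p + 1) * BiorthAsymp.c1 n p z α β ∧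
      ‖BiorthAsymp.xi2 n p z α β‖ <
        1 / BiorthAsymp.poch ((n : ℝ) + 2 + (α + β).re) (p + 1) *
          (Real.Gamma (p + 2 + (α + β).re) / ‖Complex.Gamma (α + β + 1)‖) *
          (1 / ‖z - 1‖ ^ (p + 1)) * BiorthAsymp.c2 n p z α β) := by
  refine ⟨fun n p₁ p₂ z α β hz h => BiorthAsymp.decomposition n p₁ p₂ hz h,
    fun K L hK hK1 hL hLΩ p => ⟨?_, ?_⟩, fun n p z α β hz h => ?_⟩
  · obtain ⟨C, hC⟩ := BiorthAsymp.exists_norm_xi1_le hK hK1 hL hLΩ p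
    -- The constant serves all `n`, so the threshold is `0`.
    exact ⟨C, 0, fun n _ => hC n⟩
  · obtain ⟨C, hC⟩ := BiorthAsymp.exists_norm_xi2_le hK hK1 hL hLΩ p
    exact ⟨C, 0, fun n _ => hC n⟩
  · exact ⟨BiorthAsymp.norm_xi1_le n p hz h, BiorthAsymp.norm_xi2_lt n p hz h⟩
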